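/- Let $\Bbbk$ be a commutative ring; operads are non-symmetric differential graded operads over $\Bbbk$. A surjection $u:\{1,\dots,n+k\}\to\{1,\dots,n\}$ ($n\ge 1$), written as its sequence of values, is non-degenerate if $u(i)\ne u(i+1)$ for all $i$. For $1\le j\le n+k$ let $|u|_j$ be the number of $i<j$ such that $u(i)=u(i')$ for some $i'>i$. Let $\mathcal X(n)_k$ be free on these surjections (a sequence that is degenerate or not surjective represents $0$). The differential is $\delta(u)=\sum_i(-1)^{r_i}(u(1),\dots,\widehat{u(i)},\dots,u(n+k))$, over all $i$ such that the value $u(i)$ occurs more than once, where $r_i=|u|_i$ if $u(i)$ is not the last occurrence of its value, and $r_i=|u|_{j+1}$ if it is the last and $u(j)$ is the penultimate occurrence. For $v=(v_0,t,v_1,t,\dots,t,v_r)\in\mathcal X(m)$ with exactly $r$ occurrences of $t$, and $u\in\mathcal X(n)_k$, $$v\circ_t u=\sum_{1=j_0\le j_1\le\dots\le j_r=n+k}\pm(\beta v_0,\alpha u_1,\beta v_1,\dots,\alpha u_r,\beta v_r),\qquad u_p=(u(j_{p-1}),\dots,u(j_p)),$$ with $\alpha(s)=s+t-1$, $\beta(s)=s$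 for $s<t$ and $\beta(s)=s+n-1$ for $s>t$. The sign is the Koszul sign of the permutation $v_1,\dots,v_r,u_1,\dots,u_r\mapsto u_1,v_1,\dots,u_r,v_r$, where the degree of $u_p$ is $|u|_{j_p}-|u|_{j_{p-1}}$, and the degree of $v_q$ is the number of entries of $v$ that are not the last occurrence of their value, counted from the $q$-th occurrence of $t$ (included) to the $(q+1)$-st (excluded), or to the end of $v$ if $q=r$. A cactus is a non-degenerate surjection without subsequence $(i,j,i,j)$, $i\neq j$. The cacti span $\mathcal C=F_2\mathcal X\subset\mathcal X$, the operad of spineless cacti. Let $\mathcal A_\infty$ be the free graded operad on generators $m_n$ ($n\ge2$) of arity $n$ and degree $n-2$, with the differential $$\partial m_n=\sum_{\substack{p+q-1=n\\ p,q\ge2}}\ \sum_{i=1}^{p}(-1)^{(i-1)+q(p-i)}\,m_p\circ_i m_q .$$ Let $\mathcal C'_n$ be the set of all cacti in $\mathcal C(n)_{n-2}$ that contain no subsequence $(i,j,i)$ with $j=i+1$ or $j<i$. Put $p(u)=0$ for $u\in\mathcal C'_2=\{(1,2),(2,1)\}$. For $n\ge3$, each $u\in\mathcal C'_n$ is obtained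 from exactly one $v\in\mathcal C'_{n-1}$ by replacing one entry $v(j)\neq n-1$ by $(v(j),n,v(j))$; put $p(u)=p(v)+(n-3)+|v|_j+\varepsilon$, where $\varepsilon=1$ if $j>v^{-1}(n-1)$ and $\varepsilon=0$ otherwise. Theorem. $\mathcal A_\infty$ and $\mathcal C$ are non-symmetric differential graded operads, and there is a morphism of such operads $\psi:\mathcal A_\infty\to\mathcal C$ with $$\psi(m_2)=(2,1)+(1,2),\qquad \psi(m_n)=\sum_{u\in\mathcal C'_n}(-1)^{p(u)}\,u\quad(n\ge2).$$ -/

import Mathlib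

universe u

/-! Non-symmetric differential graded operads over a commutative ring `k`. -/

/-- The data of a (non-symmetric) dg operad: modules `obj n a` (arity `n`, degree `a`), a unit in
`obj 1 0`, partial compositions `∘_i : obj m a ⊗ obj n b → obj (m + n - 1) (a + b)` for `1 ≤ i ≤ m`,
and a differential of degree `-1`.  Arities and degrees of results are variables together with the
equation that determines them, so that no transport along equalities is needed. -/
structure DGOperadData (k : Type u) [CommRing k] where
  obj : ℕ → ℤ → Type u
  [grp : ∀ n a, AddCommGroup (obj n a)]
  [mod : ∀ n a, Module k (obj n a)]
  one : obj 1 0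
  circ : ∀ {m n p : ℕ} {a b c : ℤ} (i : ℕ), 1 ≤ i → i ≤ m → m + n = p + 1 → a + b = c →
    obj m a →ₗ[k] obj n b →ₗ[k] obj p c
  d : ∀ {n : ℕ} {a b : ℤ}, b + 1 = a → obj n a →ₗ[k] obj n b

attribute [instance] DGOperadData.grp DGOperadData.mod

namespace DGOperadData

variable {k : Type u} [CommRing k]

/-- The laws of a (non-symmetric) dg operad. -/
structure IsDGOperad (O : DGOperadData k) : Prop where
  d_d : ∀ {n : ℕ} {a b c : ℤ} (hab : b + 1 = a) (hbc : c + 1 = b) (x : O.obj n a),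
    O.d hbc (O.d hab x) = 0
  /-- `d (x ∘_i y) = (d x) ∘_i y + (-1)^|x| x ∘_i (d y)`. -/
  leibniz : ∀ {m n p : ℕ} {a a' b b' c c' : ℤ} (i : ℕ) (hi : 1 ≤ i) (him : i ≤ m)
    (hp : m + n = p + 1) (hc : a + b = c) (ha' : a' + 1 = a) (hb' : b' + 1 = b)
    (hc' : c' + 1 = c) (x : O.obj m a) (y : O.obj n b),
    O.d hc' (O.circ i hi him hp hc x y) =
      O.circ i hi him hp (by omega) (O.d ha' x) y +
        a.negOnePow • O.circ i hi him hp (by omega) x (O.d hb' y)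
  /-- `1 ∘_1 x = x`. -/
  one_circ : ∀ {n : ℕ} {a : ℤ} (x : O.obj n a),
    O.circ 1 le_rfl le_rfl (by omega) (by omega) O.one x = x
  /-- `x ∘_i 1 = x`. -/
  circ_one : ∀ {n : ℕ} {a : ℤ} (i : ℕ) (hi : 1 ≤ i) (hin : i ≤ n) (x : O.obj n a),
    O.circ i hi hin (by omega) (by omega) x O.one = x
  /-- `(x ∘_i y) ∘_j z = (-1)^(|y||z|) (x ∘_j z) ∘_{i+n-1} y` for `j < i`, `n` the arity of `z`. -/
  parallel : ∀ {l m n p q r : ℕ} {a b c e f g : ℤ} (i j : ℕ) (hj : 1 ≤ j) (hji : j < i)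
    (hil : i ≤ l) (hp : l + m = p + 1) (hq : l + n = q + 1) (hr : p + n = r + 1)
    (he : a + b = e) (hf : a + c = f) (hg : e + c = g)
    (x : O.obj l a) (y : O.obj m b) (z : O.obj n c),
    O.circ j hj (by omega) hr hg (O.circ i (by omega) hil hp he x y) z =
      (b * c).negOnePow • O.circ (i + n - 1) (by omega) (by omega) (by omega) (by omega)
        (O.circ j hj (by omega) hq hf x z) y
  /-- `(x ∘_i y) ∘_j z = x ∘_i (y ∘_{j-i+1} z)` for `i ≤ j < i + m`, `m` the arity of `y`. -/
  sequential : ∀ {l m n p q r : ℕ} {a b c e f g : ℤ} (i j : ℕ) (hi : 1 ≤ i) (hil : i ≤ l)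
    (hij : i ≤ j) (hjm : j < m + i) (hp : l + m = p + 1) (hq : m + n = q + 1)
    (hr : p + n = r + 1) (he : a + b = e) (hf : b + c = f) (hg : e + c = g)
    (x : O.obj l a) (y : O.obj m b) (z : O.obj n c),
    O.circ j (by omega) (by omega) hr hg (O.circ i hi hil hp he x y) z =
      O.circ i hi hil (by omega) (by omega) x
        (O.circ (j - i + 1) (by omega) (by omega) hq hf y z)

/-- Morphisms of (non-symmetric) dg operads. -/
structure Hom (O P : DGOperadData k) where
  map : ∀ {n : ℕ} {a : ℤ}, O.obj n a →ₗ[k] P.obj n a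
  map_one : map O.one = P.one
  map_circ : ∀ {m n p : ℕ} {a b c : ℤ} (i : ℕ) (hi : 1 ≤ i) (him : i ≤ m)
    (hp : m + n = p + 1) (hc : a + b = c) (x : O.obj m a) (y : O.obj n b),
    map (O.circ i hi him hp hc x y) = P.circ i hi him hp hc (map x) (map y)
  map_d : ∀ {n : ℕ} {a b : ℤ} (h : b + 1 = a) (x : O.obj n a), map (O.d h x) = P.d h (map x)

/-- The suboperad carried by submodules that contain the unit and are closed under composition and
the differential. -/
@[reducible]
noncomputable def sub (O : DGOperadData k) (S : ∀ (n : ℕ) (a : ℤ), Submodule k (O.obj n a))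
    (h_one : O.one ∈ S 1 0)
    (h_circ : ∀ {m n p : ℕ} {a b c : ℤ} (i : ℕ) (hi : 1 ≤ i) (him : i ≤ m)
      (hp : m + n = p + 1) (hc : a + b = c) (x : O.obj m a) (y : O.obj n b),
      x ∈ S m a → y ∈ S n b → O.circ i hi him hp hc x y ∈ S p c)
    (h_d : ∀ {n : ℕ} {a b : ℤ} (h : b + 1 = a) (x : O.obj n a), x ∈ S n a → O.d h x ∈ S n b) :
    DGOperadData k where
  obj n a := S n a
  one := ⟨O.one, h_one⟩
  circ {m n p a b c} i hi him hp hc :=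
    LinearMap.mk₂ k
      (fun (x : S m a) (y : S n b) =>
        (⟨O.circ i hi him hp hc x y, h_circ i hi him hp hc x y x.2 y.2⟩ : S p c))
      (fun x x' y => Subtype.ext (by simp))
      (fun r x y => Subtype.ext (by simp))
      (fun x y y' => Subtype.ext (by simp))
      (fun r x y => Subtype.ext (by simp))
  d {n a b} h := (O.d h).restrict (p := S n a) (q := S n b) (h_d h)

end DGOperadData

/-! The operad `A_∞`: the free operad on `m_n` (`n ≥ 2`, arity `n`, degree `n - 2`). -/

/-- Formal operadic monomials in the generators `m_n`. -/
inductive AExpr : ℕ → ℤ → Type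
  | one : AExpr 1 0
  | gen (n : ℕ) (a : ℤ) (hn : 2 ≤ n) (ha : a + 2 = n) : AExpr n a
  | circ {m n p : ℕ} {a b c : ℤ} (i : ℕ) (hi : 1 ≤ i) (him : i ≤ m) (hp : m + n = p + 1)
      (hc : a + b = c) (x : AExpr m a) (y : AExpr n b) : AExpr p c

/-- `AExpr.Rel x y s`: the operad laws impose `x = s • y` on monomials, where `s` is a sign. -/
inductive AExpr.Rel : ∀ {n : ℕ} {a : ℤ}, AExpr n a → AExpr n a → ℤˣ → Prop
  | one_circ {n : ℕ} {a : ℤ} (x : AExpr n a) :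
      Rel (.circ 1 le_rfl le_rfl (by omega) (by omega) .one x) x 1
  | circ_one {n : ℕ} {a : ℤ} (i : ℕ) (hi : 1 ≤ i) (hin : i ≤ n) (x : AExpr n a) :
      Rel (.circ i hi hin (by omega) (by omega) x .one) x 1
  | parallel {l m n p q r : ℕ} {a b c e f g : ℤ} (i j : ℕ) (hj : 1 ≤ j) (hji : j < i)
      (hil : i ≤ l) (hp : l + m = p + 1) (hq : l + n = q + 1) (hr : p + n = r + 1)
      (he : a + b = e) (hf : a + c = f) (hg : e + c = g)
      (x : AExpr l a) (y : AExpr m b) (z : AExpr n c) :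
      Rel (.circ j hj (by omega) hr hg (.circ i (by omega) hil hp he x y) z)
        (.circ (i + n - 1) (by omega) (by omega) (by omega) (by omega)
          (.circ j hj (by omega) hq hf x z) y)
        (b * c).negOnePow
  | sequential {l m n p q r : ℕ} {a b c e f g : ℤ} (i j : ℕ) (hi : 1 ≤ i) (hil : i ≤ l)
      (hij : i ≤ j) (hjm : j < m + i) (hp : l + m = p + 1) (hq : m + n = q + 1)
      (hr : p + n = r + 1) (he : a + b = e) (hf : b + c = f) (hg : e + c = g)
      (x : AExpr l a) (y : AExpr m b) (z : AExpr n c) :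
      Rel (.circ j (by omega) (by omega) hr hg (.circ i hi hil hp he x y) z)
        (.circ i hi hil (by omega) (by omega) x
          (.circ (j - i + 1) (by omega) (by omega) hq hf y z)) 1
  | congr_left {m n p : ℕ} {a b c : ℤ} (i : ℕ) (hi : 1 ≤ i) (him : i ≤ m)
      (hp : m + n = p + 1) (hc : a + b = c) (x x' : AExpr m a) (s : ℤˣ) (y : AExpr n b)
      (h : Rel x x' s) : Rel (.circ i hi him hp hc x y) (.circ i hi him hp hc x' y) s
  | congr_right {m n p : ℕ} {a b c : ℤ} (i : ℕ) (hi : 1 ≤ i) (him : i ≤ m)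
      (hp : m + n = p + 1) (hc : a + b = c) (x : AExpr m a) (y y' : AExpr n b) (s : ℤˣ)
      (h : Rel y y' s) : Rel (.circ i hi him hp hc x y) (.circ i hi him hp hc x y') s

namespace AInf

variable (k : Type u) [CommRing k]

/-- The linear span of the operad laws between monomials. -/
noncomputable def relSub (n : ℕ) (a : ℤ) : Submodule k (AExpr n a →₀ k) :=
  Submodule.span k {z | ∃ (x y : AExpr n a) (s : ℤˣ), AExpr.Rel x y s ∧
    z = Finsupp.single x 1 - s • Finsupp.single y 1}

/-- The free operad on the generators `m_n`, in arity `n` and degree `a`. -/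
abbrev Obj (n : ℕ) (a : ℤ) : Type u := (AExpr n a →₀ k) ⧸ relSub k n a

/-- The class of a monomial. -/
noncomputable def mon {n : ℕ} {a : ℤ} (x : AExpr n a) : Obj k n a :=
  (relSub k n a).mkQ (Finsupp.single x 1)

variable {k}

theorem mon_rel {n : ℕ} {a : ℤ} {x y : AExpr n a} {s : ℤˣ} (h : AExpr.Rel x y s) :
    mon k x = s • mon k y := by
  have : (relSub k n a).mkQ (Finsupp.single x 1 - s • Finsupp.single y 1) = 0 := by
    rw [Submodule.mkQ_apply, Submodule.Quotient.mk_eq_zero]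
    exact Submodule.subset_span ⟨x, y, s, h, rfl⟩
  rw [map_sub, sub_eq_zero] at this
  rw [mon, this, Units.smul_def, map_zsmul, ← Units.smul_def, mon]

/-- Linear maps out of `Obj` from values on monomials. -/
noncomputable def lift {n : ℕ} {a : ℤ} {M : Type u} [AddCommGroup M] [Module k M]
    (f : AExpr n a → M) (hf : ∀ x y s, AExpr.Rel x y s → f x = s • f y) : Obj k n a →ₗ[k] M :=
  (relSub k n a).liftQ (Finsupp.linearCombination k f) (by
    refine Submodule.span_le.2 ?_
    rintro z ⟨x, y, s, h, rfl⟩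
    simp only [SetLike.mem_coe, LinearMap.mem_ker, map_sub, Units.smul_def, map_zsmul,
      Finsupp.linearCombination_single, one_smul]
    rw [hf x y s h, Units.smul_def, sub_self])

theorem lift_mon {n : ℕ} {a : ℤ} {M : Type u} [AddCommGroup M] [Module k M]
    (f : AExpr n a → M) (hf : ∀ x y s, AExpr.Rel x y s → f x = s • f y) (x : AExpr n a) :
    lift (k := k) f hf (mon k x) = f x := by
  rw [lift, mon]
  refine (Submodule.liftQ_apply _ _ _).trans ?_
  rw [Finsupp.linearCombination_single, one_smul]

theorem hom_ext {n : ℕ} {a : ℤ} {M : Type u} [AddCommGroup M] [Module k M]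
    {f g : Obj k n a →ₗ[k] M} (h : ∀ x, f (mon k x) = g (mon k x)) : f = g := by
  refine Submodule.linearMap_qext _ (Finsupp.lhom_ext' fun x => LinearMap.ext_ring ?_)
  exact h x

variable (k)

/-- Partial composition, induced by composition of monomials. -/
noncomputable def circ {m n p : ℕ} {a b c : ℤ} (i : ℕ) (hi : 1 ≤ i) (him : i ≤ m)
    (hp : m + n = p + 1) (hc : a + b = c) : Obj k m a →ₗ[k] Obj k n b →ₗ[k] Obj k p c :=
  lift (fun x => lift (fun y => mon k (.circ i hi him hp hc x y))
      (fun y y' s h => mon_rel (.congr_right i hi him hp hc x y y' s h)))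
    (fun x x' s h => hom_ext fun y => by
      rw [Units.smul_def, LinearMap.smul_apply, ← Units.smul_def, lift_mon, lift_mon]
      exact mon_rel (.congr_left i hi him hp hc x x' s y h))

variable {k}

theorem circ_mon {m n p : ℕ} {a b c : ℤ} (i : ℕ) (hi : 1 ≤ i) (him : i ≤ m)
    (hp : m + n = p + 1) (hc : a + b = c) (x : AExpr m a) (y : AExpr n b) :
    circ k i hi him hp hc (mon k x) (mon k y) = mon k (.circ i hi him hp hc x y) := by
  rw [circ, lift_mon, lift_mon]

theorem map_units_smul {M N : Type u} [AddCommGroup M] [Module k M] [AddCommGroup N] [Module k N]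
    (f : M →ₗ[k] N) (s : ℤˣ) (x : M) : f (s • x) = s • f x := by
  rw [Units.smul_def, map_zsmul, ← Units.smul_def]

theorem units_smul_apply {M N : Type u} [AddCommGroup M] [Module k M] [AddCommGroup N]
    [Module k N] (f : M →ₗ[k] N) (s : ℤˣ) (x : M) : (s • f) x = s • f x := rfl

@[elab_as_elim]
theorem induction_mon {n : ℕ} {a : ℤ} {P : Obj k n a → Prop} (x : Obj k n a)
    (h0 : P 0) (hadd : ∀ x y, P x → P y → P (x + y)) (hsmul : ∀ (r : k) x, P (mon k x) →
    P (r • mon k x)) (hmon : ∀ x, P (mon k x)) : P x := by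
  obtain ⟨x, rfl⟩ := Submodule.mkQ_surjective _ x
  induction x using Finsupp.induction_linear with
  | zero => simpa using h0
  | add f g hf hg => rw [map_add]; exact hadd _ _ hf hg
  | single x r =>
    have : (relSub k n a).mkQ (Finsupp.single x r) = r • mon k x := by
      rw [mon, ← map_smul, Finsupp.smul_single, smul_eq_mul, mul_one]
    rw [this]; exact hsmul r x (hmon x)

theorem one_circ {n : ℕ} {a : ℤ} (x : Obj k n a) :
    circ k 1 le_rfl le_rfl (by omega) (by omega) (mon k .one) x = x := by
  refine induction_mon x (by simp) (fun x y hx hy => ?_) (fun r x hx => ?_) (fun x => ?_)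
  · rw [map_add, hx, hy]
  · rw [map_smul, hx]
  · rw [circ_mon, mon_rel (.one_circ x), one_smul]

theorem circ_one {n : ℕ} {a : ℤ} (i : ℕ) (hi : 1 ≤ i) (hin : i ≤ n) (x : Obj k n a) :
    circ k i hi hin (by omega) (by omega) x (mon k .one) = x := by
  refine induction_mon x (by simp) (fun x y hx hy => ?_) (fun r x hx => ?_) (fun x => ?_)
  · rw [map_add, LinearMap.add_apply, hx, hy]
  · rw [map_smul, LinearMap.smul_apply, hx]
  · rw [circ_mon, mon_rel (.circ_one i hi hin x), one_smul]

theorem parallel {l m n p q r : ℕ} {a b c e f g : ℤ} (i j : ℕ) (hj : 1 ≤ j) (hji : j < i)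
    (hil : i ≤ l) (hp : l + m = p + 1) (hq : l + n = q + 1) (hr : p + n = r + 1)
    (he : a + b = e) (hf : a + c = f) (hg : e + c = g)
    (x : Obj k l a) (y : Obj k m b) (z : Obj k n c) :
    circ k j hj (by omega) hr hg (circ k i (by omega) hil hp he x y) z =
      (b * c).negOnePow • circ k (i + n - 1) (by omega) (by omega) (by omega) (by omega)
        (circ k j hj (by omega) hq hf x z) y := by
  refine induction_mon x (by simp) (fun x x' hx hx' => ?_) (fun r x hx => ?_) (fun x => ?_)
  · simp only [map_add, LinearMap.add_apply, hx, hx', smul_add]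
  · simp only [map_smul, LinearMap.smul_apply, hx, smul_comm r]
  refine induction_mon y (by simp) (fun x x' hx hx' => ?_) (fun r x hx => ?_) (fun y => ?_)
  · simp only [map_add, LinearMap.add_apply, hx, hx', smul_add]
  · simp only [map_smul, LinearMap.smul_apply, hx, smul_comm r]
  refine induction_mon z (by simp) (fun x x' hx hx' => ?_) (fun r x hx => ?_) (fun z => ?_)
  · simp only [map_add, LinearMap.add_apply, hx, hx', smul_add]
  · simp only [map_smul, LinearMap.smul_apply, hx, smul_comm r]
  simp only [circ_mon]
  exact mon_rel (.parallel i j hj hji hil hp hq hr he hf hg x y z)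

theorem sequential {l m n p q r : ℕ} {a b c e f g : ℤ} (i j : ℕ) (hi : 1 ≤ i) (hil : i ≤ l)
    (hij : i ≤ j) (hjm : j < m + i) (hp : l + m = p + 1) (hq : m + n = q + 1)
    (hr : p + n = r + 1) (he : a + b = e) (hf : b + c = f) (hg : e + c = g)
    (x : Obj k l a) (y : Obj k m b) (z : Obj k n c) :
    circ k j (by omega) (by omega) hr hg (circ k i hi hil hp he x y) z =
      circ k i hi hil (by omega) (by omega) x
        (circ k (j - i + 1) (by omega) (by omega) hq hf y z) := by
  refine induction_mon x (by simp) (fun x x' hx hx' => ?_) (fun r x hx => ?_) (fun x => ?_)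
  · simp only [map_add, LinearMap.add_apply, hx, hx']
  · simp only [map_smul, LinearMap.smul_apply, hx]
  refine induction_mon y (by simp) (fun x x' hx hx' => ?_) (fun r x hx => ?_) (fun y => ?_)
  · simp only [map_add, LinearMap.add_apply, hx, hx']
  · simp only [map_smul, LinearMap.smul_apply, hx]
  refine induction_mon z (by simp) (fun x x' hx hx' => ?_) (fun r x hx => ?_) (fun z => ?_)
  · simp only [map_add, hx, hx']
  · simp only [map_smul, hx]
  simp only [circ_mon]
  rw [mon_rel (.sequential i j hi hil hij hjm hp hq hr he hf hg x y z), one_smul]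

variable (k)

/-- The differential of a generator:
`∂ m_n = ∑ (-1)^(i-1) (-1)^(q (p-i)) m_p ∘_i m_q`, over `p, q ≥ 2`, `p + q - 1 = n`,
`1 ≤ i ≤ p`. -/
noncomputable def dGen (n : ℕ) (b : ℤ) (hb : b + 3 = n) : Obj k n b :=
  ∑ p ∈ Finset.range (n + 1), ∑ q ∈ Finset.range (n + 1), ∑ i ∈ Finset.range (n + 1),
    if h : 2 ≤ p ∧ 2 ≤ q ∧ p + q = n + 1 ∧ 1 ≤ i ∧ i ≤ p then
      ((-1 : k) ^ ((i - 1) + q * (p - i))) •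
        circ k i h.2.2.2.1 h.2.2.2.2 h.2.2.1 (by omega)
          (mon k (.gen p (p - 2) h.1 (by omega))) (mon k (.gen q (q - 2) h.2.1 (by omega)))
    else 0

/-- The differential of a monomial, by the Leibniz rule. -/
noncomputable def dExpr : ∀ {n : ℕ} {a : ℤ}, AExpr n a → ∀ b : ℤ, b + 1 = a → Obj k n b
  | _, _, .one, _, _ => 0
  | _, _, .gen n a _ ha, b, hb => dGen k n b (by omega)
  | _, _, .circ (a := a) (b := b) i hi him hp hc x y, e, he =>
      circ k i hi him hp (by omega) (dExpr x (a - 1) (by omega)) (mon k y) +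
        a.negOnePow • circ k i hi him hp (by omega) (mon k x) (dExpr y (b - 1) (by omega))

theorem dExpr_rel {n : ℕ} {a : ℤ} {x y : AExpr n a} {s : ℤˣ} (h : AExpr.Rel x y s) :
    ∀ (b : ℤ) (hb : b + 1 = a), dExpr k x b hb = s • dExpr k y b hb := by
  induction h with
  | one_circ x =>
    rintro b hb
    obtain rfl : b = _ - 1 := eq_sub_of_add_eq hb
    simp only [dExpr, map_zero, LinearMap.zero_apply, zero_add, Int.negOnePow_zero, one_smul]
    exact one_circ _
  | circ_one i hi hin x =>
    rintro b hb
    obtain rfl : b = _ - 1 := eq_sub_of_add_eq hb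
    simp only [dExpr, map_zero, smul_zero, add_zero, one_smul]
    exact circ_one i hi hin _
  | @parallel l m n p q r a b c e f g i j hj hji hil hp hq hr he hf hg x y z =>
    rintro t ht
    subst he hf hg
    simp only [dExpr, map_add, LinearMap.add_apply, map_units_smul, units_smul_apply, ← circ_mon,
      smul_add]
    rw [parallel i j hj hji hil hp hq hr _ (f := a + c - 1) (by omega) (by omega) (dExpr k x _ _),
      parallel i j hj hji hil hp hq hr _ (f := a + c) (by omega) (by omega) _ (dExpr k y _ _),
      parallel i j hj hji hil hp hq hr _ (f := a + c - 1) (by omega) (by omega) _ _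
        (dExpr k z _ _)]
    simp only [smul_smul, ← Int.negOnePow_add]
    have e1 : (a + (b - 1) * c).negOnePow = (b * c + (a + c)).negOnePow :=
      (Int.negOnePow_eq_iff _ _).2 ⟨-c, by ring⟩
    have e2 : (a + b + b * (c - 1)).negOnePow = (b * c + a).negOnePow := by
      congr 1; ring
    rw [e1, e2]
    abel
  | @sequential l m n p q r a b c e f g i j hi hil hij hjm hp hq hr he hf hg x y z =>
    rintro t ht
    subst he hf hg
    simp only [dExpr, map_add, LinearMap.add_apply, map_units_smul, units_smul_apply, ← circ_mon,
      smul_add, one_smul]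
    rw [sequential i j hi hil hij hjm hp hq hr _ (f := b + c) (by omega) (by omega)
        (dExpr k x _ _),
      sequential i j hi hil hij hjm hp hq hr _ (f := b + c - 1) (by omega) (by omega) _
        (dExpr k y _ _),
      sequential i j hi hil hij hjm hp hq hr _ (f := b + c - 1) (by omega) (by omega) _ _
        (dExpr k z _ _)]
    simp only [smul_smul, ← Int.negOnePow_add]
    abel
  | congr_left i hi him hp hc x x' s y h ih =>
    rintro t ht
    simp only [dExpr, ih, mon_rel h, map_units_smul, units_smul_apply, smul_add,
      smul_comm s]
  | congr_right i hi him hp hc x y y' s h ih =>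
    rintro t ht
    simp only [dExpr, ih, mon_rel h, map_units_smul, smul_add, smul_comm s]

/-- The differential. -/
noncomputable def d {n : ℕ} {a b : ℤ} (h : b + 1 = a) : Obj k n a →ₗ[k] Obj k n b :=
  lift (fun x => dExpr k x b h) (fun _ _ _ hr => dExpr_rel k hr b h)

end AInf

/-- The dg operad `A_∞`. -/
@[reducible]
noncomputable def AInf (k : Type u) [CommRing k] : DGOperadData k where
  obj := AInf.Obj k
  one := AInf.mon k .one
  circ := AInf.circ k
  d := AInf.d k

/-- The generator `m_n` of `A_∞`. -/
noncomputable def AInf.m (k : Type u) [CommRing k] (n : ℕ) (hn : 2 ≤ n) :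
    (AInf k).obj n ((n : ℤ) - 2) :=
  AInf.mon k (.gen n (n - 2) hn (by omega))

/-! The surjection operad, with a surjection written as the list of its values.
Positions in lists are counted from `0`. -/

namespace Surj

/-- `u` is the sequence of values of a non-degenerate surjection onto `{1, …, n}`, `n ≥ 1`. -/
def IsNondeg (n : ℕ) (u : List ℕ) : Prop :=
  1 ≤ n ∧ (∀ x, x ∈ u ↔ 1 ≤ x ∧ x ≤ n) ∧ u.IsChain (· ≠ ·)

/-- Non-degenerate surjections `{1, …, n + a} → {1, …, n}`. -/
abbrev Seq (n : ℕ) (a : ℤ) : Type := {u : List ℕ // IsNondeg n u ∧ (u.length : ℤ) = n + a}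

/-- The number of positions before `j` that do not carry the last occurrence of their value, that
is, the relative degree of `(u 0, …, u j)` in `u`. -/
def relDeg (u : List ℕ) (j : ℕ) : ℕ :=
  ((Finset.range j).filter fun i => u.getD i 0 ∈ u.drop (i + 1)).card

/-- The relabelling of the values of `u` in `v ∘_t u`. -/
def alpha (t s : ℕ) : ℕ := s + t - 1

/-- The relabelling of the values of `v` in `v ∘_t u`, where `u` has arity `n`. -/
def beta (t n s : ℕ) : ℕ := if s < t then s else s + n - 1

/-- The terms `(e, w)`, standing for `(-1)^e w`, of `v ∘_t u`, where `u` has arity `n`.  With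
`v = (v_0, t, v_1, t, …, t, v_r)`, they are the sequences
`w = (β v_0, α u_1, β v_1, …, α u_r, β v_r)`, where `u_1, …, u_r` are the consecutive pieces of `u`
cut at positions `j_1 ≤ … ≤ j_{r-1}`, adjacent pieces sharing the letter at the cut.  Taking
`v_1, …, v_r, u_1, …, u_r` to `u_1, v_1, …, u_r, v_r` moves `u_p` across `v_p, …, v_r`, so the Koszul
rule gives `e = ∑_p |u_p| (|v_p| + … + |v_r|)`; here `|v_p| + … + |v_r|` is the relative degree of
the part of `v` from the `p`-th occurrence of `t` to the end.  The recursion reads `v` from the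
left; the argument `u` is what is left of the inner sequence, beginning with the letter at the last
cut.  Relative degrees of pieces are those in the whole sequence, because being a last occurrence
only depends on the letters to the right. -/
def compTerms (t n : ℕ) : List ℕ → List ℕ → List (ℕ × List ℕ)
  | [], _ => [(0, [])]
  | x :: v, u =>
    if x ≠ t then
      (compTerms t n v u).map fun s => (s.1, beta t n x :: s.2)
    else if t ∉ v then
      [(relDeg u u.length * relDeg (x :: v) (v.length + 1),
        u.map (alpha t) ++ v.map (beta t n))]
    else
      (List.range u.length).flatMap fun j =>
        (compTerms t n v (u.drop j)).map fun s =>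
          (relDeg u j * relDeg (x :: v) (v.length + 1) + s.1,
            (u.take (j + 1)).map (alpha t) ++ s.2)

/-- The terms `(e, w)`, standing for `(-1)^e w`, of the differential of `u`: the entry at position
`i` is skipped unless it is the only occurrence of its value.  The exponent is the relative degree
of `(u 0, …, u i)`, or, if `i` carries a last occurrence, that of `(u 0, …, u (j + 1))`, where `j`
carries the penultimate occurrence. -/
def dTerms (u : List ℕ) : List (ℕ × List ℕ) :=
  ((List.range u.length).filter fun i => decide (u.count (u.getD i 0) ≠ 1)).map fun i =>
    (if u.getD i 0 ∈ u.drop (i + 1) then relDeg u i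
      else relDeg u (Nat.findGreatest (fun j => u.getD j 0 = u.getD i 0) (i - 1) + 1),
      u.eraseIdx i)

variable (k : Type u) [CommRing k]

open Classical in
/-- The basis element given by a list; a list that is not a non-degenerate surjection represents
zero. -/
noncomputable def basis (n : ℕ) (a : ℤ) (w : List ℕ) : Seq n a →₀ k :=
  if h : IsNondeg n w ∧ (w.length : ℤ) = n + a then Finsupp.single ⟨w, h⟩ 1 else 0

/-- The element given by a list of signed terms. -/
noncomputable def ofTerms (n : ℕ) (a : ℤ) (L : List (ℕ × List ℕ)) : Seq n a →₀ k :=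
  (L.map fun s => ((-1 : k) ^ s.1) • basis k n a s.2).sum

/-- Partial composition `v ∘_t u`. -/
noncomputable def circ {m n p : ℕ} {a b c : ℤ} (t : ℕ) :
    (Seq m a →₀ k) →ₗ[k] (Seq n b →₀ k) →ₗ[k] (Seq p c →₀ k) :=
  Finsupp.linearCombination k fun v => Finsupp.linearCombination k fun u =>
    ofTerms k p c (compTerms t n v.1 u.1)

/-- The differential. -/
noncomputable def d {n : ℕ} {a b : ℤ} : (Seq n a →₀ k) →ₗ[k] (Seq n b →₀ k) :=
  Finsupp.linearCombination k fun u => ofTerms k n b (dTerms u.1)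

/-- The unit `(1)`. -/
noncomputable def one : Seq 1 0 →₀ k := basis k 1 0 [1]

end Surj

/-- The surjection operad. -/
@[reducible]
noncomputable def surjOperad (k : Type u) [CommRing k] : DGOperadData k where
  obj n a := Surj.Seq n a →₀ k
  one := Surj.one k
  circ t _ _ _ _ := Surj.circ k t
  d _ := Surj.d k

/-! Cacti. -/

/-- A sequence is a cactus if it has no subsequence `(i, j, i, j)` with `i ≠ j`. -/
def IsCactus (u : List ℕ) : Prop := ∀ i j, i ≠ j → ¬ [i, j, i, j].Sublist u

namespace Cactus

theorem sublist_alpha (t n : ℕ) : ∀ (v u : List ℕ), t ∈ v → (∀ x ∈ u, 1 ≤ x ∧ x ≤ n) →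
    ∀ e w, (e, w) ∈ Surj.compTerms t n v u →
    ∀ s : List ℕ, s.IsChain (· ≠ ·) → (∀ x ∈ s, t ≤ x ∧ x < t + n) → s.Sublist w →
      s.Sublist (u.map (Surj.alpha t))
  | [], _, htv, _ => by simp at htv
  | x :: v, u, htv, hu => by
    have hbeta : ∀ y, y ≠ t → ¬ (t ≤ Surj.beta t n y ∧ Surj.beta t n y < t + n) := by
      intro y hy
      unfold Surj.beta
      split_ifs <;> omega
    intro e w hw s hs hst hsw
    unfold Surj.compTerms at hw
    split_ifs at hw with h1 h2
    · obtain ⟨⟨e', w'⟩, hw', heq⟩ := List.mem_map.1 hw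
      obtain ⟨rfl, rfl⟩ := Prod.mk.inj heq
      have htv' : t ∈ v := (List.mem_cons.1 htv).resolve_left fun h => h1 h.symm
      refine sublist_alpha t n v u htv' hu _ _ hw' s hs hst ?_
      cases hsw with
      | cons _ h => exact h
      | cons_cons _ h => exact absurd (hst _ List.mem_cons_self) (hbeta x h1)
    · obtain ⟨j, hj, hw⟩ := List.mem_flatMap.1 hw
      obtain ⟨⟨e', w'⟩, hw', heq⟩ := List.mem_map.1 hw
      obtain ⟨rfl, rfl⟩ := Prod.mk.inj heq
      obtain ⟨s1, s2, rfl, hs1, hs2⟩ := List.sublist_append_iff.1 hsw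
      have hj := List.mem_range.1 hj
      have hs2 := sublist_alpha t n v (u.drop j) h2
        (fun y hy => hu y (List.mem_of_mem_drop hy)) _ _ hw' s2
        (List.IsChain.right_of_append hs)
        (fun y hy => hst y (List.mem_append_right _ hy)) hs2
      have hu' : u.map (Surj.alpha t) =
          (u.take j).map (Surj.alpha t) ++ (u.drop j).map (Surj.alpha t) := by
        rw [← List.map_append, List.take_append_drop]
      rw [hu']
      rw [List.take_succ_eq_append_getElem hj, List.map_append] at hs1
      obtain ⟨p1, p2, rfl, hp1, hp2⟩ := List.sublist_append_iff.1 hs1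
      rw [List.drop_eq_getElem_cons hj, List.map_cons] at hs2 ⊢
      rw [List.append_assoc]
      refine hp1.append ?_
      rw [List.map_singleton, List.sublist_singleton] at hp2
      rcases hp2 with rfl | rfl
      · exact hs2
      · cases hs2 with
        | cons _ h => exact h.cons_cons _
        | cons_cons _ h =>
          exfalso
          rw [List.append_assoc] at hs
          have := List.IsChain.right_of_append hs
          simp at this
    · obtain ⟨rfl, rfl⟩ := Prod.mk.inj (List.mem_singleton.1 hw)
      obtain ⟨s1, s2, rfl, hs1, hs2⟩ := List.sublist_append_iff.1 hsw
      have : s2 = [] := by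
        refine List.eq_nil_iff_forall_not_mem.2 fun y hy => ?_
        obtain ⟨z, hz, rfl⟩ := List.mem_map.1 (hs2.subset hy)
        exact hbeta z (fun h => h2 (h ▸ hz)) (hst _ (List.mem_append_right _ hy))
      rw [this, List.append_nil]
      exact hs1

/-- Left inverse of `beta`, sending all values of the inner sequence to `t`. -/
def collapse (t n x : ℕ) : ℕ := if x < t then x else if x < t + n then t else x + 1 - n

theorem collapse_beta (t n x : ℕ) (hx : x ≠ t) : collapse t n (Surj.beta t n x) = x := by
  unfold collapse Surj.beta
  split_ifs <;> omega

theorem collapse_alpha (t n : ℕ) (u : List ℕ) (hu : ∀ x ∈ u, 1 ≤ x ∧ x ≤ n) :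
    ∀ x ∈ (u.map (Surj.alpha t)).map (collapse t n), x = t := by
  intro x hx
  obtain ⟨y, hy, rfl⟩ := List.mem_map.1 hx
  obtain ⟨z, hz, rfl⟩ := List.mem_map.1 hy
  have := hu z hz
  unfold collapse Surj.alpha
  split_ifs <;> omega

theorem sublist_cons_of_chain (t : ℕ) (s1 s2 l v : List ℕ) (hl : ∀ x ∈ l, x = t)
    (h1 : s1.Sublist l) (hs : (s1 ++ s2).IsChain (· ≠ ·)) (h2 : s2.Sublist v) :
    (s1 ++ s2).Sublist (t :: v) := by
  match s1, h1, hs with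
  | [], _, _ => exact h2.cons _
  | [a], h1, _ =>
    obtain rfl := hl a (h1.subset List.mem_cons_self)
    exact h2.cons_cons _
  | a :: b :: r, h1, hs =>
    have ha := hl a (h1.subset List.mem_cons_self)
    have hb := hl b (h1.subset (List.mem_cons_of_mem _ List.mem_cons_self))
    simp [ha, hb] at hs

theorem sublist_collapse (t n : ℕ) : ∀ (v u : List ℕ),
    (∀ x ∈ u, 1 ≤ x ∧ x ≤ n) →
    ∀ e w, (e, w) ∈ Surj.compTerms t n v u →
    ∀ s : List ℕ, s.IsChain (· ≠ ·) → s.Sublist (w.map (collapse t n)) → s.Sublist v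
  | [], _, _ => by
    intro e w hw s _ hsw
    obtain ⟨rfl, rfl⟩ := Prod.mk.inj (List.mem_singleton.1 hw)
    exact hsw
  | x :: v, u, hu => by
    intro e w hw s hs hsw
    unfold Surj.compTerms at hw
    split_ifs at hw with h1 h2
    · obtain ⟨⟨e', w'⟩, hw', heq⟩ := List.mem_map.1 hw
      obtain ⟨rfl, rfl⟩ := Prod.mk.inj heq
      rw [List.map_cons, collapse_beta t n x h1] at hsw
      cases hsw with
      | cons _ h => exact (sublist_collapse t n v u hu _ _ hw' s hs h).cons _
      | cons_cons _ h =>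
        exact (sublist_collapse t n v u hu _ _ hw' _ (List.IsChain.tail hs) h).cons_cons _
    · obtain ⟨j, hj, hw⟩ := List.mem_flatMap.1 hw
      obtain ⟨⟨e', w'⟩, hw', heq⟩ := List.mem_map.1 hw
      obtain ⟨rfl, rfl⟩ := Prod.mk.inj heq
      rw [List.map_append] at hsw
      obtain ⟨s1, s2, rfl, hs1, hs2⟩ := List.sublist_append_iff.1 hsw
      rw [not_not.1 h1]
      exact sublist_cons_of_chain t s1 s2 _ v
        (collapse_alpha t n _ fun y hy => hu y (List.mem_of_mem_take hy)) hs1 hs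
        (sublist_collapse t n v (u.drop j) (fun y hy => hu y (List.mem_of_mem_drop hy)) _ _ hw'
          s2 (List.IsChain.right_of_append hs) hs2)
    · obtain ⟨rfl, rfl⟩ := Prod.mk.inj (List.mem_singleton.1 hw)
      have hv : (v.map (Surj.beta t n)).map (collapse t n) = v := by
        rw [List.map_map]
        conv_rhs => rw [← List.map_id v]
        exact List.map_congr_left fun y hy => collapse_beta t n y fun h => h2 (h ▸ hy)
      rw [List.map_append, hv] at hsw
      obtain ⟨s1, s2, rfl, hs1, hs2⟩ := List.sublist_append_iff.1 hsw
      rw [not_not.1 h1]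
      exact sublist_cons_of_chain t s1 s2 _ v (collapse_alpha t n u hu) hs1 hs hs2

theorem isCactus_comp (t n : ℕ) (ht : 1 ≤ t) (v u : List ℕ) (htv : t ∈ v)
    (hu : ∀ x ∈ u, 1 ≤ x ∧ x ≤ n) (hvc : IsCactus v) (huc : IsCactus u)
    (e : ℕ) (w : List ℕ) (h : (e, w) ∈ Surj.compTerms t n v u) : IsCactus w := by
  intro i j hij hs
  by_cases hin : (t ≤ i ∧ i < t + n) ∧ (t ≤ j ∧ j < t + n)
  · have := sublist_alpha t n v u htv hu e w h [i, j, i, j] (by simp [hij, hij.symm])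
      (by simp [hin]) hs
    have hmap : [i, j, i, j] = [i + 1 - t, j + 1 - t, i + 1 - t, j + 1 - t].map (Surj.alpha t) := by
      simp only [List.map_cons, List.map_nil, Surj.alpha]
      have : i + 1 - t + t - 1 = i := by omega
      have : j + 1 - t + t - 1 = j := by omega
      simp [*]
    have hback : ((u.map (Surj.alpha t)).map fun x => x + 1 - t) = u := by
      rw [List.map_map]
      conv_rhs => rw [← List.map_id u]
      refine List.map_congr_left fun y hy => ?_
      have := hu y hy
      simp only [Function.comp, Surj.alpha, id]
      omega
    have h2 := this.map fun x => x + 1 - t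
    rw [hback] at h2
    exact huc (i + 1 - t) (j + 1 - t) (by omega) h2
  · have hne : collapse t n i ≠ collapse t n j := by
      unfold collapse
      split_ifs <;> omega
    exact hvc _ _ hne (sublist_collapse t n v u hu e w h _ (by simp [hne, hne.symm])
      (hs.map (collapse t n)))

/-- The span of the cacti in the surjection operad. -/
noncomputable def span (k : Type u) [CommRing k] (n : ℕ) (a : ℤ) :
    Submodule k (Surj.Seq n a →₀ k) :=
  Finsupp.supported k k {u : Surj.Seq n a | IsCactus u.1}

theorem basis_mem (k : Type u) [CommRing k] (n : ℕ) (a : ℤ) (w : List ℕ) (hw : IsCactus w) :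
    Surj.basis k n a w ∈ span k n a := by
  unfold Surj.basis
  split_ifs with h
  · exact Finsupp.single_mem_supported k _ hw
  · exact Submodule.zero_mem _

theorem ofTerms_mem (k : Type u) [CommRing k] (n : ℕ) (a : ℤ) (L : List (ℕ × List ℕ))
    (hL : ∀ s ∈ L, IsCactus s.2) : Surj.ofTerms k n a L ∈ span k n a := by
  refine list_sum_mem fun x hx => ?_
  obtain ⟨s, hs, rfl⟩ := List.mem_map.1 hx
  exact Submodule.smul_mem _ _ (basis_mem k n a _ (hL s hs))

theorem one_mem (k : Type u) [CommRing k] : Surj.one k ∈ span k 1 0 := by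
  refine basis_mem k _ _ _ fun i j _ h => ?_
  have := h.length_le
  simp at this

theorem circ_mem (k : Type u) [CommRing k] {m n p : ℕ} {a b c : ℤ} (t : ℕ) (ht : 1 ≤ t)
    (htm : t ≤ m) (x : Surj.Seq m a →₀ k) (y : Surj.Seq n b →₀ k) (hx : x ∈ span k m a)
    (hy : y ∈ span k n b) : (Surj.circ k t x y : Surj.Seq p c →₀ k) ∈ span k p c := by
  rw [Surj.circ, Finsupp.linearCombination_apply, Finsupp.sum, LinearMap.sum_apply]
  refine Submodule.sum_mem _ fun v hv => ?_
  rw [LinearMap.smul_apply, Finsupp.linearCombination_apply, Finsupp.sum]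
  refine Submodule.smul_mem _ _ (Submodule.sum_mem _ fun u hu => Submodule.smul_mem _ _ ?_)
  refine ofTerms_mem k _ _ _ fun s hs => ?_
  exact isCactus_comp t n ht v.1 u.1 ((v.2.1.2.1 t).2 ⟨ht, htm⟩)
    (fun z hz => (u.2.1.2.1 z).1 hz) (hx hv) (hy hu) s.1 s.2 hs

theorem d_mem (k : Type u) [CommRing k] {n : ℕ} {a b : ℤ} (x : Surj.Seq n a →₀ k)
    (hx : x ∈ span k n a) : (Surj.d k x : Surj.Seq n b →₀ k) ∈ span k n b := by
  rw [Surj.d, Finsupp.linearCombination_apply, Finsupp.sum]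
  refine Submodule.sum_mem _ fun u hu => Submodule.smul_mem _ _ ?_
  refine ofTerms_mem k _ _ _ fun s hs => ?_
  obtain ⟨i, _, rfl⟩ := List.mem_map.1 hs
  intro p q hpq hsub
  exact hx hu p q hpq (hsub.trans (List.eraseIdx_sublist _ _))

end Cactus

/-- The operad of spineless cacti: the suboperad of the surjection operad spanned by the cacti. -/
@[reducible]
noncomputable def cactusOperad (k : Type u) [CommRing k] : DGOperadData k :=
  (surjOperad k).sub (Cactus.span k) (Cactus.one_mem k)
    (fun i hi him _ _ x y hx hy => Cactus.circ_mem k i hi him x y hx hy)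
    (fun _ x hx => Cactus.d_mem k x hx)

namespace Cactus

/-- The set `C'_n`: the cacti of arity `n` and degree `n - 2` without subsequences `(i, j, i)` with
`j = i + 1` or `j < i`. -/
def IsAdmissible (n : ℕ) (u : Surj.Seq n ((n : ℤ) - 2)) : Prop :=
  IsCactus u.1 ∧ ∀ i j, (j = i + 1 ∨ j < i) → ¬ [i, j, i].Sublist u.1

instance finite_seq (n : ℕ) (a : ℤ) : Finite (Surj.Seq n a) := by
  refine Finite.of_injective (β := Fin ((n : ℤ) + a).toNat → Fin (n + 1))
    (fun u i => ⟨u.1.getD i 0, ?_⟩) ?_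
  · have hl := u.2.2
    have hi := i.2
    have hi' : (i : ℕ) < u.1.length := by omega
    rw [List.getD_eq_getElem _ _ hi']
    have := ((u.2.1.2.1 _).1 (List.getElem_mem hi')).2
    omega
  · intro u v huv
    have hu := u.2.2
    have hv := v.2.2
    refine Subtype.ext (List.ext_getElem (by omega) fun i h1 h2 => ?_)
    have := congrFun huv ⟨i, by omega⟩
    simp only [Fin.mk.injEq] at this
    rwa [List.getD_eq_getElem _ _ h1, List.getD_eq_getElem _ _ h2] at this

open Classical in
/-- The set `C'_n` as a finite set. -/
noncomputable def admissible (n : ℕ) : Finset (Surj.Seq n ((n : ℤ) - 2)) :=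
  (Set.toFinite {u | IsAdmissible n u}).toFinset

/-- The sign exponent `p(u)` of `u ∈ C'_n`.  For `n = 2` it is `0`.  For `n ≥ 3` such a `u` arises
from a unique `v ∈ C'_(n-1)` by replacing a letter `v j` by `(v j, n, v j)`, and
`p(u) = p(v) + (n - 3) + |v|_j + ε`, where `|v|_j` is the relative degree of `(v 0, …, v j)` in `v`,
and `ε` is `1` if `j` is to the right of the position of `n - 1` in `v`, and `0` otherwise. -/
def signExp : ℕ → List ℕ → ℕ
  | 0, _ => 0
  | 1, _ => 0
  | 2, _ => 0
  | n + 3, u =>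
    let j := u.idxOf (n + 3) - 1
    let v := u.take (j + 1) ++ u.drop (j + 3)
    signExp (n + 2) v + n + Surj.relDeg v j + if v.idxOf (n + 2) < j then 1 else 0

end Cactus

/-! The operad structure. All operations are first defined on the free module on all words,
degenerate ones included. There each of them obeys a recursion on the first letter:
`diff_cons_of_mem` and `diff_cons_of_notMem` for the differential, `comp_cons_of_ne` and
`comp_word_cons_cons` for composition. Deleting one of two equal letters may leave a letter that
occurs once; the operator `drop`, which removes a letter that occurs exactly once, accounts for this
and commutes with everything (`diff_drop_word`, `drop_alpha_comp`, `drop_beta_comp`). With these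
recursions, `d² = 0` (`diff_diff_word`), the Leibniz rule (`diff_comp_word`) and the two
associativity laws (`comp_comp_word`, `comp_comm_word`) follow by induction on length. Degenerate
words are stable under the operations, so the identities descend to the surjection operad
(`map_ofSeq_toSeq`), and then restrict to the cacti.

The morphism. Let `h = ins N (N + 1)` be the signed sum over all ways of replacing a letter `y ≠ N`
by `(y, N + 1, y)`. Deleting one of the two copies of `y` slides `N + 1` past `y`, so `d h + h d`
telescopes. Starting from a word `u` in which `N` occurs once, what is left is `(N + 1, u) + (u, N +
1)` minus the two words with `N + 1` next to `N`. Writing `μ_2 = (1,2) + (2,1)`, this says `d h u +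
h d u = μ_2 ∘_1 u - u ∘_N μ_2` (`diff_ins`). Moreover `h` acts on a composite at an input other than
the last through the outer factor only (`ins_comp_left`), and at the last input as a signed
derivation in both factors (`ins_comp_last`).

Define `μ_{n+1} = ± h μ_n`. If `d μ_n` has the form required by `A_∞`, then `h d μ_n` gives all
terms required of `d μ_{n+1}` except `μ_2 ∘_1 μ_n` and `μ_n ∘_n μ_2`, and these are supplied by
`diff_ins` (`diff_mu_succ`).

The iterated insertions produce exactly the words of `C'_n`, each once (`mu_eq_sum`). Indeed,
deleting the largest letter of a word of `C'_{n+1}` leaves a word on `n` letters that is too long to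
be non-degenerate (`not_isChain_of_length`), so the neighbours of the deleted letter are equal.

On the side of `A_∞`, `d² = 0` on generators is a sign-reversing matching of terms (`cancel`). Since
`A_∞` is free, a family satisfying its relations in a dg operad defines a morphism (`evalHom`). -/

/-! The free module on words, and the operations of the surjection operad before passing to the
quotient by degenerate words. -/

/-- The free module on all words in natural numbers. -/
abbrev FreeWords (k : Type u) [CommRing k] : Type u := List ℕ →₀ k

namespace FreeWords

variable (k : Type u) [CommRing k]

/-- The basis element of a word. -/
noncomputable def word (w : List ℕ) : FreeWords k := Finsupp.single w 1

/-- The span of the words with property `P`. -/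
noncomputable def spanOf (P : List ℕ → Prop) : Submodule k (FreeWords k) :=
  Finsupp.supported k k {w | P w}

variable {k}

section Basic

variable {N : Type*} [AddCommGroup N] [Module k N]

/-- Linear extension of a function on words. -/
noncomputable def lin (f : List ℕ → N) : FreeWords k →ₗ[k] N := Finsupp.linearCombination k f

@[simp] theorem lin_word (f : List ℕ → N) (w : List ℕ) : lin f (word k w) = f w := by
  simp [lin, word]

theorem word_mem {P : List ℕ → Prop} {w : List ℕ} (h : P w) : word k w ∈ spanOf k P :=
  Finsupp.single_mem_supported k _ h

theorem spanOf_mono {P Q : List ℕ → Prop} (h : ∀ w, P w → Q w) {W : FreeWords k}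
    (hW : W ∈ spanOf k P) : W ∈ spanOf k Q :=
  Finsupp.supported_mono (s := {w | P w}) (t := {w | Q w}) h hW

theorem map_mem {P : List ℕ → Prop} {W : FreeWords k} (hW : W ∈ spanOf k P)
    (f : FreeWords k →ₗ[k] N) (S : Submodule k N) (h : ∀ w, P w → f (word k w) ∈ S) : f W ∈ S := by
  have hs : spanOf k P = Submodule.span k (word k '' {w | P w}) :=
    Finsupp.supported_eq_span_single k _
  rw [hs] at hW
  have : Submodule.span k (word k '' {w | P w}) ≤ S.comap f := by
    refine Submodule.span_le.2 ?_
    rintro _ ⟨w, hw, rfl⟩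
    exact h w hw
  exact this hW

/-- This turns identities for words with a condition on their letters into identities for the
outputs of `diff`, `drop` and `comp`, which are linear combinations of words that all satisfy the
condition. -/
theorem eq_of_mem {P : List ℕ → Prop} {W : FreeWords k} (hW : W ∈ spanOf k P)
    (f g : FreeWords k →ₗ[k] N) (h : ∀ w, P w → f (word k w) = g (word k w)) : f W = g W := by
  have := map_mem hW (f - g) ⊥ fun w hw => by simp [h w hw]
  simpa [sub_eq_zero] using this

theorem eq_zero_of_mem {P : List ℕ → Prop} {W : FreeWords k} (hW : W ∈ spanOf k P)
    (f : FreeWords k →ₗ[k] N) (h : ∀ w, P w → f (word k w) = 0) : f W = 0 :=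
  eq_of_mem hW f 0 (by simpa using h)

theorem mem_true (W : FreeWords k) : W ∈ spanOf k fun _ => True := by
  simp [spanOf]

theorem ext_word {f g : FreeWords k →ₗ[k] N} (h : ∀ w, f (word k w) = g (word k w)) : f = g :=
  LinearMap.ext fun W => eq_of_mem (mem_true W) f g fun w _ => h w

theorem spanOf_and {P Q : List ℕ → Prop} {W : FreeWords k} (hP : W ∈ spanOf k P)
    (hQ : W ∈ spanOf k Q) : W ∈ spanOf k fun w => P w ∧ Q w :=
  fun _ hw => ⟨hP hw, hQ hw⟩

end Basic

/-- Prepending a letter. -/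
noncomputable def cons (x : ℕ) : FreeWords k →ₗ[k] FreeWords k := lin fun w => word k (x :: w)

@[simp] theorem cons_word (x : ℕ) (w : List ℕ) : cons x (word k w) = word k (x :: w) := by
  simp [cons]

theorem cons_mem {P Q : List ℕ → Prop} {x : ℕ} {W : FreeWords k} (hW : W ∈ spanOf k P)
    (h : ∀ w, P w → Q (x :: w)) : cons x W ∈ spanOf k Q :=
  map_mem hW _ _ fun w hw => by rw [cons_word]; exact word_mem (h w hw)

/-! Degrees. -/

/-- `1` if `x` occurs in `u`, and `0` otherwise. -/
def rep (x : ℕ) (u : List ℕ) : ℕ := if x ∈ u then 1 else 0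

theorem rep_of_mem {x : ℕ} {u : List ℕ} (h : x ∈ u) : rep x u = 1 := if_pos h

theorem rep_of_notMem {x : ℕ} {u : List ℕ} (h : x ∉ u) : rep x u = 0 := if_neg h

theorem rep_congr {x y : ℕ} {u v : List ℕ} (h : x ∈ u ↔ y ∈ v) : rep x u = rep y v := by
  simp [rep, h]

theorem relDeg_zero (u : List ℕ) : Surj.relDeg u 0 = 0 := by simp [Surj.relDeg]

/-- Whether an entry is a last occurrence depends only on what stands to its right, so a new first
letter changes nothing for the others and counts itself exactly when it recurs. All sign recursions
come from this. -/
theorem relDeg_cons_succ (x : ℕ) (u : List ℕ) (j : ℕ) :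
    Surj.relDeg (x :: u) (j + 1) = rep x u + Surj.relDeg u j := by
  simp only [Surj.relDeg, Finset.card_filter, Finset.sum_range_succ', rep]
  rw [add_comm]
  simp

/-- The number of entries that are not the last occurrence of their value. -/
def deg (u : List ℕ) : ℕ := Surj.relDeg u u.length

@[simp] theorem deg_nil : deg [] = 0 := rfl

theorem deg_cons (x : ℕ) (u : List ℕ) : deg (x :: u) = rep x u + deg u :=
  relDeg_cons_succ x u u.length

/-- Each letter of `u` has exactly one last occurrence. -/
theorem deg_add_card (u : List ℕ) : deg u + u.toFinset.card = u.length := by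
  induction u with
  | nil => rfl
  | cons x u ih =>
    rw [deg_cons, List.toFinset_cons, List.length_cons, ← ih]
    by_cases h : x ∈ u
    · rw [rep_of_mem h, Finset.insert_eq_of_mem (List.mem_toFinset.2 h)]; ring
    · rw [rep_of_notMem h, Finset.card_insert_of_notMem (by simpa using h)]; ring

theorem deg_map_of_injOn {f : ℕ → ℕ} : ∀ {u : List ℕ}, (∀ x ∈ u, ∀ y ∈ u, f x = f y → x = y) →
    deg (u.map f) = deg u
  | [], _ => rfl
  | x :: u, h => by
    rw [List.map_cons, deg_cons, deg_cons, deg_map_of_injOn fun y hy z hz =>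
      h y (List.mem_cons_of_mem _ hy) z (List.mem_cons_of_mem _ hz)]
    congr 1
    refine rep_congr ⟨fun hx => ?_, List.mem_map_of_mem⟩
    obtain ⟨y, hy, e⟩ := List.mem_map.1 hx
    rwa [← h y (List.mem_cons_of_mem _ hy) x List.mem_cons_self e]

/-! Removing a value that occurs once. -/

variable (k) in
/-- The word without `x` if `x` occurs exactly once, and zero otherwise. -/
noncomputable def dropWord (x : ℕ) (u : List ℕ) : FreeWords k :=
  if u.count x = 1 then word k (u.erase x) else 0

/-- Removing `x` from words in which it occurs exactly once; other words are sent to zero. -/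
noncomputable def drop (x : ℕ) : FreeWords k →ₗ[k] FreeWords k := lin (dropWord k x)

theorem drop_word_of_notMem {x : ℕ} {u : List ℕ} (h : x ∉ u) : drop x (word k u) = 0 := by
  simp [drop, dropWord, List.count_eq_zero_of_not_mem h]

theorem drop_of_notMem {x : ℕ} {W : FreeWords k} (hW : W ∈ spanOf k fun w => x ∉ w) :
    drop x W = 0 :=
  eq_zero_of_mem hW _ fun _ h => drop_word_of_notMem h

theorem drop_cons_of_ne {x y : ℕ} (h : y ≠ x) (W : FreeWords k) :
    drop x (cons y W) = cons y (drop x W) := by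
  refine LinearMap.congr_fun (f := drop x ∘ₗ cons y) (g := cons y ∘ₗ drop x)
    (ext_word fun w => ?_) W
  simp only [LinearMap.comp_apply, cons_word, drop, lin_word, dropWord,
    List.count_cons_of_ne h, List.erase_cons_tail (show ¬ (y == x) = true by simpa using h)]
  split_ifs <;> simp

theorem drop_cons_self_of_mem {x : ℕ} {W : FreeWords k} (hW : W ∈ spanOf k fun w => x ∈ w) :
    drop x (cons x W) = 0 := by
  refine eq_zero_of_mem hW (drop x ∘ₗ cons x) fun w hw => ?_
  have : w.count x ≠ 0 := by rwa [Ne, List.count_eq_zero, not_not]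
  simp [drop, dropWord, this]

theorem drop_cons_self_of_notMem {x : ℕ} {W : FreeWords k}
    (hW : W ∈ spanOf k fun w => x ∉ w) : drop x (cons x W) = W := by
  refine eq_of_mem hW (drop x ∘ₗ cons x) LinearMap.id fun w hw => ?_
  simp [drop, dropWord, List.count_eq_zero_of_not_mem hw]

/-- A letter that occurs once is its own last occurrence, so its removal leaves the degree
unchanged. -/
theorem drop_word_mem (x : ℕ) (u : List ℕ) : drop x (word k u) ∈ spanOf k fun w =>
    (∀ z, z ∈ w ↔ z ∈ u ∧ z ≠ x) ∧ deg w = deg u ∧ w.length + 1 = u.length := by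
  rw [drop, lin_word, dropWord]
  split_ifs with h
  · have hx : x ∈ u := List.count_pos_iff.1 (by omega)
    have hm : ∀ z, z ∈ u.erase x ↔ z ∈ u ∧ z ≠ x := by
      intro z
      by_cases hz : z = x
      · subst hz
        simp only [ne_eq, not_true_eq_false, and_false, iff_false]
        rw [← List.count_eq_zero, List.count_erase_self, h]
      · rw [List.mem_erase_of_ne hz]; simp [hz]
    have hl : (u.erase x).length + 1 = u.length := by
      rw [List.length_erase_of_mem hx]
      have := List.length_pos_of_mem hx
      omega
    refine word_mem ⟨hm, ?_, hl⟩
    have h1 := deg_add_card u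
    have h2 := deg_add_card (u.erase x)
    have h3 : (u.erase x).toFinset = u.toFinset.erase x := by
      ext z; simp [hm, and_comm]
    rw [h3, Finset.card_erase_of_mem (List.mem_toFinset.2 hx)] at h2
    have : 0 < u.toFinset.card := Finset.card_pos.2 ⟨x, List.mem_toFinset.2 hx⟩
    omega
  · exact Submodule.zero_mem _

theorem drop_comm {x y : ℕ} (h : x ≠ y) (W : FreeWords k) :
    drop x (drop y W) = drop y (drop x W) := by
  refine LinearMap.congr_fun (f := drop x ∘ₗ drop y) (g := drop y ∘ₗ drop x)
    (ext_word fun w => ?_) W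
  simp only [LinearMap.comp_apply]
  induction w with
  | nil => simp [drop_word_of_notMem]
  | cons z w ih =>
    have aux : ∀ x y : ℕ, x ≠ y → drop x (drop y (word k (x :: w))) =
        drop y (drop x (word k (x :: w))) := by
      intro x y hxy
      rw [← cons_word, drop_cons_of_ne hxy]
      by_cases hw : x ∈ w
      · rw [drop_cons_self_of_mem (word_mem hw), drop_cons_self_of_mem, map_zero]
        exact spanOf_mono (fun v hv => (hv.1 x).2 ⟨hw, hxy⟩) (drop_word_mem y w)
      · rw [drop_cons_self_of_notMem (word_mem hw), drop_cons_self_of_notMem]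
        exact spanOf_mono (fun v hv => mt (hv.1 x).1 fun h => hw h.1) (drop_word_mem y w)
    by_cases hx : z = x
    · subst hx; exact aux z y h
    · by_cases hy : z = y
      · subst hy; exact (aux z x h.symm).symm
      · rw [← cons_word, drop_cons_of_ne hx, drop_cons_of_ne hy, drop_cons_of_ne hy,
          drop_cons_of_ne hx, ih]

/-! The differential. -/

variable (k) in
/-- The differential of a word. -/
noncomputable def diffWord : List ℕ → FreeWords k
  | [] => 0
  | x :: u => if x ∈ u then word k u - cons x (drop x (word k u)) - cons x (diffWord u)
      else cons x (diffWord u)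

/-- The differential. -/
noncomputable def diff : FreeWords k →ₗ[k] FreeWords k := lin (diffWord k)

@[simp] theorem diff_nil : diff (word k []) = 0 := by simp [diff, diffWord]

/-- Deleting the initial `x` has sign `+`. Deletions further right have their sign reversed, because
the initial `x` has degree one. If `x` occurs exactly once in a word of `W`, that entry cannot be
deleted there, but it can be after `x` is prepended: the penultimate occurrence is then the initial
one, the exponent is `1`, and this is the term with `drop`. -/
theorem diff_cons_of_mem {x : ℕ} {W : FreeWords k} (hW : W ∈ spanOf k fun w => x ∈ w) :
    diff (cons x W) = W - cons x (drop x W) - cons x (diff W) := by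
  refine eq_of_mem hW (diff ∘ₗ cons x) (LinearMap.id - cons x ∘ₗ drop x - cons x ∘ₗ diff)
    fun w hw => ?_
  simp [diff, diffWord, hw]

theorem diff_cons_of_notMem {x : ℕ} {W : FreeWords k} (hW : W ∈ spanOf k fun w => x ∉ w) :
    diff (cons x W) = cons x (diff W) := by
  refine eq_of_mem hW (diff ∘ₗ cons x) (cons x ∘ₗ diff) fun w hw => ?_
  simp [diff, diffWord, hw]

theorem diff_word_mem : ∀ u : List ℕ, diff (word k u) ∈ spanOf k fun w =>
    (∀ z, z ∈ w ↔ z ∈ u) ∧ w.length + 1 = u.length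
  | [] => by simp
  | x :: u => by
    have ih := diff_word_mem u
    rw [← cons_word]
    by_cases h : x ∈ u
    · rw [diff_cons_of_mem (word_mem h)]
      refine Submodule.sub_mem _ (Submodule.sub_mem _ (word_mem ⟨?_, rfl⟩)
        (cons_mem (drop_word_mem x u) fun w hw => ⟨fun z => ?_, ?_⟩))
        (cons_mem ih fun w hw => ⟨fun z => ?_, ?_⟩)
      · intro z
        simp only [List.mem_cons]
        exact ⟨Or.inr, fun hz => hz.elim (fun e => e ▸ h) id⟩
      · simp only [List.mem_cons, hw.1 z]; tauto
      · simp [hw.2.2]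
      · simp [hw.1 z]
      · simp [hw.2]
    · rw [diff_cons_of_notMem (word_mem h)]
      exact cons_mem ih fun w hw => ⟨fun z => by simp [hw.1 z], by simp [hw.2]⟩

theorem mem_diff_word (x : ℕ) {u : List ℕ} (h : x ∈ u) :
    diff (word k u) ∈ spanOf k fun w => x ∈ w :=
  spanOf_mono (fun _ hw => (hw.1 x).2 h) (diff_word_mem u)

theorem notMem_diff_word (x : ℕ) {u : List ℕ} (h : x ∉ u) :
    diff (word k u) ∈ spanOf k fun w => x ∉ w :=
  spanOf_mono (fun _ hw => mt (hw.1 x).1 h) (diff_word_mem u)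

theorem notMem_drop_word_self (x : ℕ) (u : List ℕ) :
    drop x (word k u) ∈ spanOf k fun w => x ∉ w :=
  spanOf_mono (fun _ hw => mt (hw.1 x).1 fun h' => h'.2 rfl) (drop_word_mem x u)

theorem mem_drop_word {x y : ℕ} (hxy : y ≠ x) {u : List ℕ} (h : y ∈ u) :
    drop x (word k u) ∈ spanOf k fun w => y ∈ w :=
  spanOf_mono (fun _ hw => (hw.1 y).2 ⟨h, hxy⟩) (drop_word_mem x u)

theorem notMem_drop_word {x y : ℕ} {u : List ℕ} (h : y ∉ u) :
    drop x (word k u) ∈ spanOf k fun w => y ∉ w :=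
  spanOf_mono (fun _ hw => mt (hw.1 y).1 fun h' => h h'.1) (drop_word_mem x u)

/-- An entry that is the only one of its value carries no degree, so its removal does not affect the
signs of other deletions. If `x` occurs exactly twice, the two deletions in the differential have
opposite signs and become equal after `drop x`. -/
theorem diff_drop_word (x : ℕ) : ∀ u : List ℕ,
    diff (drop x (word k u)) = drop x (diff (word k u))
  | [] => by simp [drop_word_of_notMem]
  | y :: u => by
    have ih := diff_drop_word x u
    rw [← cons_word]
    by_cases hy : y = x
    · subst hy
      by_cases h : y ∈ u
      · rw [drop_cons_self_of_mem (word_mem h), diff_cons_of_mem (word_mem h), map_sub, map_sub,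
          drop_cons_self_of_notMem (notMem_drop_word_self y u),
          drop_cons_self_of_mem (mem_diff_word y h)]
        simp
      · rw [drop_cons_self_of_notMem (word_mem h), diff_cons_of_notMem (word_mem h),
          drop_cons_self_of_notMem (notMem_diff_word y h)]
    · rw [drop_cons_of_ne hy]
      by_cases h : y ∈ u
      · rw [diff_cons_of_mem (mem_drop_word hy h), diff_cons_of_mem (word_mem h), map_sub, map_sub,
          drop_cons_of_ne hy, drop_cons_of_ne hy, ih, drop_comm (Ne.symm hy)]
      · rw [diff_cons_of_notMem (notMem_drop_word h), diff_cons_of_notMem (word_mem h),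
          drop_cons_of_ne hy, ih]

/-- When the first letter recurs, deleting it before or after differentiating the rest gives the
same element with opposite signs, and the two terms with `drop` cancel by `diff_drop_word`. -/
theorem diff_diff_word : ∀ u : List ℕ, diff (diff (word k u)) = 0
  | [] => by simp
  | x :: u => by
    have ih := diff_diff_word u
    rw [← cons_word]
    by_cases h : x ∈ u
    · rw [diff_cons_of_mem (word_mem h), map_sub, map_sub, diff_cons_of_mem (mem_diff_word x h),
        diff_cons_of_notMem (notMem_drop_word_self x u), ih, diff_drop_word]
      simp
    · rw [diff_cons_of_notMem (word_mem h), diff_cons_of_notMem (notMem_diff_word x h), ih,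
        map_zero]

theorem diff_diff (W : FreeWords k) : diff (diff W) = 0 :=
  eq_zero_of_mem (mem_true W) (diff ∘ₗ diff) fun w _ => diff_diff_word w

end FreeWords

/-! ### Composition of words by recursion on the first letters. -/

namespace FreeWords

variable {k : Type u} [CommRing k]

variable (k) in
/-- The element given by a list of signed words. -/
noncomputable def ofTerms (L : List (ℕ × List ℕ)) : FreeWords k :=
  (L.map fun s => ((-1 : k) ^ s.1) • word k s.2).sum

theorem ofTerms_append (L L' : List (ℕ × List ℕ)) :
    ofTerms k (L ++ L') = ofTerms k L + ofTerms k L' := by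
  simp [ofTerms]

theorem ofTerms_map_cons (e a : ℕ) (L : List (ℕ × List ℕ)) :
    ofTerms k (L.map fun s => (e + s.1, a :: s.2)) = (-1 : k) ^ e • cons a (ofTerms k L) := by
  induction L with
  | nil => simp [ofTerms]
  | cons s L ih =>
    simp only [ofTerms, List.map_cons, List.sum_cons, map_add, smul_add, List.map_map] at ih ⊢
    rw [ih]
    simp [pow_add, mul_smul]

/-- Partial composition, before passing to the quotient by degenerate words. -/
noncomputable def comp (t n : ℕ) : FreeWords k →ₗ[k] FreeWords k →ₗ[k] FreeWords k :=
  lin fun v => lin fun u => ofTerms k (Surj.compTerms t n v u)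

theorem comp_word (t n : ℕ) (v u : List ℕ) :
    comp t n (word k v) (word k u) = ofTerms k (Surj.compTerms t n v u) := by
  simp [comp]

/-- Relabelling. -/
noncomputable def relabel (f : ℕ → ℕ) : FreeWords k →ₗ[k] FreeWords k :=
  lin fun w => word k (w.map f)

@[simp] theorem relabel_word (f : ℕ → ℕ) (w : List ℕ) :
    relabel f (word k w) = word k (w.map f) := by simp [relabel]

theorem relabel_cons (f : ℕ → ℕ) (x : ℕ) (W : FreeWords k) :
    relabel f (cons x W) = cons (f x) (relabel f W) :=
  LinearMap.congr_fun (f := relabel f ∘ₗ cons x) (g := cons (f x) ∘ₗ relabel f)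
    (ext_word fun w => by simp) W

theorem comp_cons_of_ne {t x : ℕ} (h : x ≠ t) (n : ℕ) (V Y : FreeWords k) :
    comp t n (cons x V) Y = cons (Surj.beta t n x) (comp t n V Y) := by
  refine eq_of_mem (mem_true V) ((comp t n).flip Y ∘ₗ cons x)
    (cons (Surj.beta t n x) ∘ₗ (comp t n).flip Y) fun v _ => ?_
  refine eq_of_mem (mem_true Y) (comp t n (cons x (word k v)))
    (cons (Surj.beta t n x) ∘ₗ comp t n (word k v)) fun u _ => ?_
  rw [cons_word, LinearMap.comp_apply, comp_word, comp_word, Surj.compTerms, if_pos h]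
  have := ofTerms_map_cons (k := k) 0 (Surj.beta t n x) (Surj.compTerms t n v u)
  simpa using this

theorem comp_word_of_notMem (t n : ℕ) (u : List ℕ) : ∀ {v : List ℕ}, t ∉ v →
    comp t n (word k v) (word k u) = word k (v.map (Surj.beta t n))
  | [], _ => by simp [comp_word, Surj.compTerms, ofTerms]
  | x :: v, h => by
    rw [List.mem_cons, not_or] at h
    rw [← cons_word, comp_cons_of_ne (Ne.symm h.1), comp_word_of_notMem t n u h.2, cons_word,
      List.map_cons]

theorem comp_word_cons_last (t n : ℕ) {v : List ℕ} (h : t ∉ v) (u : List ℕ) :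
    comp t n (word k (t :: v)) (word k u) = (-1 : k) ^ (deg u * deg v) •
      word k (u.map (Surj.alpha t) ++ v.map (Surj.beta t n)) := by
  have : Surj.relDeg (t :: v) (v.length + 1) = deg v :=
    (deg_cons t v).trans (by rw [rep_of_notMem h, zero_add])
  rw [comp_word, Surj.compTerms, if_neg (by simp), if_pos h, this]
  simp [ofTerms, deg]

theorem comp_word_cons_nil (t n : ℕ) {v : List ℕ} (h : t ∈ v) :
    comp t n (word k (t :: v)) (word k []) = 0 := by
  rw [comp_word, Surj.compTerms, if_neg (by simp), if_neg (by simpa using h)]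
  simp [ofTerms]

/-- The first piece of the inner word starts with `y`. Either the cut is at `y`, so that `y` is
written and also begins the next piece (possible only if `t` occurs again), or the piece continues
beyond `y`. In the second case `y` contributes its degree `rep y u` to a piece that moves across
everything from this `t` to the end of the outer word. -/
theorem comp_word_cons_cons (t n : ℕ) (v : List ℕ) (y : ℕ) (u : List ℕ) :
    comp t n (word k (t :: v)) (word k (y :: u)) = cons (Surj.alpha t y)
      ((if t ∈ v then comp t n (word k v) (word k (y :: u)) else 0) +
        (-1 : k) ^ (rep y u * deg (t :: v)) • comp t n (word k (t :: v)) (word k u)) := by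
  by_cases h : t ∈ v
  · rw [if_pos h, comp_word, comp_word, comp_word, map_add, map_smul]
    have hd : Surj.relDeg (t :: v) (v.length + 1) = deg (t :: v) := rfl
    have e1 : ∀ u, Surj.compTerms t n (t :: v) u = (List.range u.length).flatMap fun j =>
        (Surj.compTerms t n v (u.drop j)).map fun s =>
          (Surj.relDeg u j * deg (t :: v) + s.1,
            (u.take (j + 1)).map (Surj.alpha t) ++ s.2) := by
      intro u
      rw [Surj.compTerms, if_neg (by simp), if_neg (by simpa using h)]
      rfl
    rw [← ofTerms_map_cons]
    have e2 := ofTerms_map_cons (k := k) 0 (Surj.alpha t y) (Surj.compTerms t n v (y :: u))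
    rw [pow_zero, one_smul] at e2
    rw [← e2, ← ofTerms_append, e1, e1 u, List.length_cons, List.range_succ_eq_map,
      List.flatMap_cons]
    congr 2
    · simp [relDeg_zero]
    · rw [List.flatMap_map, List.map_flatMap]
      simp only [List.map_map]
      congr 1
      funext j
      refine List.map_congr_left fun s _ => ?_
      simp only [relDeg_cons_succ, Function.comp, List.take_succ_cons, List.map_cons,
        List.cons_append, add_mul, add_assoc]
  · rw [if_neg h, comp_word_cons_last t n h, comp_word_cons_last t n h, zero_add, smul_smul,
      ← pow_add, map_smul, cons_word, deg_cons, deg_cons, rep_of_notMem h]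
    congr 2
    ring

/-- Besides the words themselves, the recursion depends only on whether `t` recurs, whether `y`
recurs, and the degree of the outer word. It is therefore linear in families where these three data,
recorded by `b`, `c` and `e`, are constant. -/
theorem comp_cons_cons {t : ℕ} (n : ℕ) {y e : ℕ} {b c : Prop} [Decidable b] [Decidable c]
    {V U : FreeWords k} (hV : V ∈ spanOf k fun v => (t ∈ v ↔ b) ∧ deg (t :: v) = e)
    (hU : U ∈ spanOf k fun u => y ∈ u ↔ c) :
    comp t n (cons t V) (cons y U) = cons (Surj.alpha t y)
      ((if b then comp t n V (cons y U) else 0) +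
        (-1 : k) ^ ((if c then 1 else 0) * e) • comp t n (cons t V) U) := by
  refine eq_of_mem hV ((comp t n).flip (cons y U) ∘ₗ cons t) (cons (Surj.alpha t y) ∘ₗ
    ((if b then (comp t n).flip (cons y U) else 0) + (-1 : k) ^ ((if c then 1 else 0) * e) •
      (comp t n).flip U ∘ₗ cons t)) (fun v hv => ?_) |>.trans (by split_ifs <;> simp)
  refine eq_of_mem hU (comp t n (cons t (word k v)) ∘ₗ cons y) (cons (Surj.alpha t y) ∘ₗ
    ((if b then comp t n (word k v) ∘ₗ cons y else 0) + (-1 : k) ^ ((if c then 1 else 0) * e) •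
      comp t n (cons t (word k v)))) (fun u hu => ?_) |>.trans (by split_ifs <;> simp)
  have hr : rep y u = if c then 1 else 0 := by simp [rep, hu]
  rw [LinearMap.comp_apply, cons_word, cons_word, comp_word_cons_cons, hv.2, hr]
  by_cases hb : b
  · rw [if_pos (hv.1.2 hb), if_pos hb]; split_ifs <;> simp
  · rw [if_neg (mt hv.1.1 hb), if_neg hb]; split_ifs <;> simp

theorem comp_cons_nil {t : ℕ} (n : ℕ) {V : FreeWords k} (hV : V ∈ spanOf k fun v => t ∈ v) :
    comp t n (cons t V) (word k []) = 0 :=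
  eq_zero_of_mem hV ((comp t n).flip (word k []) ∘ₗ cons t) fun v hv => by
    simpa using comp_word_cons_nil t n hv

theorem comp_of_notMem (t n : ℕ) (u : List ℕ) {V : FreeWords k}
    (hV : V ∈ spanOf k fun v => t ∉ v) :
    comp t n V (word k u) = relabel (Surj.beta t n) V :=
  eq_of_mem hV ((comp t n).flip (word k u)) _ fun v hv => by
    simpa using comp_word_of_notMem t n u hv

/-- The empty word has no letter at which it could be cut, so only words with a single `t` survive,
and there `t` simply disappears. Inductions that consume the inner word letter by letter end here.
-/
theorem comp_nil_right (t n : ℕ) : ∀ {v : List ℕ}, t ∈ v →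
    comp t n (word k v) (word k []) = relabel (Surj.beta t n) (drop t (word k v))
  | x :: v, h => by
    by_cases hx : x = t
    · subst hx
      rw [← cons_word]
      by_cases hv : x ∈ v
      · rw [drop_cons_self_of_mem (word_mem hv), comp_cons_nil n (word_mem hv), map_zero]
      · rw [drop_cons_self_of_notMem (word_mem hv), cons_word, comp_word_cons_last x n hv]
        simp
    · have hv := (List.mem_cons.1 h).resolve_left (Ne.symm hx)
      rw [← cons_word, drop_cons_of_ne hx, comp_cons_of_ne hx, comp_nil_right t n hv,
        relabel_cons]

/-! Letters, degree and length of the terms of a composition. -/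

theorem alpha_ne_beta {t n x y : ℕ} (hy : 1 ≤ y ∧ y ≤ n) (hx : x ≠ t) :
    Surj.alpha t y ≠ Surj.beta t n x := by
  unfold Surj.alpha Surj.beta
  split_ifs <;> omega

theorem beta_inj {t n x y : ℕ} (hx : x ≠ t) (hy : y ≠ t) (h : Surj.beta t n x = Surj.beta t n y) :
    x = y := by
  unfold Surj.beta at h
  split_ifs at h <;> omega

theorem alpha_inj {t x y : ℕ} (hx : 1 ≤ x) (hy : 1 ≤ y) (h : Surj.alpha t x = Surj.alpha t y) :
    x = y := by
  unfold Surj.alpha at h; omega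

/-- The letters of the words of a composition. -/
def IsCompLetter (t n : ℕ) (v u : List ℕ) (z : ℕ) : Prop :=
  (∃ y ∈ u, Surj.alpha t y = z) ∨ ∃ x ∈ v, x ≠ t ∧ Surj.beta t n x = z

theorem isCompLetter_alpha {t n : ℕ} {v u : List ℕ} {y : ℕ} (hu : ∀ x ∈ u, 1 ≤ x ∧ x ≤ n)
    (hy : 1 ≤ y ∧ y ≤ n) : IsCompLetter t n v u (Surj.alpha t y) ↔ y ∈ u := by
  refine ⟨?_, fun h => .inl ⟨y, h, rfl⟩⟩
  rintro (⟨x, hx, e⟩ | ⟨x, _, hxt, e⟩)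
  · rwa [← alpha_inj (hu x hx).1 hy.1 e]
  · exact absurd e.symm (alpha_ne_beta hy hxt)

theorem isCompLetter_beta {t n : ℕ} {v u : List ℕ} {y : ℕ} (hu : ∀ x ∈ u, 1 ≤ x ∧ x ≤ n)
    (hy : y ≠ t) : IsCompLetter t n v u (Surj.beta t n y) ↔ y ∈ v := by
  refine ⟨?_, fun h => .inr ⟨y, h, hy, rfl⟩⟩
  rintro (⟨x, hx, e⟩ | ⟨x, hx, hxt, e⟩)
  · exact absurd e (alpha_ne_beta (hu x hx) hy)
  · rwa [← beta_inj hxt hy e]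

/-- If `t` occurs `r` times, these entries are replaced by the letters of `u` with `r - 1` cut
letters doubled; the doubled letters make up for the degree lost with the occurrences of `t`. -/
theorem comp_word_mem {t n : ℕ} : ∀ (v u : List ℕ), (∀ x ∈ u, 1 ≤ x ∧ x ≤ n) → t ∈ v →
    comp t n (word k v) (word k u) ∈ spanOf k fun w => (∀ z, z ∈ w ↔ IsCompLetter t n v u z) ∧
      deg w = deg v + deg u ∧ w.length + 1 = v.length + u.length
  | x :: v, u, hu, h => by
    by_cases hx : x = t
    · subst hx
      match u, hu with
      | [], hu =>
        by_cases hv : x ∈ v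
        · rw [comp_word_cons_nil x n hv]; exact Submodule.zero_mem _
        · rw [comp_word_cons_last x n hv]
          refine Submodule.smul_mem _ _ (word_mem ⟨fun z => ?_, ?_, by simp⟩)
          · simp only [List.map_nil, List.nil_append, List.mem_map, IsCompLetter,
              List.not_mem_nil, false_and, exists_false, false_or, List.mem_cons]
            constructor
            · rintro ⟨a, ha, e⟩
              exact ⟨a, .inr ha, fun e' => hv (e' ▸ ha), e⟩
            · rintro ⟨a, ha, hax, e⟩
              exact ⟨a, ha.resolve_left hax, e⟩
          · rw [List.map_nil, List.nil_append, deg_cons, rep_of_notMem hv, deg_nil,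
              deg_map_of_injOn fun y hy z hz e => beta_inj (t := x) (fun e' => hv (e' ▸ hy))
                (fun e' => hv (e' ▸ hz)) e]
            omega
      | y :: u, hu =>
        have hy := hu y List.mem_cons_self
        have hu' : ∀ x ∈ u, 1 ≤ x ∧ x ≤ n := fun x hx => hu x (List.mem_cons_of_mem _ hx)
        rw [comp_word_cons_cons, map_add, map_smul]
        refine Submodule.add_mem _ ?_ (Submodule.smul_mem _ _
          (cons_mem (comp_word_mem (x :: v) u hu' h) ?_))
        · split_ifs with hv
          · refine cons_mem (comp_word_mem v (y :: u) hu hv) fun w hw => ⟨fun z => ?_, ?_, ?_⟩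
            · rw [List.mem_cons, hw.1]
              simp only [IsCompLetter, List.mem_cons]
              grind
            · rw [deg_cons, deg_cons x, hw.2.1, rep_of_mem hv,
                rep_of_mem ((hw.1 _).2 ((isCompLetter_alpha hu hy).2 List.mem_cons_self))]
              ring
            · simp only [List.length_cons] at hw ⊢; omega
          · rw [map_zero]; exact Submodule.zero_mem _
        · rintro w ⟨h1, h2, h3⟩
          refine ⟨fun z => ?_, ?_, ?_⟩
          · rw [List.mem_cons, h1]
            simp only [IsCompLetter, List.mem_cons]
            grind
          · rw [deg_cons, h2, deg_cons y, rep_congr ((h1 _).trans (isCompLetter_alpha hu' hy))]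
            ring
          · simp only [List.length_cons] at h3 ⊢; omega
    · have hv := (List.mem_cons.1 h).resolve_left (Ne.symm hx)
      rw [← cons_word, comp_cons_of_ne hx]
      refine cons_mem (comp_word_mem v u hu hv) fun w hw => ⟨fun z => ?_, ?_, ?_⟩
      · rw [List.mem_cons, hw.1]
        simp only [IsCompLetter, List.mem_cons]
        grind
      · rw [deg_cons, deg_cons, hw.2.1, rep_congr ((hw.1 _).trans (isCompLetter_beta hu hx))]
        ring
      · simp only [List.length_cons]; omega
  termination_by v u => v.length + u.length

end FreeWords

/-! ### Compatibility of composition with `drop`, and the Leibniz rule. -/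

namespace FreeWords

variable {k : Type u} [CommRing k]

theorem deg_eq_of_mem_iff {u w : List ℕ} {l : ℕ} (h : ∀ z, z ∈ w ↔ z ∈ u)
    (hl : w.length + l = u.length) : deg w + l = deg u := by
  have h1 := deg_add_card u
  have h2 := deg_add_card w
  have h3 : w.toFinset = u.toFinset := by ext z; simp [h]
  rw [h3] at h2
  omega

theorem deg_diff_word (u : List ℕ) : diff (word k u) ∈ spanOf k fun w => deg w + 1 = deg u :=
  spanOf_mono (fun _ hw => deg_eq_of_mem_iff hw.1 hw.2) (diff_word_mem u)

theorem mem_alpha_comp {t n : ℕ} {v u : List ℕ} (hu : ∀ x ∈ u, 1 ≤ x ∧ x ≤ n) (h : t ∈ v) {y : ℕ}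
    (hy : 1 ≤ y ∧ y ≤ n) :
    comp t n (word k v) (word k u) ∈ spanOf k fun w => Surj.alpha t y ∈ w ↔ y ∈ u :=
  spanOf_mono (fun _ hw => (hw.1 _).trans (isCompLetter_alpha hu hy)) (comp_word_mem v u hu h)

theorem mem_beta_comp {t n : ℕ} {v u : List ℕ} (hu : ∀ x ∈ u, 1 ≤ x ∧ x ≤ n) {y : ℕ}
    (hy : y ≠ t) :
    comp t n (word k v) (word k u) ∈ spanOf k fun w => Surj.beta t n y ∈ w ↔ y ∈ v := by
  by_cases h : t ∈ v
  · exact spanOf_mono (fun _ hw => (hw.1 _).trans (isCompLetter_beta hu hy))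
      (comp_word_mem v u hu h)
  · rw [comp_word_of_notMem t n u h]
    refine word_mem ⟨fun hz => ?_, List.mem_map_of_mem⟩
    obtain ⟨z, hz, e⟩ := List.mem_map.1 hz
    rwa [← beta_inj (fun e' : z = t => h (e' ▸ hz)) hy e]

/-- If `t` does not occur in `v`, the composite forgets `u`, so degrees do not add in general. The
alternative `u = []` has to be admitted because the inductions pass the last `t` precisely when the
inner word is used up. -/
theorem deg_comp {t n : ℕ} {v u : List ℕ} (hu : ∀ x ∈ u, 1 ≤ x ∧ x ≤ n) (h : t ∈ v ∨ u = []) :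
    comp t n (word k v) (word k u) ∈ spanOf k fun w => deg w = deg v + deg u := by
  by_cases hv : t ∈ v
  · exact spanOf_mono (fun _ hw => hw.2.1) (comp_word_mem v u hu hv)
  · obtain rfl := h.resolve_left hv
    rw [comp_word_of_notMem t n _ hv]
    refine word_mem ?_
    rw [deg_map_of_injOn fun y hy z hz e => beta_inj (t := t)
      (fun e' : y = t => hv (e' ▸ hy)) (fun e' : z = t => hv (e' ▸ hz)) e, deg_nil, add_zero]

theorem comp_cons_last_nil {t : ℕ} (n : ℕ) {V : FreeWords k} (hV : V ∈ spanOf k fun v => t ∉ v) :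
    comp t n (cons t V) (word k []) = comp t n V (word k []) :=
  eq_of_mem hV ((comp t n).flip (word k []) ∘ₗ cons t) ((comp t n).flip (word k []))
    fun v hv => by
      simp [comp_word_cons_last t n hv, comp_word_of_notMem t n _ hv]

/-- A cut at `y` doubles it, and doubled letters are killed by `drop`. The terms that survive come
from words with a single `y` and cuts elsewhere, that is, from the cuts of `u` without `y`; a single
`y` has degree zero and does not affect signs. -/
theorem drop_alpha_comp {t n y : ℕ} (hy : 1 ≤ y ∧ y ≤ n) : ∀ (v u : List ℕ),
    (∀ x ∈ u, 1 ≤ x ∧ x ≤ n) → t ∈ v →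
    drop (Surj.alpha t y) (comp t n (word k v) (word k u)) = comp t n (word k v) (drop y (word k u))
  | x :: v, u, hu, h => by
    by_cases hx : x = t
    · subst hx
      match u, hu with
      | [], hu =>
        rw [drop_word_of_notMem (List.not_mem_nil), map_zero]
        refine drop_of_notMem (spanOf_mono (fun w hw => ?_) (mem_alpha_comp hu h hy))
        simp [hw]
      | z :: u, hu =>
        have hz := hu z List.mem_cons_self
        have hu' : ∀ x ∈ u, 1 ≤ x ∧ x ≤ n := fun x hx => hu x (List.mem_cons_of_mem _ hx)
        have ih := drop_alpha_comp hy (x :: v) u hu' h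
        by_cases hzy : z = y
        · subst hzy
          rw [comp_word_cons_cons]
          rw [← cons_word z, map_add, map_smul, map_add, map_smul]
          have hA : drop (Surj.alpha x z) (cons (Surj.alpha x z)
              (if x ∈ v then comp x n (word k v) (cons z (word k u)) else 0)) = 0 := by
            split_ifs with hv
            · refine drop_cons_self_of_mem (spanOf_mono (fun w hw => ?_)
                (cons_word (k := k) z u ▸ mem_alpha_comp hu hv hy))
              simp [hw]
            · simp
          rw [hA, zero_add]
          by_cases hyu : z ∈ u
          · rw [drop_cons_self_of_mem (spanOf_mono (fun w hw => hw.2 hyu)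
              (mem_alpha_comp hu' h hy)), drop_cons_self_of_mem (word_mem hyu)]
            simp
          · rw [drop_cons_self_of_notMem (spanOf_mono (fun w hw => mt hw.1 hyu)
              (mem_alpha_comp hu' h hy)), drop_cons_self_of_notMem (word_mem hyu),
              rep_of_notMem hyu]
            simp
        · have hα : Surj.alpha x z ≠ Surj.alpha x y := fun e => hzy (alpha_inj hz.1 hy.1 e)
          rw [← cons_word x] at ih
          rw [comp_word_cons_cons, drop_cons_of_ne hα, ← cons_word z, drop_cons_of_ne hzy,
            ← cons_word x, comp_cons_cons n (b := x ∈ v) (c := z ∈ u) (word_mem ⟨Iff.rfl, rfl⟩)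
              (spanOf_mono (fun w hw => (hw.1 z).trans (and_iff_left hzy)) (drop_word_mem y u)),
            map_add, map_smul, ih]
          congr 2
          split_ifs with hv
          · rw [cons_word, drop_alpha_comp hy v (z :: u) hu hv, ← cons_word, drop_cons_of_ne hzy]
          · simp
    · have hv := (List.mem_cons.1 h).resolve_left (Ne.symm hx)
      rw [← cons_word, comp_cons_of_ne hx, comp_cons_of_ne hx,
        drop_cons_of_ne (alpha_ne_beta hy hx).symm, drop_alpha_comp hy v u hu hv]
  termination_by v u => v.length + u.length

/-- A letter `x ≠ t` of `v` is only relabelled, so its number of occurrences is the same in all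
terms. -/
theorem drop_beta_comp {t n x : ℕ} (hxt : x ≠ t) : ∀ (v u : List ℕ),
    (∀ x ∈ u, 1 ≤ x ∧ x ≤ n) →
    drop (Surj.beta t n x) (comp t n (word k v) (word k u)) = comp t n (drop x (word k v)) (word k u)
  | [], u, hu => by
    rw [comp_word_of_notMem t n u List.not_mem_nil, drop_word_of_notMem (List.not_mem_nil),
      List.map_nil, drop_word_of_notMem (List.not_mem_nil), map_zero, LinearMap.zero_apply]
  | y :: v, u, hu => by
    by_cases hyt : y = t
    · subst hyt
      match u, hu with
      | [], hu =>
        have ih := drop_beta_comp hxt v [] hu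
        rw [← cons_word, drop_cons_of_ne hxt.symm]
        by_cases hv : y ∈ v
        · rw [comp_cons_nil n (word_mem hv), comp_cons_nil n (mem_drop_word hxt.symm hv), map_zero]
        · rw [comp_cons_last_nil n (word_mem hv), comp_cons_last_nil n (notMem_drop_word hv), ih]
      | z :: u, hu =>
        have hz := hu z List.mem_cons_self
        have hu' : ∀ x ∈ u, 1 ≤ x ∧ x ≤ n := fun x hx => hu x (List.mem_cons_of_mem _ hx)
        have ih := drop_beta_comp hxt (y :: v) u hu'
        have hd : drop x (word k v) ∈ spanOf k fun w =>
            (y ∈ w ↔ y ∈ v) ∧ deg (y :: w) = deg (y :: v) := by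
          refine spanOf_mono (fun w hw => ?_) (drop_word_mem x v)
          have : y ∈ w ↔ y ∈ v := (hw.1 y).trans (and_iff_left hxt.symm)
          exact ⟨this, by rw [deg_cons, deg_cons, rep_congr this, hw.2.1]⟩
        rw [← cons_word y, drop_cons_of_ne hxt.symm] at ih
        rw [comp_word_cons_cons, drop_cons_of_ne (alpha_ne_beta hz hxt), ← cons_word z,
          ← cons_word y, drop_cons_of_ne hxt.symm,
          comp_cons_cons n (c := z ∈ u) hd (word_mem Iff.rfl), map_add, map_smul, ih]
        congr 2
        split_ifs with hv
        · rw [cons_word, drop_beta_comp hxt v (z :: u) hu]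
        · simp
    · have ih := drop_beta_comp hxt v u hu
      rw [← cons_word, comp_cons_of_ne hyt]
      by_cases hyx : y = x
      · subst hyx
        by_cases hv : y ∈ v
        · rw [drop_cons_self_of_mem (word_mem hv), drop_cons_self_of_mem
            (spanOf_mono (fun w hw => hw.2 hv) (mem_beta_comp hu hyt)), map_zero,
            LinearMap.zero_apply]
        · rw [drop_cons_self_of_notMem (word_mem hv), drop_cons_self_of_notMem
            (spanOf_mono (fun w hw => mt hw.1 hv) (mem_beta_comp hu hyt))]
      · rw [drop_cons_of_ne fun e => hyx (beta_inj hyt hxt e), drop_cons_of_ne hyx,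
          comp_cons_of_ne hyt, ih]
  termination_by v u => v.length + u.length

/-- The Leibniz rule. -/
theorem diff_comp_word {t n : ℕ} (v u : List ℕ) (hu : ∀ x ∈ u, 1 ≤ x ∧ x ≤ n)
    (h : t ∈ v ∨ u = []) :
    diff (comp t n (word k v) (word k u)) = comp t n (diff (word k v)) (word k u) +
      (-1 : k) ^ deg v • comp t n (word k v) (diff (word k u)) := by
  induction hN : v.length + u.length using Nat.strong_induction_on generalizing v u with
  | _ N ih =>
  subst hN
  have ih v' u' hu' h' hN := ih (v'.length + u'.length) hN v' u' hu' h' rfl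
  rcases v with _ | ⟨x, v⟩
  · obtain rfl := h.resolve_left List.not_mem_nil
    rw [comp_word_of_notMem t n _ List.not_mem_nil]
    simp
  · by_cases hx : x = t
    · rcases u with _ | ⟨y, u⟩
      · subst hx
        rw [← cons_word, diff_nil, map_zero, smul_zero, add_zero]
        by_cases hv : x ∈ v
        · rw [comp_cons_nil n (word_mem hv), diff_cons_of_mem (word_mem hv), map_sub, map_sub,
            LinearMap.sub_apply, LinearMap.sub_apply, comp_cons_nil n (mem_diff_word x hv),
            comp_cons_last_nil n (notMem_drop_word_self x v),
            comp_of_notMem x n [] (notMem_drop_word_self x v), comp_nil_right x n hv]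
          simp
        · rw [comp_cons_last_nil n (word_mem hv), diff_cons_of_notMem (word_mem hv),
            comp_cons_last_nil n (notMem_diff_word x hv), ih v [] hu (.inr rfl) (by simp)]
          simp
      · subst hx
        have hy := hu y List.mem_cons_self
        have hu' : ∀ x ∈ u, 1 ≤ x ∧ x ≤ n := fun x hx => hu x (List.mem_cons_of_mem _ hx)
        have hxv : x ∈ x :: v := List.mem_cons_self
        have ihB := ih (x :: v) u hu' (.inl hxv) (by simp)
        have dB := drop_alpha_comp (k := k) hy (x :: v) u hu' hxv
        have mB := mem_alpha_comp (k := k) hu' hxv hy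
        have hdu : diff (word k u) ∈ spanOf k fun w => y ∈ w ↔ y ∈ u :=
          spanOf_mono (fun w hw => hw.1 y) (diff_word_mem u)
        have hru : drop y (word k u) ∈ spanOf k fun w => y ∈ w ↔ False :=
          spanOf_mono (fun w hw => iff_false_intro hw) (notMem_drop_word_self y u)
        have hwu : word k u ∈ spanOf k fun w => y ∈ w ↔ y ∈ u := word_mem Iff.rfl
        have hwv : word k v ∈ spanOf k fun w => (x ∈ w ↔ x ∈ v) ∧ deg (x :: w) = deg (x :: v) :=
          word_mem ⟨Iff.rfl, rfl⟩
        rw [comp_word_cons_cons]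
        simp only [← cons_word] at ihB dB mB ⊢
        -- After expansion by `comp_word_cons_cons`, the differentials of the two summands are known
        -- by induction, and the terms in which a letter becomes unique by `drop_alpha_comp`. What
        -- remains in each case is a comparison of signs, according to whether `x` recurs in `v` and
        -- `y` recurs in `u`.
        by_cases hv : x ∈ v
        · have ihA := ih v (y :: u) hu (.inl hv) (by simp)
          have dA := drop_alpha_comp (k := k) hy v (y :: u) hu hv
          have mA := spanOf_mono (fun w hw => hw.2 List.mem_cons_self)
            (mem_alpha_comp (k := k) hu hv hy)
          have hdeg : deg (x :: v) = deg v + 1 := by rw [deg_cons, rep_of_mem hv]; ring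
          rw [hdeg] at hwv ihB ⊢
          have hdv : diff (word k v) ∈ spanOf k fun w =>
              (x ∈ w ↔ x ∈ v) ∧ deg (x :: w) = deg v :=
            spanOf_mono (fun w hw => ⟨hw.1.1 x, by
              rw [deg_cons, rep_of_mem ((hw.1.1 x).2 hv), ← hw.2]; ring⟩)
              (spanOf_and (diff_word_mem v) (deg_diff_word v))
          have hrv : drop x (word k v) ∈ spanOf k fun w =>
              (x ∈ w ↔ False) ∧ deg (x :: w) = deg v :=
            spanOf_mono (fun w hw => ⟨iff_false_intro fun h => ((hw.1 x).1 h).2 rfl, by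
              rw [deg_cons, rep_of_notMem fun h => ((hw.1 x).1 h).2 rfl, hw.2.1, zero_add]⟩)
              (drop_word_mem x v)
          simp only [← cons_word] at ihA dA mA
          rw [diff_cons_of_mem (word_mem hv)] at ihB ⊢
          rw [if_pos hv]
          by_cases hyu : y ∈ u
          · rw [rep_of_mem hyu, diff_cons_of_mem (Submodule.add_mem _ mA
              (Submodule.smul_mem _ _ (spanOf_mono (fun w hw => hw.2 hyu) mB)))]
            rw [diff_cons_of_mem (word_mem hyu)] at ihA ⊢
            rw [drop_cons_self_of_mem (word_mem hyu)] at dA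
            simp only [map_add, map_sub, map_smul, LinearMap.sub_apply, dA, dB, ihA, ihB,
              comp_cons_cons n hwv hru, comp_cons_cons n hwv hdu, comp_cons_cons n hdv hwu,
              comp_cons_cons n hrv hwu, if_pos hv, if_pos hyu, if_false, pow_succ, one_mul,
              zero_mul, pow_zero, map_zero, smul_add, smul_sub]
            rcases neg_one_pow_eq_or k (deg v) with e | e <;> rw [e] <;> module
          · rw [rep_of_notMem hyu, map_add, map_add, diff_cons_of_mem mA, map_smul, map_smul,
              diff_cons_of_notMem (spanOf_mono (fun w hw => mt hw.1 hyu) mB)]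
            rw [diff_cons_of_notMem (word_mem hyu)] at ihA ⊢
            rw [drop_cons_self_of_notMem (word_mem hyu)] at dA
            simp only [map_add, map_sub, map_smul, LinearMap.sub_apply, dA, ihA, ihB,
              comp_cons_cons n hwv hdu, comp_cons_cons n hdv hwu,
              comp_cons_cons n hrv hwu, if_pos hv, if_neg hyu, if_false, pow_succ,
              zero_mul, pow_zero, map_zero, smul_add, smul_sub]
            rcases neg_one_pow_eq_or k (deg v) with e | e <;> rw [e] <;> module
        · have hdv : diff (word k v) ∈ spanOf k fun w =>
              (x ∈ w ↔ x ∈ v) ∧ deg (x :: w) + 1 = deg (x :: v) := by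
            refine spanOf_mono (fun w hw => ⟨hw.1.1 x, ?_⟩)
              (spanOf_and (diff_word_mem v) (deg_diff_word v))
            rw [deg_cons, deg_cons, rep_of_notMem hv, rep_of_notMem (mt (hw.1.1 x).1 hv), ← hw.2]
            ring
          rw [diff_cons_of_notMem (word_mem hv)] at ihB ⊢
          rw [if_neg hv, zero_add]
          have hdeg : deg (x :: v) = deg v := by rw [deg_cons, rep_of_notMem hv, zero_add]
          rw [hdeg] at hwv ihB hdv ⊢
          -- Words of `diff v` enter the recursion with an exponent one less than `deg v`. Splitting
          -- off `deg v = 0`, where `diff v = 0`, avoids truncated subtraction.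
          obtain ⟨d, hd⟩ | hd : (∃ d, deg v = d + 1) ∨ deg v = 0 := by
            cases deg v <;> simp
          · have hdv' : diff (word k v) ∈ spanOf k fun w =>
                (x ∈ w ↔ x ∈ v) ∧ deg (x :: w) = d :=
              spanOf_mono (fun w hw => ⟨hw.1, by omega⟩) hdv
            rw [hd] at ihB hwv ⊢
            by_cases hyu : y ∈ u
            · rw [rep_of_mem hyu, map_smul, map_smul, diff_cons_of_mem
                (spanOf_mono (fun w hw => hw.2 hyu) mB), diff_cons_of_mem (word_mem hyu)]
              simp only [map_add, map_sub, map_smul, dB, ihB,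
                comp_cons_cons n hwv hru, comp_cons_cons n hwv hdu, comp_cons_cons n hdv' hwu,
                if_neg hv, if_pos hyu, if_false, pow_succ, one_mul,
                zero_mul, pow_zero, map_zero, smul_add, smul_sub]
              rcases neg_one_pow_eq_or k d with e | e <;> rw [e] <;> module
            · rw [rep_of_notMem hyu, map_smul, map_smul,
                diff_cons_of_notMem (spanOf_mono (fun w hw => mt hw.1 hyu) mB),
                diff_cons_of_notMem (word_mem hyu)]
              simp only [map_add, map_smul, ihB, comp_cons_cons n hwv hdu,
                comp_cons_cons n hdv' hwu, if_neg hv, if_neg hyu, pow_succ,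
                zero_mul, pow_zero, map_zero, smul_add]
              rcases neg_one_pow_eq_or k d with e | e <;> rw [e] <;> module
          · have h0 : diff (word k v) = 0 :=
              eq_zero_of_mem hdv LinearMap.id fun w hw => by omega
            rw [hd] at ihB hwv ⊢
            rw [h0] at ihB ⊢
            by_cases hyu : y ∈ u
            · rw [map_smul, map_smul, diff_cons_of_mem
                (spanOf_mono (fun w hw => hw.2 hyu) mB), diff_cons_of_mem (word_mem hyu)]
              simp only [map_add, map_sub, map_smul, dB, ihB,
                comp_cons_cons n hwv hru, comp_cons_cons n hwv hdu,
                if_neg hv, if_pos hyu, if_false, LinearMap.zero_apply,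
                mul_zero, pow_zero, map_zero, smul_add, smul_sub]
              module
            · rw [map_smul, map_smul,
                diff_cons_of_notMem (spanOf_mono (fun w hw => mt hw.1 hyu) mB),
                diff_cons_of_notMem (word_mem hyu)]
              simp only [map_add, map_smul, ihB, comp_cons_cons n hwv hdu, if_neg hv,
                if_neg hyu, LinearMap.zero_apply, mul_zero,
                pow_zero, map_zero, smul_add]
              module
    · have h' : t ∈ v ∨ u = [] := h.imp_left fun h =>
        (List.mem_cons.1 h).resolve_left (Ne.symm hx)
      have ih := ih v u hu h' (by simp)
      have mv := mem_beta_comp (k := k) (v := v) hu hx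
      rw [← cons_word, comp_cons_of_ne hx, comp_cons_of_ne hx, deg_cons]
      by_cases hv : x ∈ v
      · rw [diff_cons_of_mem (spanOf_mono (fun w hw => hw.2 hv) mv), diff_cons_of_mem (word_mem hv),
          ih, rep_of_mem hv, drop_beta_comp hx v u hu]
        simp only [map_sub, map_add, map_smul, LinearMap.sub_apply, comp_cons_of_ne hx, pow_add]
        module
      · rw [diff_cons_of_notMem (spanOf_mono (fun w hw => mt hw.1 hv) mv),
          diff_cons_of_notMem (word_mem hv), ih, rep_of_notMem hv, comp_cons_of_ne hx, map_add,
          map_smul, zero_add]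

end FreeWords

/-! ### The two associativity laws for composition of words. -/

namespace FreeWords

variable {k : Type u} [CommRing k]

/-- Sequential composition is associative. -/
theorem comp_comp_word {i j j' m n q : ℕ} (hi : 1 ≤ i) (hj' : 1 ≤ j' ∧ j' ≤ m)
    (hj : j + 1 = i + j') (hq : q + 1 = m + n) (x y z : List ℕ) (hy : ∀ a ∈ y, 1 ≤ a ∧ a ≤ m)
    (hz : ∀ a ∈ z, 1 ≤ a ∧ a ≤ n) (h : i ∈ x ∨ y = []) :
    comp j n (comp i m (word k x) (word k y)) (word k z) =
      comp i q (word k x) (comp j' n (word k y) (word k z)) := by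
  induction hN : x.length + y.length + z.length using Nat.strong_induction_on
    generalizing x y z with
  | _ N ih =>
  subst hN
  have ih x y z hy hz h hN := ih (x.length + y.length + z.length) hN x y z hy hz h rfl
  rcases x with _ | ⟨a, x⟩
  · obtain rfl := h.resolve_left List.not_mem_nil
    simp [comp_word_of_notMem _ _ _ List.not_mem_nil]
  by_cases ha : a = i
  swap
  · have h1 : Surj.beta i m a ≠ j := by
      unfold Surj.beta
      split_ifs <;> omega
    have h2 : Surj.beta j n (Surj.beta i m a) = Surj.beta i q a := by
      unfold Surj.beta
      split_ifs <;> omega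
    rw [← cons_word, comp_cons_of_ne ha, comp_cons_of_ne h1, comp_cons_of_ne ha, h2,
      ih x y z hy hz (h.imp_left fun h => (List.mem_cons.1 h).resolve_left (Ne.symm ha)) (by simp)]
  subst ha
  rcases y with _ | ⟨b, y⟩
  · rw [comp_word_of_notMem j' n z List.not_mem_nil, List.map_nil, ← cons_word]
    by_cases hx : a ∈ x
    · rw [comp_cons_nil m (word_mem hx), comp_cons_nil q (word_mem hx), map_zero,
        LinearMap.zero_apply]
    · rw [comp_cons_last_nil m (word_mem hx), comp_cons_last_nil q (word_mem hx),
        ih x [] z hy hz (.inr rfl) (by simp), comp_word_of_notMem j' n z List.not_mem_nil,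
        List.map_nil]
  have hax : a ∈ a :: x := List.mem_cons_self
  have hb := hy b List.mem_cons_self
  have hy' : ∀ a ∈ y, 1 ≤ a ∧ a ≤ m := fun a h => hy a (List.mem_cons_of_mem _ h)
  have hwx : word k x ∈ spanOf k fun w => (a ∈ w ↔ a ∈ x) ∧ deg (a :: w) = deg (a :: x) :=
    word_mem ⟨Iff.rfl, rfl⟩
  by_cases hbj : b = j'
  swap
  · have h1 : Surj.alpha a b ≠ j := by
      unfold Surj.alpha
      omega
    have h2 : Surj.beta j n (Surj.alpha a b) = Surj.alpha a (Surj.beta j' n b) := by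
      unfold Surj.beta Surj.alpha
      split_ifs <;> omega
    have ihB := ih (a :: x) y z hy' hz (.inl hax) (by simp)
    rw [comp_word_cons_cons, comp_cons_of_ne h1, h2, ← cons_word b, comp_cons_of_ne hbj,
      ← cons_word a, comp_cons_cons q (c := b ∈ y) hwx (mem_beta_comp hz hbj), map_add, map_smul,
      LinearMap.add_apply, LinearMap.smul_apply, cons_word a, ihB]
    congr 2
    split_ifs with hx
    · have ihA := ih x (b :: y) z hy hz (.inl hx) (by simp)
      rw [cons_word, ihA, ← cons_word b, comp_cons_of_ne hbj]
    · simp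
  subst hbj
  -- The letter `b` is where `z` goes in, so all three words contribute to the next letter. This is
  -- the only case in which the three recursions interact.
  have hαb : Surj.alpha a b = j := by
    unfold Surj.alpha
    omega
  have hbm : b ∈ b :: y := List.mem_cons_self
  have mA : a ∈ x → comp a m (word k x) (word k (b :: y)) ∈ spanOf k fun w => j ∈ w :=
    fun hx => spanOf_mono (fun w hw => (hαb ▸ hw).2 hbm) (mem_alpha_comp hy hx hb)
  have mB : comp a m (word k (a :: x)) (word k y) ∈ spanOf k fun w => j ∈ w ↔ b ∈ y :=
    hαb ▸ mem_alpha_comp hy' hax hb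
  rcases z with _ | ⟨c, z⟩
  · have ihB := ih (a :: x) y [] hy' hz (.inl hax) (by simp)
    rw [comp_word_cons_cons, hαb, ← cons_word b, map_add, map_add, LinearMap.add_apply]
    have hA : comp j n (cons j (if a ∈ x then comp a m (word k x) (cons b (word k y)) else 0))
        (word k []) = 0 := by
      split_ifs with hx
      · rw [cons_word, comp_cons_nil n (mA hx)]
      · simp
    rw [hA, zero_add, map_smul, map_smul, LinearMap.smul_apply]
    by_cases hby : b ∈ y
    · rw [comp_cons_nil n (spanOf_mono (fun w hw => hw.2 hby) mB), comp_cons_nil n (word_mem hby)]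
      simp
    · rw [comp_cons_last_nil n (spanOf_mono (fun w hw => mt hw.1 hby) mB),
        comp_cons_last_nil n (word_mem hby), ihB, rep_of_notMem hby]
      simp
  have hc := hz c List.mem_cons_self
  have hz' : ∀ a ∈ z, 1 ≤ a ∧ a ≤ n := fun a h => hz a (List.mem_cons_of_mem _ h)
  have hα : Surj.alpha a (Surj.alpha b c) = Surj.alpha j c := by
    unfold Surj.alpha
    omega
  have hwz : word k z ∈ spanOf k fun w => c ∈ w ↔ c ∈ z := word_mem Iff.rfl
  have dA (hx : a ∈ x) : comp a m (word k x) (word k (b :: y)) ∈ spanOf k fun w =>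
      (j ∈ w ↔ True) ∧ deg (j :: w) = deg (a :: x) + deg (b :: y) :=
    spanOf_mono (fun w hw => ⟨iff_true_intro hw.1, by
      rw [deg_cons, rep_of_mem hw.1, hw.2, deg_cons a, rep_of_mem hx, add_assoc]⟩)
      (spanOf_and (mA hx) (deg_comp hy (.inl hx)))
  have dB : comp a m (word k (a :: x)) (word k y) ∈ spanOf k fun w =>
      (j ∈ w ↔ b ∈ y) ∧ deg (j :: w) = deg (a :: x) + deg (b :: y) :=
    spanOf_mono (fun w hw => ⟨hw.1, by
      rw [deg_cons, rep_congr hw.1, hw.2, deg_cons b]; ring⟩)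
      (spanOf_and mB (deg_comp hy' (.inl hax)))
  have mP (hby : b ∈ y) : comp b n (word k y) (word k (c :: z)) ∈ spanOf k fun w =>
      Surj.alpha b c ∈ w ↔ True :=
    spanOf_mono (fun w hw => iff_true_intro (hw.2 List.mem_cons_self)) (mem_alpha_comp hz hby hc)
  have mQ : comp b n (word k (b :: y)) (word k z) ∈ spanOf k fun w =>
      Surj.alpha b c ∈ w ↔ c ∈ z := mem_alpha_comp hz' hbm hc
  -- All terms now begin with the image of `c`. If `z` is not cut at `c`, the rest is governed by
  -- `ihZ`; if it is, `ihA` covers the terms with `y` cut at `b` and `ihB` those in which the piece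
  -- of `y` continues.
  have ihZ := ih (a :: x) (b :: y) z hy hz' (.inl hax) (by simp)
  have ihB := ih (a :: x) y (c :: z) hy' hz (.inl hax) (by simp)
  have ihA (hx : a ∈ x) := ih x (b :: y) (c :: z) hy hz (.inl hx) (by simp)
  rw [comp_word_cons_cons, comp_word_cons_cons, hαb]
  rw [comp_word_cons_cons, hαb] at ihZ
  rw [comp_word_cons_cons b] at ihA
  replace ihZ := congrArg (cons (Surj.alpha j c)) ihZ
  simp only [← cons_word] at dA dB mP mQ ihZ ihA ihB ⊢
  by_cases hx : a ∈ x <;> by_cases hby : b ∈ y <;>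
  simp only [if_pos, if_neg, hx, hby, rep_of_mem, rep_of_notMem, not_false_eq_true, zero_add,
    forall_const, map_add, map_smul, LinearMap.add_apply, LinearMap.smul_apply,
    false_imp_iff, comp_cons_cons n dB hwz, comp_cons_cons q hwx mQ, hα,
    one_mul, zero_mul, pow_zero, one_smul, smul_add] at dA mP ihA ihB ihZ ⊢
  · rw [comp_cons_cons n dA hwz, comp_cons_cons q hwx mP, ihA, ihB]
    simp only [if_pos, hx, hα, map_add, map_smul, rep]
    linear_combination (norm := module) ((-1 : k) ^ ((if c ∈ z then 1 else 0) *
      (deg (a :: x) + deg (b :: y)))) • ihZ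
  · rw [comp_cons_cons n dA hwz, ihA]
    simp only [if_pos, map_add, map_smul, rep]
    linear_combination (norm := module) ((-1 : k) ^ ((if c ∈ z then 1 else 0) *
      (deg (a :: x) + deg (b :: y)))) • ihZ
  · rw [comp_cons_cons q hwx mP, ihB]
    simp only [if_pos, if_neg hx, hα, map_add, map_zero, map_smul, rep]
    linear_combination (norm := module) ((-1 : k) ^ ((if c ∈ z then 1 else 0) *
      (deg (a :: x) + deg (b :: y)))) • ihZ
  · simp only [rep]
    linear_combination (norm := module) ((-1 : k) ^ ((if c ∈ z then 1 else 0) *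
      (deg (a :: x) + deg (b :: y)))) • ihZ

/-- Parallel compositions commute. -/
theorem comp_comm_word {i j m n i' : ℕ} (hj : 1 ≤ j) (hji : j < i) (hi' : i' + 1 = i + n)
    (x y z : List ℕ) (hy : ∀ a ∈ y, 1 ≤ a ∧ a ≤ m) (hz : ∀ a ∈ z, 1 ≤ a ∧ a ≤ n)
    (h : i ∈ x ∨ y = []) (h' : j ∈ x ∨ z = []) :
    comp j n (comp i m (word k x) (word k y)) (word k z) =
      (-1 : k) ^ (deg y * deg z) •
        comp i' m (comp j n (word k x) (word k z)) (word k y) := by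
  induction hN : x.length + y.length + z.length using Nat.strong_induction_on
    generalizing x y z with
  | _ N ih =>
  subst hN
  have ih x y z hy hz h h' hN := ih (x.length + y.length + z.length) hN x y z hy hz h h' rfl
  have hne : i ≠ j := hji.ne'
  have hβi : Surj.beta j n i = i' := by
    unfold Surj.beta
    split_ifs <;> omega
  have hβj : Surj.beta i m j = j := by
    unfold Surj.beta
    split_ifs; omega
  rcases x with _ | ⟨a, x⟩
  · obtain rfl := h.resolve_left List.not_mem_nil
    obtain rfl := h'.resolve_left List.not_mem_nil
    simp [comp_word_of_notMem _ _ _ List.not_mem_nil]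
  by_cases hai : a = i
  · subst hai
    have h'x : j ∈ x ∨ z = [] :=
      h'.imp_left fun h => (List.mem_cons.1 h).resolve_left hne.symm
    have mW : comp j n (word k x) (word k z) ∈ spanOf k fun w => i' ∈ w ↔ a ∈ x :=
      hβi ▸ mem_beta_comp hz hne
    rcases y with _ | ⟨b, y⟩
    · rw [← cons_word, comp_cons_of_ne hne, hβi]
      by_cases hx : a ∈ x
      · rw [comp_cons_nil m (word_mem hx), comp_cons_nil m
          (spanOf_mono (fun w hw => hw.2 hx) mW)]
        simp
      · rw [comp_cons_last_nil m (word_mem hx), comp_cons_last_nil m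
          (spanOf_mono (fun w hw => mt hw.1 hx) mW), ih x [] z hy hz (.inr rfl) h'x (by simp)]
    have hax : a ∈ a :: x := List.mem_cons_self
    have hb := hy b List.mem_cons_self
    have hy' : ∀ a ∈ y, 1 ≤ a ∧ a ≤ m := fun a h => hy a (List.mem_cons_of_mem _ h)
    have h1 : Surj.alpha a b ≠ j := by
      unfold Surj.alpha
      omega
    have h2 : Surj.beta j n (Surj.alpha a b) = Surj.alpha i' b := by
      unfold Surj.beta Surj.alpha
      split_ifs <;> omega
    -- The outer word of the second composition already contains `z`, so moving `b` across it costs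
    -- an additional `deg z`. These contributions build up the sign `deg y * deg z`.
    have dW : comp j n (word k x) (word k z) ∈ spanOf k fun w =>
        (i' ∈ w ↔ a ∈ x) ∧ deg (i' :: w) = deg (a :: x) + deg z :=
      spanOf_mono (fun w hw => ⟨hw.1, by
        rw [deg_cons, rep_congr hw.1, hw.2, deg_cons, add_assoc]⟩)
        (spanOf_and mW (deg_comp hz h'x))
    have hwy : word k y ∈ spanOf k fun w => b ∈ w ↔ b ∈ y := word_mem Iff.rfl
    have ihB := ih (a :: x) y z hy' hz (.inl hax) h' (by simp)
    have ihA (hx : a ∈ x) := ih x (b :: y) z hy hz (.inl hx) h'x (by simp)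
    rw [comp_word_cons_cons, comp_cons_of_ne h1, h2, deg_cons b]
    rw [deg_cons b] at ihA
    simp only [← cons_word] at ihA ihB ⊢
    rw [comp_cons_of_ne hne, hβi, comp_cons_cons m dW hwy]
    rw [comp_cons_of_ne hne, hβi] at ihB
    by_cases hx : a ∈ x <;>
    simp only [if_pos, if_neg, hx, not_false_eq_true, zero_add,
      forall_const, map_add, map_smul, LinearMap.add_apply, LinearMap.smul_apply,
      false_imp_iff, rep] at ihA ihB ⊢
    · rw [ihA, ihB]
      simp only [map_smul]
      split_ifs
      · rcases neg_one_pow_eq_or k (deg z) with e | e <;>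
          simp only [pow_add, add_mul, one_mul, e] <;> module
      · simp only [zero_mul, zero_add, pow_zero]; module
    · rw [ihB]
      simp only [map_smul]
      split_ifs
      · rcases neg_one_pow_eq_or k (deg z) with e | e <;>
          simp only [pow_add, add_mul, one_mul, e] <;> module
      · simp only [zero_mul, zero_add, pow_zero]; module
  by_cases haj : a = j
  · subst haj
    have hx' : i ∈ x ∨ y = [] :=
      h.imp_left fun h => (List.mem_cons.1 h).resolve_left hne
    have mW : comp i m (word k x) (word k y) ∈ spanOf k fun w => a ∈ w ↔ a ∈ x :=
      spanOf_mono (fun w hw => by rwa [hβj] at hw) (mem_beta_comp hy hne.symm)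
    rcases z with _ | ⟨b, z⟩
    · rw [← cons_word, comp_cons_of_ne hne.symm, hβj]
      by_cases hx : a ∈ x
      · rw [comp_cons_nil n (word_mem hx), comp_cons_nil n
          (spanOf_mono (fun w hw => hw.2 hx) mW)]
        simp
      · rw [comp_cons_last_nil n (word_mem hx), comp_cons_last_nil n
          (spanOf_mono (fun w hw => mt hw.1 hx) mW), ih x y [] hy hz hx' (.inr rfl) (by simp)]
    have hax : a ∈ a :: x := List.mem_cons_self
    have hb := hz b List.mem_cons_self
    have hz' : ∀ a ∈ z, 1 ≤ a ∧ a ≤ n := fun a h => hz a (List.mem_cons_of_mem _ h)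
    have h1 : Surj.alpha a b ≠ i' := by
      unfold Surj.alpha
      omega
    have h2 : Surj.beta i' m (Surj.alpha a b) = Surj.alpha a b := by
      unfold Surj.beta Surj.alpha
      split_ifs <;> omega
    have dW : comp i m (word k x) (word k y) ∈ spanOf k fun w =>
        (a ∈ w ↔ a ∈ x) ∧ deg (a :: w) = deg (a :: x) + deg y :=
      spanOf_mono (fun w hw => ⟨hw.1, by
        rw [deg_cons, rep_congr hw.1, hw.2, deg_cons, add_assoc]⟩)
        (spanOf_and mW (deg_comp hy hx'))
    have hwz : word k z ∈ spanOf k fun w => b ∈ w ↔ b ∈ z := word_mem Iff.rfl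
    have ihB := ih (a :: x) y z hy hz' h (.inl hax) (by simp)
    have ihA (hx : a ∈ x) := ih x y (b :: z) hy hz hx' (.inl hx) (by simp)
    rw [comp_word_cons_cons a, comp_cons_of_ne h1, h2, deg_cons b]
    rw [deg_cons b] at ihA
    simp only [← cons_word] at ihA ihB ⊢
    rw [comp_cons_of_ne hne.symm, hβj, comp_cons_cons n dW hwz]
    rw [comp_cons_of_ne hne.symm, hβj] at ihB
    by_cases hx : a ∈ x <;>
    simp only [if_pos, if_neg, hx, not_false_eq_true, zero_add,
      forall_const, map_add, map_smul, LinearMap.add_apply, LinearMap.smul_apply,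
      false_imp_iff, rep] at ihA ihB ⊢
    · rw [ihA, ihB]
      simp only [map_smul]
      split_ifs
      · rcases neg_one_pow_eq_or k (deg y) with e | e <;>
          simp only [pow_add, mul_add, one_mul, mul_one, e] <;> module
      · simp only [zero_mul, zero_add, pow_zero]; module
    · rw [ihB]
      simp only [map_smul]
      split_ifs
      · rcases neg_one_pow_eq_or k (deg y) with e | e <;>
          simp only [pow_add, mul_add, one_mul, mul_one, e] <;> module
      · simp only [zero_mul, zero_add, pow_zero]; module
  · have h1 : Surj.beta i m a ≠ j := by
      unfold Surj.beta
      split_ifs <;> omega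
    have h2 : Surj.beta j n a ≠ i' := by
      unfold Surj.beta
      split_ifs <;> omega
    have h3 : Surj.beta j n (Surj.beta i m a) = Surj.beta i' m (Surj.beta j n a) := by
      unfold Surj.beta
      split_ifs <;> omega
    rw [← cons_word, comp_cons_of_ne hai, comp_cons_of_ne h1, comp_cons_of_ne haj,
      comp_cons_of_ne h2, h3, ih x y z hy hz
        (h.imp_left fun h => (List.mem_cons.1 h).resolve_left (Ne.symm hai))
        (h'.imp_left fun h => (List.mem_cons.1 h).resolve_left (Ne.symm haj)) (by simp), map_smul]

end FreeWords

namespace FreeWords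

variable {k : Type u} [CommRing k]

/-! Comparison with the differential of the surjection operad. -/

/-- The sign exponent of the term of the differential in which the entry at `i` is skipped. -/
def diffExp (u : List ℕ) (i : ℕ) : ℕ :=
  if u.getD i 0 ∈ u.drop (i + 1) then Surj.relDeg u i
    else Surj.relDeg u (Nat.findGreatest (fun j => u.getD j 0 = u.getD i 0) (i - 1) + 1)

variable (k) in
/-- The term of the differential in which the entry at `i` is skipped. -/
noncomputable def diffTerm (u : List ℕ) (i : ℕ) : FreeWords k :=
  if u.count (u.getD i 0) ≠ 1 then (-1 : k) ^ diffExp u i • word k (u.eraseIdx i) else 0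

theorem ofTerms_dTerms (u : List ℕ) :
    ofTerms k (Surj.dTerms u) = ∑ i ∈ Finset.range u.length, diffTerm k u i := by
  have h1 : ∀ n, ∑ i ∈ Finset.range n, diffTerm k u i =
      ((List.range n).map (diffTerm k u)).sum := by
    intro n
    induction n with
    | zero => simp
    | succ n ih => rw [Finset.sum_range_succ, ih, List.range_succ]; simp
  rw [h1, ofTerms, Surj.dTerms, List.map_map]
  generalize List.range u.length = l
  induction l with
  | nil => rfl
  | cons i l ih =>
    rw [List.filter_cons, List.map_cons, List.sum_cons]
    by_cases h : u.count (u.getD i 0) ≠ 1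
    · rw [if_pos (by simpa using h), List.map_cons, List.sum_cons, ih, diffTerm, if_pos h]
      rfl
    · rw [if_neg (by simpa using h), ih, diffTerm, if_neg h, zero_add]

/-- The hypothesis says that the value at `i` occurs more than once in `u`. If `i` is its last
occurrence, the penultimate one lies in `u` and moves by one position; otherwise `Nat.findGreatest`
would only return its default value. -/
theorem diffExp_cons_of_exists {x : ℕ} {u : List ℕ} {i : ℕ}
    (h : u.getD i 0 ∈ u.drop (i + 1) ∨ ∃ j < i, u.getD j 0 = u.getD i 0) :
    diffExp (x :: u) (i + 1) = rep x u + diffExp u i := by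
  unfold diffExp
  rw [List.getD_cons_succ, List.drop_succ_cons]
  by_cases hd : u.getD i 0 ∈ u.drop (i + 1)
  · rw [if_pos hd, if_pos hd, relDeg_cons_succ]
  · obtain ⟨j, hj, hji⟩ := h.resolve_left hd
    rw [if_neg hd, if_neg hd, ← relDeg_cons_succ]
    congr 2
    set y := u.getD i 0
    set g := Nat.findGreatest (fun j => u.getD j 0 = y) (i - 1) with hg
    obtain ⟨h1, h2, h3⟩ := Nat.findGreatest_eq_iff.1 hg.symm
    have hgy : u.getD g 0 = y :=
      Nat.findGreatest_spec (P := fun j => u.getD j 0 = y) (show j ≤ i - 1 by omega) hji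
    refine Nat.findGreatest_eq_iff.2 ⟨by omega, fun _ => by simpa using hgy, fun m hm hmi => ?_⟩
    obtain ⟨m, rfl⟩ : ∃ m', m = m' + 1 := ⟨m - 1, by omega⟩
    simpa using h3 (show g < m by omega) (show m ≤ i - 1 by omega)

/-- Prepending `x` adds `rep x u` to every exponent. The only new term comes from an `x` that is
unique in `u`: it becomes deletable, with exponent `1`. Stating the correction at `u.idxOf x` needs
no case distinction, since `drop` vanishes when `x` is repeated in `u`. -/
theorem diffTerm_cons_succ (x : ℕ) (u : List ℕ) {i : ℕ} (hi : i < u.length) :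
    diffTerm k (x :: u) (i + 1) = (-1 : k) ^ rep x u • cons x (diffTerm k u i) -
      if u.idxOf x = i then cons x (drop x (word k u)) else 0 := by
  have hget : u.getD i 0 = u[i] := List.getD_eq_getElem _ _ hi
  have hcount : u.count u[i] = (u.take i).count u[i] + 1 + (u.drop (i + 1)).count u[i] := by
    have e : u.take i ++ u[i] :: u.drop (i + 1) = u := by
      rw [← List.drop_eq_getElem_cons hi, List.take_append_drop]
    have := congrArg (List.count u[i]) e
    rw [List.count_append, List.count_cons_self] at this
    omega
  have hex : u.count u[i] ≠ 1 → u.getD i 0 ∈ u.drop (i + 1) ∨ ∃ j < i, u.getD j 0 = u.getD i 0 := by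
    intro h
    rw [hget]
    by_cases hd : u[i] ∈ u.drop (i + 1)
    · exact .inl hd
    · rw [List.count_eq_zero_of_not_mem hd] at hcount
      have : u[i] ∈ u.take i := List.count_pos_iff.1 (by omega)
      obtain ⟨j, hj, e⟩ := List.mem_iff_getElem.1 this
      rw [List.length_take] at hj
      refine .inr ⟨j, by omega, ?_⟩
      rw [List.getElem_take] at e
      rw [List.getD_eq_getElem _ _ (by omega), e]
  unfold diffTerm
  rw [List.getD_cons_succ, List.eraseIdx_cons_succ, hget]
  by_cases hx : u[i] = x
  · have hmem : x ∈ u := hx ▸ List.getElem_mem hi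
    have hcx : (x :: u).count x ≠ 1 := by
      have := List.count_pos_iff.2 hmem
      rw [List.count_cons_self]
      omega
    rw [rep_of_mem hmem]
    by_cases h1 : u.count x = 1
    · have hnt : x ∉ u.take i := by
        rw [hx] at hcount
        exact List.count_eq_zero.1 (by omega)
      have hnd : x ∉ u.drop (i + 1) := by
        rw [hx] at hcount
        exact List.count_eq_zero.1 (by omega)
      have hidx : u.idxOf x = i := by
        conv_lhs => rw [← List.take_append_drop i u, List.drop_eq_getElem_cons hi]
        rw [List.idxOf_append_of_notMem hnt, hx, List.idxOf_cons_self, List.length_take]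
        omega
      have herase : u.erase x = u.eraseIdx i := by
        rw [List.erase_eq_eraseIdx_of_idxOf hidx]
      have hexp : diffExp (x :: u) (i + 1) = 1 := by
        unfold diffExp
        rw [List.getD_cons_succ, List.drop_succ_cons, hget, hx, if_neg hnd, relDeg_cons_succ,
          rep_of_mem hmem]
        -- The penultimate occurrence is the prepended letter at position `0`. This is also the
        -- default value of `Nat.findGreatest`, so it suffices to exclude positive positions.
        have : Nat.findGreatest (fun j => (x :: u).getD j 0 = x) (i + 1 - 1) = 0 := by
          refine Nat.findGreatest_eq_iff.2 ⟨Nat.zero_le _, fun h => absurd rfl h,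
            fun m hm hmi e => hnt ?_⟩
          obtain ⟨m, rfl⟩ : ∃ m', m = m' + 1 := ⟨m - 1, by omega⟩
          rw [List.getD_cons_succ, List.getD_eq_getElem _ _ (by omega)] at e
          rw [← e]
          exact List.mem_iff_getElem.2 ⟨m, by rw [List.length_take]; omega, List.getElem_take⟩
        rw [this, relDeg_zero]
      rw [hx, if_pos hcx, if_neg (by simp [h1]), if_pos hidx, hexp, drop, lin_word,
        dropWord, if_pos h1, herase]
      simp
    · have hdrop : drop x (word k u) = 0 := by rw [drop, lin_word, dropWord, if_neg h1]
      rw [hdrop, map_zero, ite_self, sub_zero, hx, if_pos hcx, if_pos h1,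
        diffExp_cons_of_exists (hex (hx ▸ h1)), rep_of_mem hmem, pow_add, mul_smul, map_smul,
        cons_word]
  · have hidx : u.idxOf x ≠ i := fun e => hx (by subst e; exact List.getElem_idxOf hi)
    rw [if_neg hidx, sub_zero, List.count_cons_of_ne (Ne.symm hx)]
    split_ifs with h
    · rw [diffExp_cons_of_exists (hex h), pow_add, mul_smul, map_smul, cons_word]
    · simp

theorem diff_word (u : List ℕ) : diff (word k u) = ofTerms k (Surj.dTerms u) := by
  induction u with
  | nil => simp [ofTerms, Surj.dTerms]
  | cons x u ih =>
    rw [ofTerms_dTerms, List.length_cons, Finset.sum_range_succ', Finset.sum_congr rfl fun i hi =>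
      diffTerm_cons_succ x u (Finset.mem_range.1 hi), Finset.sum_sub_distrib, ← Finset.smul_sum,
      ← map_sum, ← ofTerms_dTerms, ← ih, Finset.sum_ite_eq,
      ← cons_word]
    simp only [Finset.mem_range, List.idxOf_lt_length_iff]
    by_cases h : x ∈ u
    · have h0 : diffTerm k (x :: u) 0 = word k u := by
        simp [diffTerm, diffExp, h, relDeg_zero, List.count_eq_zero]
      rw [diff_cons_of_mem (word_mem h), if_pos h, h0, rep_of_mem h]
      module
    · have h0 : diffTerm k (x :: u) 0 = 0 := by
        simp [diffTerm, h, List.count_eq_zero]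
      rw [diff_cons_of_notMem (word_mem h), if_neg h, h0, rep_of_notMem h]
      simp

/-! Degenerate words. -/

/-- The span of the degenerate words. -/
noncomputable abbrev degenerate (k : Type u) [CommRing k] : Submodule k (FreeWords k) :=
  spanOf k fun w => ¬ w.IsChain (· ≠ ·)

theorem not_isChain_cons {w : List ℕ} (x : ℕ) (h : ¬ w.IsChain (· ≠ ·)) :
    ¬ (x :: w).IsChain (· ≠ ·) := fun h' => h h'.tail

theorem not_isChain_cons_cons (x : ℕ) (w : List ℕ) : ¬ (x :: x :: w).IsChain (· ≠ ·) := by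
  simp

theorem not_isChain_cases {x : ℕ} {w : List ℕ} (h : ¬ (x :: w).IsChain (· ≠ ·)) :
    ¬ w.IsChain (· ≠ ·) ∨ ∃ w', w = x :: w' := by
  rcases w with _ | ⟨y, w⟩
  · simp at h
  · by_cases hxy : x = y
    · exact .inr ⟨w, by rw [hxy]⟩
    · exact .inl fun h' => h (List.isChain_cons_cons.2 ⟨hxy, h'⟩)

theorem cons_mem_degenerate {x : ℕ} {W : FreeWords k} (h : W ∈ degenerate k) :
    cons x W ∈ degenerate k :=
  cons_mem h fun _ => not_isChain_cons x

theorem cons_cons_mem_degenerate (x : ℕ) (W : FreeWords k) :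
    cons x (cons x W) ∈ degenerate k :=
  cons_mem (cons_mem (mem_true W) (Q := fun w => ∃ w', w = x :: w') fun w _ => ⟨w, rfl⟩)
    (by rintro _ ⟨w, rfl⟩; exact not_isChain_cons_cons x w)

theorem drop_mem_degenerate (x : ℕ) : ∀ u : List ℕ, ¬ u.IsChain (· ≠ ·) →
    drop x (word k u) ∈ degenerate k
  | [], h => by simp at h
  | y :: u, h => by
    rw [← cons_word]
    by_cases hy : y = x
    · subst hy
      by_cases hu : y ∈ u
      · rw [drop_cons_self_of_mem (word_mem hu)]; exact Submodule.zero_mem _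
      · rw [drop_cons_self_of_notMem (word_mem hu)]
        refine word_mem ((not_isChain_cases h).resolve_right ?_)
        rintro ⟨w, rfl⟩
        exact hu List.mem_cons_self
    · rw [drop_cons_of_ne hy]
      rcases not_isChain_cases h with h | ⟨w, rfl⟩
      · exact cons_mem_degenerate (drop_mem_degenerate x u h)
      · rw [← cons_word, drop_cons_of_ne hy]
        exact cons_cons_mem_degenerate _ _

/-- For a word that begins with `x, x`, the terms that could be non-degenerate are the deletions of
one of these two entries. They give the same word with opposite signs. -/
theorem diff_mem_degenerate : ∀ u : List ℕ, ¬ u.IsChain (· ≠ ·) →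
    diff (word k u) ∈ degenerate k
  | [], h => by simp at h
  | x :: u, h => by
    rw [← cons_word]
    rcases not_isChain_cases h with h | ⟨w, rfl⟩
    · have ih := diff_mem_degenerate u h
      by_cases hx : x ∈ u
      · rw [diff_cons_of_mem (word_mem hx)]
        exact Submodule.sub_mem _ (Submodule.sub_mem _ (word_mem h)
          (cons_mem_degenerate (drop_mem_degenerate x u h))) (cons_mem_degenerate ih)
      · rw [diff_cons_of_notMem (word_mem hx)]
        exact cons_mem_degenerate ih
    · rw [diff_cons_of_mem (word_mem List.mem_cons_self), ← cons_word]
      by_cases hx : x ∈ w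
      · rw [drop_cons_self_of_mem (word_mem hx), diff_cons_of_mem (word_mem hx)]
        have : cons x (word k w) - cons x 0 - cons x (word k w - cons x (drop x (word k w)) -
            cons x (diff (word k w))) = cons x (cons x (drop x (word k w) + diff (word k w))) := by
          simp only [map_sub, map_add, map_zero]
          module
        rw [this]
        exact cons_cons_mem_degenerate _ _
      · rw [drop_cons_self_of_notMem (word_mem hx), diff_cons_of_notMem (word_mem hx), sub_self,
          zero_sub]
        exact Submodule.neg_mem _ (cons_cons_mem_degenerate _ _)

/-- Two adjacent occurrences of `t` are replaced by consecutive pieces of `u` with nothing in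
between, and the letter at their common cut appears twice in a row. -/
theorem comp_mem_degenerate_left (t n : ℕ) : ∀ v u : List ℕ, ¬ v.IsChain (· ≠ ·) →
    comp t n (word k v) (word k u) ∈ degenerate k
  | [], u, h => by simp at h
  | x :: v, u, h => by
    by_cases hx : x = t
    · subst hx
      match u with
      | [] =>
        by_cases hv : x ∈ v
        · rw [comp_word_cons_nil x n hv]; exact Submodule.zero_mem _
        · have hv' := (not_isChain_cases h).resolve_right fun ⟨w, e⟩ =>
            hv (e ▸ List.mem_cons_self)
          rw [← cons_word, comp_cons_last_nil n (word_mem hv)]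
          exact comp_mem_degenerate_left x n v [] hv'
      | y :: u =>
        rw [comp_word_cons_cons, map_add, map_smul]
        refine Submodule.add_mem _ ?_ (Submodule.smul_mem _ _
          (cons_mem_degenerate (comp_mem_degenerate_left x n (x :: v) u h)))
        split_ifs with hv
        · rcases not_isChain_cases h with h | ⟨w, rfl⟩
          · exact cons_mem_degenerate (comp_mem_degenerate_left x n v (y :: u) h)
          · rw [comp_word_cons_cons]
            exact cons_cons_mem_degenerate _ _
        · simp
    · rw [← cons_word, comp_cons_of_ne hx]
      rcases not_isChain_cases h with h | ⟨w, rfl⟩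
      · exact cons_mem_degenerate (comp_mem_degenerate_left t n v u h)
      · rw [← cons_word, comp_cons_of_ne hx]
        exact cons_cons_mem_degenerate _ _
  termination_by v u => v.length + u.length

/-- Two equal neighbours of `u` stay together in one piece even if the cut is at one of them,
because the cut letter belongs to both pieces. If `t` were absent from `v`, the word `u` would be
forgotten. -/
theorem comp_mem_degenerate_right (t n : ℕ) : ∀ v u : List ℕ, t ∈ v → ¬ u.IsChain (· ≠ ·) →
    comp t n (word k v) (word k u) ∈ degenerate k
  | x :: v, u, ht, h => by
    by_cases hx : x = t
    · subst hx
      match u, h with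
      | [], h => simp at h
      | y :: u, h =>
        rw [comp_word_cons_cons, map_add, map_smul]
        refine Submodule.add_mem _ ?_ (Submodule.smul_mem _ _ ?_)
        · split_ifs with hv
          · exact cons_mem_degenerate (comp_mem_degenerate_right x n v (y :: u) hv h)
          · simp
        · rcases not_isChain_cases h with h | ⟨w, rfl⟩
          · exact cons_mem_degenerate (comp_mem_degenerate_right x n (x :: v) u ht h)
          · rw [comp_word_cons_cons]
            exact cons_cons_mem_degenerate _ _
    · rw [← cons_word, comp_cons_of_ne hx]
      exact cons_mem_degenerate (comp_mem_degenerate_right t n v u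
        ((List.mem_cons.1 ht).resolve_left (Ne.symm hx)) h)
  termination_by v u => v.length + u.length

end FreeWords

namespace FreeWords

variable {k : Type u} [CommRing k]

/-! Bilinear forms of the identities between words. -/

section Bilinear

variable {P Q R : List ℕ → Prop} {X Y Z : FreeWords k}

theorem diff_comp {t n d : ℕ} (hX : X ∈ spanOf k fun v => t ∈ v ∧ deg v = d)
    (hY : Y ∈ spanOf k fun u => ∀ a ∈ u, 1 ≤ a ∧ a ≤ n) :
    diff (comp t n X Y) = comp t n (diff X) Y + (-1 : k) ^ d • comp t n X (diff Y) := by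
  refine eq_of_mem hX (diff ∘ₗ (comp t n).flip Y)
    ((comp t n).flip Y ∘ₗ diff + (-1 : k) ^ d • (comp t n).flip (diff Y)) fun v hv => ?_
  refine eq_of_mem hY (diff ∘ₗ comp t n (word k v))
    (comp t n (diff (word k v)) + (-1 : k) ^ d • comp t n (word k v) ∘ₗ diff) fun u hu => ?_
  simpa [hv.2] using diff_comp_word v u hu (.inl hv.1)

theorem comp_comp {i j j' m n q : ℕ} (hi : 1 ≤ i) (hj' : 1 ≤ j' ∧ j' ≤ m)
    (hj : j + 1 = i + j') (hq : q + 1 = m + n) (hX : X ∈ spanOf k fun v => i ∈ v)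
    (hY : Y ∈ spanOf k fun u => ∀ a ∈ u, 1 ≤ a ∧ a ≤ m)
    (hZ : Z ∈ spanOf k fun u => ∀ a ∈ u, 1 ≤ a ∧ a ≤ n) :
    comp j n (comp i m X Y) Z = comp i q X (comp j' n Y Z) := by
  refine eq_of_mem hX ((comp j n).flip Z ∘ₗ (comp i m).flip Y) ((comp i q).flip (comp j' n Y Z))
    fun x hx => ?_
  refine eq_of_mem hY ((comp j n).flip Z ∘ₗ comp i m (word k x))
    (comp i q (word k x) ∘ₗ (comp j' n).flip Z) fun y hy => ?_
  refine eq_of_mem hZ (comp j n (comp i m (word k x) (word k y)))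
    (comp i q (word k x) ∘ₗ comp j' n (word k y)) fun z hz => ?_
  exact comp_comp_word hi hj' hj hq x y z hy hz (.inl hx)

theorem comp_comm {i j m n i' b c : ℕ} (hj : 1 ≤ j) (hji : j < i) (hi' : i' + 1 = i + n)
    (hX : X ∈ spanOf k fun v => i ∈ v ∧ j ∈ v)
    (hY : Y ∈ spanOf k fun u => (∀ a ∈ u, 1 ≤ a ∧ a ≤ m) ∧ deg u = b)
    (hZ : Z ∈ spanOf k fun u => (∀ a ∈ u, 1 ≤ a ∧ a ≤ n) ∧ deg u = c) :
    comp j n (comp i m X Y) Z = (-1 : k) ^ (b * c) • comp i' m (comp j n X Z) Y := by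
  refine eq_of_mem hX ((comp j n).flip Z ∘ₗ (comp i m).flip Y)
    ((-1 : k) ^ (b * c) • (comp i' m).flip Y ∘ₗ (comp j n).flip Z) fun x hx => ?_
  refine eq_of_mem hY ((comp j n).flip Z ∘ₗ comp i m (word k x))
    ((-1 : k) ^ (b * c) • comp i' m (comp j n (word k x) Z)) fun y hy => ?_
  refine eq_of_mem hZ (comp j n (comp i m (word k x) (word k y)))
    ((-1 : k) ^ (b * c) • (comp i' m).flip (word k y) ∘ₗ comp j n (word k x)) fun z hz => ?_
  have := comp_comm_word (k := k) hj hji hi' x y z hy.1 hz.1 (.inl hx.1) (.inl hx.2)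
  rw [hy.2, hz.2] at this
  exact this

theorem comp_mem {t n : ℕ} {S : Submodule k (FreeWords k)} (hX : X ∈ spanOf k P)
    (hY : Y ∈ spanOf k Q) (h : ∀ v u, P v → Q u → comp t n (word k v) (word k u) ∈ S) :
    comp t n X Y ∈ S :=
  map_mem hX ((comp t n).flip Y) S fun v hv =>
    map_mem hY (comp t n (word k v)) S fun u hu => h v u hv hu

end Bilinear

/-! Words of given arity and degree. -/

/-- The words in exactly the letters `1, …, n` of degree `a`. -/
def IsWordOf (n : ℕ) (a : ℤ) (w : List ℕ) : Prop :=
  1 ≤ n ∧ (∀ x, x ∈ w ↔ 1 ≤ x ∧ x ≤ n) ∧ (w.length : ℤ) = n + a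

theorem IsWordOf.mem {n : ℕ} {a : ℤ} {w : List ℕ} (h : IsWordOf n a w) :
    ∀ x ∈ w, 1 ≤ x ∧ x ≤ n := fun x => (h.2.1 x).1

theorem IsWordOf.deg_eq {n : ℕ} {a : ℤ} {w : List ℕ} (h : IsWordOf n a w) : (deg w : ℤ) = a := by
  have h1 := deg_add_card w
  have h2 : w.toFinset = Finset.Icc 1 n := by ext x; simp [h.2.1]
  rw [h2, Nat.card_Icc] at h1
  have := h.2.2
  omega

theorem isWordOf_diff {n : ℕ} {a b : ℤ} (hab : b + 1 = a) {X : FreeWords k}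
    (hX : X ∈ spanOf k (IsWordOf n a)) : diff X ∈ spanOf k (IsWordOf n b) := by
  refine map_mem hX _ _ fun w hw => spanOf_mono (fun v hv => ⟨hw.1, fun x => ?_, ?_⟩)
    (diff_word_mem w)
  · rw [hv.1, hw.2.1]
  · have := hw.2.2
    have := hv.2
    omega

theorem isWordOf_comp {m n p t : ℕ} {a b c : ℤ} (ht : 1 ≤ t) (htm : t ≤ m) (hp : m + n = p + 1)
    (hc : a + b = c) {X Y : FreeWords k} (hX : X ∈ spanOf k (IsWordOf m a))
    (hY : Y ∈ spanOf k (IsWordOf n b)) : comp t n X Y ∈ spanOf k (IsWordOf p c) := by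
  refine comp_mem hX hY fun v u hv hu => spanOf_mono (fun w hw => ⟨?_, fun z => ?_, ?_⟩)
    (comp_word_mem v u hu.mem ((hv.2.1 t).2 ⟨ht, htm⟩))
  · have := hv.1
    have := hu.1
    omega
  · rw [hw.1]
    constructor
    · rintro (⟨y, hy, rfl⟩ | ⟨x, hx, hxt, rfl⟩)
      · have := hu.mem y hy
        unfold Surj.alpha
        omega
      · have := hv.mem x hx
        unfold Surj.beta
        split_ifs <;> omega
    · rintro ⟨h1, h2⟩
      have := hu.1
      by_cases hz : z < t
      · refine .inr ⟨z, (hv.2.1 z).2 (by omega), by omega, ?_⟩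
        unfold Surj.beta
        rw [if_pos hz]
      · by_cases hz' : z < t + n
        · refine .inl ⟨z + 1 - t, (hu.2.1 _).2 (by omega), ?_⟩
          unfold Surj.alpha
          omega
        · refine .inr ⟨z + 1 - n, (hv.2.1 _).2 (by omega), by omega, ?_⟩
          unfold Surj.beta
          split_ifs <;> omega
  · have := hw.2.2
    have := hu.2.2
    have := hv.2.2
    omega

/-! Passage to the surjection operad. -/

/-- Words as elements of the surjection operad. -/
noncomputable def toSeq (n : ℕ) (a : ℤ) : FreeWords k →ₗ[k] (Surj.Seq n a →₀ k) :=
  lin (Surj.basis k n a)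

/-- Elements of the surjection operad as sums of words. -/
noncomputable def ofSeq (n : ℕ) (a : ℤ) : (Surj.Seq n a →₀ k) →ₗ[k] FreeWords k :=
  Finsupp.linearCombination k fun u => word k u.1

theorem ofSeq_single {n : ℕ} {a : ℤ} (u : Surj.Seq n a) :
    ofSeq n a (Finsupp.single u (1 : k)) = word k u.1 := by simp [ofSeq]

theorem toSeq_word {n : ℕ} {a : ℤ} (u : Surj.Seq n a) :
    toSeq n a (word k u.1) = Finsupp.single u 1 := by
  rw [toSeq, lin_word, Surj.basis, dif_pos u.2]

theorem toSeq_ofSeq {n : ℕ} {a : ℤ} (x : Surj.Seq n a →₀ k) : toSeq n a (ofSeq n a x) = x := by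
  have : toSeq n a ∘ₗ ofSeq (k := k) n a = LinearMap.id :=
    Finsupp.lhom_ext' fun u => LinearMap.ext_ring (by
      simp only [LinearMap.comp_apply, Finsupp.lsingle_apply, LinearMap.id_apply]
      rw [ofSeq_single, toSeq_word])
  exact LinearMap.congr_fun this x

theorem ofSeq_mem {n : ℕ} {a : ℤ} (x : Surj.Seq n a →₀ k) :
    ofSeq n a x ∈ spanOf k fun w => IsWordOf n a w ∧ w.IsChain (· ≠ ·) := by
  rw [ofSeq, Finsupp.linearCombination_apply]
  exact Submodule.sum_mem _ fun u _ => Submodule.smul_mem _ _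
    (word_mem ⟨⟨u.2.1.1, u.2.1.2.1, u.2.2⟩, u.2.1.2.2⟩)

theorem ofSeq_mem_isWordOf {n : ℕ} {a : ℤ} (x : Surj.Seq n a →₀ k) :
    ofSeq n a x ∈ spanOf k (IsWordOf n a) :=
  spanOf_mono (fun _ h => h.1) (ofSeq_mem x)

theorem toSeq_of_degenerate {n : ℕ} {a : ℤ} {W : FreeWords k} (hW : W ∈ degenerate k) :
    toSeq n a W = 0 :=
  eq_zero_of_mem hW _ fun w hw => by
    rw [toSeq, lin_word, Surj.basis, dif_neg fun h => hw h.1.2.2]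

theorem ofSeq_toSeq_word {n : ℕ} {a : ℤ} {w : List ℕ}
    (h : IsWordOf n a w ∧ w.IsChain (· ≠ ·)) : ofSeq n a (toSeq n a (word k w)) = word k w := by
  have := toSeq_word (k := k) (⟨w, ⟨h.1.1, h.1.2.1, h.2⟩, h.1.2.2⟩ : Surj.Seq n a)
  rw [this, ofSeq_single]

/-- On words of the right arity and degree, `ofSeq ∘ toSeq` only discards degenerate words. Any map
that kills these does not notice the passage through the surjection operad, so iterated operations
can be computed on words. -/
theorem map_ofSeq_toSeq {N : Type*} [AddCommGroup N] [Module k N] {n : ℕ} {a : ℤ}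
    {W : FreeWords k} (hW : W ∈ spanOf k (IsWordOf n a)) (f : FreeWords k →ₗ[k] N)
    (hf : ∀ w, ¬ w.IsChain (· ≠ ·) → IsWordOf n a w → f (word k w) = 0) :
    f (ofSeq n a (toSeq n a W)) = f W := by
  refine eq_of_mem hW (f ∘ₗ ofSeq n a ∘ₗ toSeq n a) f fun w hw => ?_
  by_cases h : w.IsChain (· ≠ ·)
  · simp only [LinearMap.comp_apply]
    rw [ofSeq_toSeq_word ⟨hw, h⟩]
  · simp only [LinearMap.comp_apply]
    rw [toSeq_of_degenerate (word_mem h), map_zero, map_zero, hf w h hw]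

theorem toSeq_ofTerms {n : ℕ} {a : ℤ} (L : List (ℕ × List ℕ)) :
    toSeq n a (ofTerms k L) = Surj.ofTerms k n a L := by
  rw [ofTerms, Surj.ofTerms, map_list_sum, List.map_map]
  congr 2
  funext s
  simp [toSeq]

theorem surj_d {n : ℕ} {a b : ℤ} (x : Surj.Seq n a →₀ k) :
    (Surj.d k x : Surj.Seq n b →₀ k) = toSeq n b (diff (ofSeq n a x)) := by
  have : (Surj.d k : (Surj.Seq n a →₀ k) →ₗ[k] (Surj.Seq n b →₀ k)) =
      toSeq n b ∘ₗ diff ∘ₗ ofSeq n a := by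
    refine Finsupp.lhom_ext' fun u => LinearMap.ext_ring ?_
    simp only [LinearMap.comp_apply, Finsupp.lsingle_apply]
    rw [ofSeq_single, diff_word, toSeq_ofTerms, Surj.d, Finsupp.linearCombination_single, one_smul]
  exact LinearMap.congr_fun this x

theorem surj_circ {m n p : ℕ} {a b c : ℤ} (t : ℕ) (x : Surj.Seq m a →₀ k)
    (y : Surj.Seq n b →₀ k) : (Surj.circ k t x y : Surj.Seq p c →₀ k) =
      toSeq p c (comp t n (ofSeq m a x) (ofSeq n b y)) := by
  have : (Surj.circ k t : (Surj.Seq m a →₀ k) →ₗ[k] (Surj.Seq n b →₀ k) →ₗ[k]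
      (Surj.Seq p c →₀ k)) =
      ((comp t n).compl₁₂ (ofSeq m a) (ofSeq n b)).compr₂ (toSeq p c) := by
    refine Finsupp.lhom_ext' fun v => LinearMap.ext_ring (Finsupp.lhom_ext' fun u =>
      LinearMap.ext_ring ?_)
    simp only [LinearMap.comp_apply, Finsupp.lsingle_apply, LinearMap.compr₂_apply,
      LinearMap.compl₁₂_apply]
    rw [ofSeq_single, ofSeq_single, comp_word, toSeq_ofTerms, Surj.circ,
      Finsupp.linearCombination_single, one_smul, Finsupp.linearCombination_single, one_smul]
  exact LinearMap.congr_fun (LinearMap.congr_fun this x) y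

theorem toSeq_diff_ofSeq {n : ℕ} {a b : ℤ} {W : FreeWords k} (hW : W ∈ spanOf k (IsWordOf n a)) :
    toSeq n b (diff (ofSeq n a (toSeq n a W))) = toSeq n b (diff W) :=
  map_ofSeq_toSeq hW (toSeq n b ∘ₗ diff) fun w hw _ => toSeq_of_degenerate (diff_mem_degenerate w hw)

theorem toSeq_comp_left {m n p t : ℕ} {a c : ℤ} {W Y : FreeWords k}
    (hW : W ∈ spanOf k (IsWordOf m a)) :
    toSeq p c (comp t n (ofSeq m a (toSeq m a W)) Y) = toSeq p c (comp t n W Y) :=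
  map_ofSeq_toSeq hW (toSeq p c ∘ₗ (comp t n).flip Y) fun w hw _ => toSeq_of_degenerate
    (map_mem (mem_true Y) (comp t n (word k w)) _ fun u _ => comp_mem_degenerate_left t n w u hw)

theorem toSeq_comp_right {m n p t : ℕ} (ht : 1 ≤ t) (htm : t ≤ m) {a b c : ℤ} {W X : FreeWords k}
    (hX : X ∈ spanOf k (IsWordOf m a)) (hW : W ∈ spanOf k (IsWordOf n b)) :
    toSeq p c (comp t n X (ofSeq n b (toSeq n b W))) = toSeq p c (comp t n X W) :=
  map_ofSeq_toSeq hW (toSeq p c ∘ₗ comp t n X) fun w hw _ => toSeq_of_degenerate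
    (map_mem hX ((comp t n).flip (word k w)) _ fun v hv =>
      comp_mem_degenerate_right t n v w ((hv.2.1 t).2 ⟨ht, htm⟩) hw)

theorem negOnePow_smul {M : Type*} [AddCommGroup M] [Module k M] (e : ℕ) (x : M) :
    (-1 : k) ^ e • x = (e : ℤ).negOnePow • x := by
  rcases Nat.even_or_odd e with h | h
  · rw [h.neg_one_pow, Int.negOnePow_even _ (by exact_mod_cast h), one_smul, one_smul]
  · rw [h.neg_one_pow, Int.negOnePow_odd _ (by exact_mod_cast h), Units.neg_smul, neg_smul,
      one_smul, one_smul]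

theorem comp_one_word (t : ℕ) : ∀ v : List ℕ, comp t 1 (word k v) (word k [1]) = word k v
  | [] => comp_word_of_notMem _ _ _ List.not_mem_nil
  | x :: v => by
    have ih := comp_one_word t v
    by_cases hx : x = t
    · subst hx
      have hα : Surj.alpha x 1 = x := by simp [Surj.alpha]
      have h0 : comp x 1 (word k (x :: v)) (word k []) = if x ∈ v then 0 else word k v := by
        split_ifs with h
        · exact comp_word_cons_nil _ _ h
        · have hv : comp x 1 (word k v) (word k []) = comp x 1 (word k v) (word k [1]) := by
            rw [comp_word_of_notMem _ _ _ h, comp_word_of_notMem _ _ _ h]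
          rw [← cons_word, comp_cons_last_nil 1 (word_mem h), hv, ih]
      rw [comp_word_cons_cons, ih, hα, h0, rep_of_notMem List.not_mem_nil]
      split_ifs <;> simp
    · have hβ : Surj.beta t 1 x = x := by
        unfold Surj.beta
        split_ifs <;> omega
      rw [← cons_word, comp_cons_of_ne hx, ih, hβ]

theorem one_comp_word {n : ℕ} {u : List ℕ} :
    comp 1 n (word k [1]) (word k u) = word k u := by
  have hα : Surj.alpha 1 = id := by
    funext x
    simp [Surj.alpha]
  rw [comp_word_cons_last _ _ List.not_mem_nil]
  simp [hα]

theorem ofSeq_one : ofSeq 1 0 (Surj.one k) = word k [1] := by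
  have h : IsWordOf 1 0 [1] := ⟨le_rfl, fun x => by rw [List.mem_singleton]; omega, rfl⟩
  rw [← ofSeq_toSeq_word (k := k) ⟨h, List.isChain_singleton 1⟩, toSeq, lin_word, Surj.one]

theorem toSeq_comp_comp {i j j' l m n p q r : ℕ} {a b c e f g : ℤ} {X Y Z : FreeWords k}
    (hX : X ∈ spanOf k (IsWordOf l a)) (hY : Y ∈ spanOf k (IsWordOf m b))
    (hZ : Z ∈ spanOf k (IsWordOf n c)) (hi : 1 ≤ i) (hil : i ≤ l) (hj' : 1 ≤ j') (hjm : j' ≤ m)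
    (hj : j + 1 = i + j') (hp : l + m = p + 1) (hq : m + n = q + 1) (he : a + b = e)
    (hf : b + c = f) :
    toSeq r g (comp j n (ofSeq p e (toSeq p e (comp i m X Y))) Z) =
      toSeq r g (comp i q X (ofSeq q f (toSeq q f (comp j' n Y Z)))) := by
  rw [toSeq_comp_left (isWordOf_comp hi hil hp he hX hY),
    toSeq_comp_right hi hil hX (isWordOf_comp hj' hjm hq hf hY hZ),
    comp_comp hi ⟨hj', hjm⟩ hj hq.symm
      (spanOf_mono (fun _ hw => (hw.2.1 i).2 ⟨hi, hil⟩) hX) (spanOf_mono (fun _ hw => hw.mem) hY)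
      (spanOf_mono (fun _ hw => hw.mem) hZ)]

end FreeWords

/-! ### The surjection operad satisfies the operad laws. -/

open FreeWords in
theorem surjOperad_isDGOperad (k : Type u) [CommRing k] : (surjOperad k).IsDGOperad where
  d_d {n a b c} hab hbc x := by
    change Surj.d k (Surj.d k x : Surj.Seq n b →₀ k) = 0
    rw [surj_d, surj_d, toSeq_diff_ofSeq (isWordOf_diff hab (ofSeq_mem_isWordOf x)), diff_diff,
      map_zero]
  leibniz {m n p a a' b b' c c'} i hi him hp hc ha' hb' hc' x y := by
    change Surj.d k (Surj.circ k i x y : Surj.Seq p c →₀ k) =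
      Surj.circ k i (Surj.d k x : Surj.Seq m a' →₀ k) y +
        a.negOnePow • Surj.circ k i x (Surj.d k y : Surj.Seq n b' →₀ k)
    have hX := ofSeq_mem_isWordOf x
    have hY := ofSeq_mem_isWordOf y
    simp only [surj_d, surj_circ]
    rw [toSeq_diff_ofSeq (isWordOf_comp hi him hp hc hX hY),
      toSeq_comp_left (isWordOf_diff ha' hX), toSeq_comp_right hi him hX (isWordOf_diff hb' hY)]
    -- Signs for words have natural exponents. In negative degree there are no words, because the
    -- degree of a word counts entries.
    rcases lt_or_ge a 0 with ha | ha
    · have : ofSeq m a x = 0 := eq_zero_of_mem hX LinearMap.id fun w hw => by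
        have := hw.deg_eq
        omega
      rw [this]
      simp
    · lift a to ℕ using ha
      rw [diff_comp (d := a) (spanOf_mono (fun w hw => ⟨(hw.2.1 i).2 ⟨hi, him⟩, by
        exact_mod_cast hw.deg_eq⟩) hX) (spanOf_mono (fun _ hw => hw.mem) hY), map_add, map_smul,
        negOnePow_smul]
  one_circ {n a} x := by
    change (Surj.circ k 1 (Surj.one k) x : Surj.Seq n a →₀ k) = x
    rw [surj_circ, ofSeq_one]
    conv_rhs => rw [← toSeq_ofSeq x]
    congr 1
    exact eq_of_mem (mem_true (ofSeq n a x)) (comp 1 n (word k [1])) LinearMap.id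
      fun w _ => one_comp_word
  circ_one {n a} i hi hin x := by
    change (Surj.circ k i x (Surj.one k) : Surj.Seq n a →₀ k) = x
    rw [surj_circ, ofSeq_one]
    conv_rhs => rw [← toSeq_ofSeq x]
    congr 1
    exact eq_of_mem (mem_true (ofSeq n a x)) ((comp i 1).flip (word k [1])) LinearMap.id
      fun w _ => comp_one_word i w
  parallel {l m n p q r a b c e f g} i j hj hji hil hp hq hr he hf hg x y z := by
    change Surj.circ k j (Surj.circ k i x y : Surj.Seq p e →₀ k) z = (b * c).negOnePow •
      Surj.circ k (i + n - 1) (Surj.circ k j x z : Surj.Seq q f →₀ k) y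
    have hX := ofSeq_mem_isWordOf x
    have hY := ofSeq_mem_isWordOf y
    have hZ := ofSeq_mem_isWordOf z
    simp only [surj_circ]
    rw [toSeq_comp_left (isWordOf_comp (by omega) hil hp he hX hY),
      toSeq_comp_left (isWordOf_comp hj (by omega) hq hf hX hZ)]
    rcases lt_or_ge b 0 with hb | hb
    · have : ofSeq m b y = 0 := eq_zero_of_mem hY LinearMap.id fun w hw => by
        have := hw.deg_eq
        omega
      rw [this]
      simp
    rcases lt_or_ge c 0 with hc | hc
    · have : ofSeq n c z = 0 := eq_zero_of_mem hZ LinearMap.id fun w hw => by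
        have := hw.deg_eq
        omega
      rw [this]
      simp
    lift b to ℕ using hb
    lift c to ℕ using hc
    rcases Nat.eq_zero_or_pos n with hn | hn
    · have : ofSeq n c z = 0 := eq_zero_of_mem hZ LinearMap.id fun w hw => by
        have := hw.1
        omega
      rw [this]
      simp
    rw [comp_comm (b := b) (c := c) (i' := i + n - 1) hj hji (by omega)
      (spanOf_mono (fun w hw => ⟨(hw.2.1 i).2 (by omega), (hw.2.1 j).2 (by omega)⟩) hX)
      (spanOf_mono (fun w hw => ⟨hw.mem, by exact_mod_cast hw.deg_eq⟩) hY)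
      (spanOf_mono (fun w hw => ⟨hw.mem, by exact_mod_cast hw.deg_eq⟩) hZ), map_smul,
      negOnePow_smul, Nat.cast_mul]
  sequential {l m n p q r a b c e f g} i j hi hil hij hjm hp hq hr he hf hg x y z := by
    change Surj.circ k j (Surj.circ k i x y : Surj.Seq p e →₀ k) z =
      Surj.circ k i x (Surj.circ k (j - i + 1) y z : Surj.Seq q f →₀ k)
    simp only [surj_circ]
    exact toSeq_comp_comp (ofSeq_mem_isWordOf x) (ofSeq_mem_isWordOf y) (ofSeq_mem_isWordOf z)
      hi hil (by omega) (by omega) (by omega) hp hq he hf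

/-! ### Suboperads, and the operad of cacti. -/

namespace DGOperadData

theorem IsDGOperad.sub {k : Type u} [CommRing k] {O : DGOperadData k} (hO : O.IsDGOperad)
    (S : ∀ (n : ℕ) (a : ℤ), Submodule k (O.obj n a)) (h_one : O.one ∈ S 1 0)
    (h_circ : ∀ {m n p : ℕ} {a b c : ℤ} (i : ℕ) (hi : 1 ≤ i) (him : i ≤ m)
      (hp : m + n = p + 1) (hc : a + b = c) (x : O.obj m a) (y : O.obj n b),
      x ∈ S m a → y ∈ S n b → O.circ i hi him hp hc x y ∈ S p c)
    (h_d : ∀ {n : ℕ} {a b : ℤ} (h : b + 1 = a) (x : O.obj n a), x ∈ S n a → O.d h x ∈ S n b) :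
    (O.sub S h_one h_circ h_d).IsDGOperad where
  d_d hab hbc x := Subtype.ext (hO.d_d hab hbc x.1)
  leibniz {_ _ _ a _ _ _ _ _} i hi him hp hc ha' hb' hc' x y := Subtype.ext <| by
    have := hO.leibniz i hi him hp hc ha' hb' hc' x.1 y.1
    rw [Units.smul_def] at this ⊢
    exact this
  one_circ x := Subtype.ext (hO.one_circ x.1)
  circ_one i hi hin x := Subtype.ext (hO.circ_one i hi hin x.1)
  parallel i j hj hji hil hp hq hr he hf hg x y z := Subtype.ext <| by
    have := hO.parallel i j hj hji hil hp hq hr he hf hg x.1 y.1 z.1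
    rw [Units.smul_def] at this ⊢
    exact this
  sequential i j hi hil hij hjm hp hq hr he hf hg x y z :=
    Subtype.ext (hO.sequential i j hi hil hij hjm hp hq hr he hf hg x.1 y.1 z.1)

end DGOperadData

theorem cactusOperad_isDGOperad (k : Type u) [CommRing k] : (cactusOperad k).IsDGOperad :=
  (surjOperad_isDGOperad k).sub _ _ _ _

namespace FreeWords

variable {k : Type u} [CommRing k]

/-! Insertion of a new letter. -/

variable (k) in
/-- The signed sum of the words obtained by replacing a letter `y ≠ x` of a word by `y, n, y`. -/
noncomputable def insWord (x n : ℕ) : List ℕ → FreeWords k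
  | [] => 0
  | y :: u => if y = x then -cons x (insWord x n u)
      else word k (y :: n :: y :: u) + (-1 : k) ^ rep y u • cons y (insWord x n u)

/-- The linear extension of `insWord`. -/
noncomputable def ins (x n : ℕ) : FreeWords k →ₗ[k] FreeWords k := lin (insWord k x n)

variable {x n : ℕ}

@[simp] theorem ins_nil : ins x n (word k []) = 0 := by simp [ins, insWord]

theorem ins_cons_self (W : FreeWords k) : ins x n (cons x W) = -cons x (ins x n W) :=
  eq_of_mem (mem_true W) (ins x n ∘ₗ cons x) (-(cons (k := k) x ∘ₗ ins x n)) fun w _ => by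
    simp [ins, insWord]

theorem ins_cons {y : ℕ} (hy : y ≠ x) {c : Prop} [Decidable c] {W : FreeWords k}
    (hW : W ∈ spanOf k fun w => y ∈ w ↔ c) :
    ins x n (cons y W) = cons y (cons n (cons y W)) +
      (-1 : k) ^ (if c then 1 else 0) • cons y (ins x n W) :=
  eq_of_mem hW (ins x n ∘ₗ cons y) (cons (k := k) y ∘ₗ cons n ∘ₗ cons y +
    (-1 : k) ^ (if c then 1 else 0) • (cons (k := k) y ∘ₗ ins x n)) fun w hw => by
      simp only [ins, insWord, LinearMap.comp_apply, LinearMap.add_apply, LinearMap.smul_apply,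
        cons_word, lin_word, if_neg hy, rep, hw]

theorem ins_word_mem : ∀ {u : List ℕ}, n ∉ u → n ≠ x → ins x n (word k u) ∈ spanOf k fun w =>
    (∀ z, z ∈ w ↔ z ∈ u ∨ z = n) ∧ w.length = u.length + 2 ∧ w.count n = 1
  | [], _, _ => by simp
  | y :: u, h, hn => by
    rw [List.mem_cons, not_or] at h
    have ih := ins_word_mem h.2 hn
    have hc : cons y (ins x n (word k u)) ∈ spanOf k fun w =>
        (∀ z, z ∈ w ↔ z ∈ y :: u ∨ z = n) ∧ w.length = (y :: u).length + 2 ∧ w.count n = 1 :=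
      cons_mem ih fun w hw => ⟨fun z => by simp [hw.1, or_assoc], by simp [hw.2],
        by rw [List.count_cons_of_ne (Ne.symm h.1), hw.2.2]⟩
    rw [← cons_word]
    by_cases hy : y = x
    · subst hy
      rw [ins_cons_self]
      exact Submodule.neg_mem _ hc
    · rw [ins_cons hy (word_mem (Iff.rfl : y ∈ u ↔ y ∈ u)), cons_word, cons_word, cons_word]
      refine Submodule.add_mem _ (word_mem ⟨fun z => ?_, by simp, ?_⟩) (Submodule.smul_mem _ _ hc)
      · simp only [List.mem_cons]
        tauto
      · rw [List.count_cons_of_ne (Ne.symm h.1), List.count_cons_self,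
          List.count_cons_of_ne (Ne.symm h.1), List.count_eq_zero_of_not_mem h.2]

theorem deg_ins_word {u : List ℕ} (h : n ∉ u) (hn : n ≠ x) :
    ins x n (word k u) ∈ spanOf k fun w => deg w = deg u + 1 := by
  refine spanOf_mono (fun w hw => ?_) (ins_word_mem h hn)
  have h1 := deg_add_card u
  have h2 := deg_add_card w
  have h3 : w.toFinset = insert n u.toFinset := by ext z; simp [hw.1, or_comm]
  rw [h3, Finset.card_insert_of_notMem (by simpa using h), hw.2.1] at h2
  omega

theorem mem_ins_word {u : List ℕ} (h : n ∉ u) (hn : n ≠ x) {y : ℕ} (hy : y ≠ n) :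
    ins x n (word k u) ∈ spanOf k fun w => y ∈ w ↔ y ∈ u :=
  spanOf_mono (fun _ hw => (hw.1 y).trans (or_iff_left hy)) (ins_word_mem h hn)

/-- A wrapped `y` occurs at least twice and is killed by `drop y`, so only the wrappings of other
letters survive; passing a `y` that occurs once costs no sign. -/
theorem drop_ins_word (hnx : n ≠ x) {y : ℕ} (hyx : y ≠ x) (hyn : y ≠ n) : ∀ {u : List ℕ}, n ∉ u →
    drop y (ins x n (word k u)) = ins x n (drop y (word k u))
  | [], _ => by simp [drop_word_of_notMem]
  | z :: u, h => by
    rw [List.mem_cons, not_or] at h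
    have ih := drop_ins_word hnx hyx hyn h.2
    rw [← cons_word]
    by_cases hzx : z = x
    · subst hzx
      rw [ins_cons_self, map_neg, drop_cons_of_ne hyx.symm, drop_cons_of_ne hyx.symm, ins_cons_self,
        ih]
    · have hu : word k u ∈ spanOf k fun w => z ∈ w ↔ z ∈ u := word_mem Iff.rfl
      rw [ins_cons hzx hu, map_add, map_smul]
      by_cases hzy : z = y
      · subst hzy
        rw [drop_cons_self_of_mem (by simp only [cons_word]; exact word_mem (by simp)), zero_add]
        have hm := mem_ins_word (k := k) h.2 hnx hyn
        by_cases hzu : z ∈ u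
        · rw [drop_cons_self_of_mem (spanOf_mono (fun w hw => hw.2 hzu) hm),
            drop_cons_self_of_mem (word_mem hzu)]
          simp
        · rw [drop_cons_self_of_notMem (spanOf_mono (fun w hw => mt hw.1 hzu) hm),
            drop_cons_self_of_notMem (word_mem hzu)]
          simp [hzu]
      · rw [drop_cons_of_ne hzy, drop_cons_of_ne (Ne.symm hyn), drop_cons_of_ne hzy,
          drop_cons_of_ne hzy, ih, ins_cons (c := z ∈ u) hzx
          (spanOf_mono (fun w hw => (hw.1 z).trans (and_iff_left hzy)) (drop_word_mem y u))]

variable (k) in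
/-- For a word `(L, x, R)` in which `x` occurs once, the sum
`(L, n, x, R) + (L, x, n, R) - (L, x, R, n)`. -/
noncomputable def bdryWord (x n : ℕ) : List ℕ → FreeWords k
  | [] => word k [n]
  | y :: u => if y = x then word k (n :: x :: u) + word k (x :: n :: u) - cons x (bdryWord x n u)
      else cons y (bdryWord x n u)

/-- Deleting one of the two copies of `y` in `(y, n, y)` puts `n` to the left or to the right of
`y`, so these terms telescope from `(n, u)` towards `(u, n)`; all other deletions cancel against
`ins (diff u)`. The letter `x` is never wrapped and reverses the sign, hence the telescope breaks
there and leaves the words with `n` on either side of `x`. -/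
theorem diff_ins_word (hnx : n ≠ x) : ∀ {u : List ℕ}, n ∉ u → u.count x ≤ 1 →
    diff (ins x n (word k u)) + ins x n (diff (word k u)) = word k (n :: u) - bdryWord k x n u
  | [], _, _ => by simp [bdryWord]
  | y :: u, h, hc => by
    rw [List.mem_cons, not_or] at h
    have ih := diff_ins_word hnx h.2
    by_cases hy : y = x
    · subst hy
      rw [List.count_cons_self] at hc
      have hu : y ∉ u := List.count_eq_zero.1 (by omega)
      replace ih := ih (by omega)
      have hm := mem_ins_word (k := k) h.2 hnx hnx.symm
      rw [← cons_word, ins_cons_self, map_neg, diff_cons_of_notMem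
        (spanOf_mono (fun w hw => mt hw.1 hu) hm), diff_cons_of_notMem (word_mem hu), ins_cons_self,
        ← neg_add, ← map_add, ih, bdryWord, if_pos rfl, map_sub, cons_word]
      abel
    · rw [List.count_cons_of_ne hy] at hc
      replace ih := congrArg (cons y) (ih hc)
      have hm := mem_ins_word (k := k) h.2 hnx (y := y) (Ne.symm h.1)
      have hu : word k u ∈ spanOf k fun w => y ∈ w ↔ y ∈ u := word_mem Iff.rfl
      have hdu : diff (word k u) ∈ spanOf k fun w => y ∈ w ↔ y ∈ u :=
        spanOf_mono (fun w hw => hw.1 y) (diff_word_mem u)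
      have h1 : cons n (cons y (word k u)) ∈ spanOf k fun w => y ∈ w := by
        simp only [cons_word]; exact word_mem (by simp)
      have h2 : cons y (word k u) ∈ spanOf k fun w => n ∉ w := by
        rw [cons_word]
        exact word_mem (by rw [List.mem_cons, not_or]; exact h)
      rw [map_add, map_sub] at ih
      rw [← cons_word, ins_cons hy hu, map_add, map_smul, diff_cons_of_mem h1,
        diff_cons_of_notMem h2, drop_cons_of_ne h.1, bdryWord, if_neg hy]
      by_cases hyu : y ∈ u
      · have hdr : drop y (word k u) ∈ spanOf k fun w => y ∈ w ↔ False :=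
          spanOf_mono (fun w hw => iff_false_intro hw) (notMem_drop_word_self y u)
        rw [drop_cons_self_of_mem (word_mem hyu), diff_cons_of_mem (word_mem hyu),
          diff_cons_of_mem (spanOf_mono (fun w hw => hw.2 hyu) hm),
          drop_ins_word hnx hy (Ne.symm h.1) h.2, map_sub (ins (k := k) x n), map_sub (ins (k := k) x n),
          ins_cons hy hdr, ins_cons hy hdu]
        simp only [if_pos hyu, if_false, map_sub, map_zero, ← cons_word] at ih ⊢
        linear_combination (norm := module) ih
      · rw [drop_cons_self_of_notMem (word_mem hyu), diff_cons_of_notMem (word_mem hyu),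
          diff_cons_of_notMem (spanOf_mono (fun w hw => mt hw.1 hyu) hm), ins_cons hy hdu]
        simp only [if_neg hyu, ← cons_word] at ih ⊢
        linear_combination (norm := module) ih

theorem bdryWord_of_notMem : ∀ {u : List ℕ}, x ∉ u → bdryWord k x n u = word k (u ++ [n])
  | [], _ => rfl
  | y :: u, h => by
    rw [List.mem_cons, not_or] at h
    rw [bdryWord, if_neg (Ne.symm h.1), bdryWord_of_notMem h.2, cons_word]
    rfl

theorem map_beta_of_lt {t n : ℕ} {u : List ℕ} (h : ∀ y ∈ u, y < t) :
    u.map (Surj.beta t n) = u := by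
  conv_rhs => rw [← List.map_id u]
  exact List.map_congr_left fun y hy => if_pos (h y hy)

/-- Since `x` is the largest letter and occurs once, placing `x + 1` directly after or before it is
the same as composing at `x` with `(1,2)` or `(2,1)`, without cuts. -/
theorem bdryWord_eq : ∀ {u : List ℕ}, u.count x = 1 → (∀ y ∈ u, 1 ≤ y ∧ y ≤ x) →
    bdryWord k x (x + 1) u = comp x 2 (word k u) (word k [1, 2] + word k [2, 1]) -
      word k (u ++ [x + 1])
  | [], h, _ => by simp at h
  | y :: u, h, hu => by
    have hu' : ∀ y ∈ u, 1 ≤ y ∧ y ≤ x := fun y hy => hu y (List.mem_cons_of_mem _ hy)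
    by_cases hy : y = x
    · subst hy
      rw [List.count_cons_self] at h
      have hyu : y ∉ u := List.count_eq_zero.1 (by omega)
      have hβ := map_beta_of_lt (n := 2) fun z hz =>
        lt_of_le_of_ne (hu' z hz).2 fun e : z = y => hyu (e ▸ hz)
      have hy1 := (hu y List.mem_cons_self).1
      have h1 : Surj.alpha y 1 = y := by unfold Surj.alpha; omega
      have h2 : Surj.alpha y 2 = y + 1 := by unfold Surj.alpha; omega
      rw [bdryWord, if_pos rfl, bdryWord_of_notMem hyu, map_add, comp_word_cons_last _ _ hyu,
        comp_word_cons_last _ _ hyu, hβ]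
      simp [deg_cons, rep, h1, h2]
      abel
    · rw [List.count_cons_of_ne hy] at h
      have hlt : y < x := lt_of_le_of_ne (hu y List.mem_cons_self).2 hy
      have hβ : Surj.beta x 2 y = y := if_pos hlt
      rw [bdryWord, if_neg hy, bdryWord_eq h hu', ← cons_word y u, comp_cons_of_ne hy, hβ, map_sub,
        cons_word]
      rfl

/-! Insertion in compositions. -/

section InsComp

variable {p q i x' n' : ℕ}

/-- Insertion into `v ∘_i u` when the distinguished letter comes from `v`. -/
theorem ins_comp_word_left (hi : 1 ≤ i) (hip : i < p) (hx' : x' + 1 = p + q) (hn' : n' = p + q)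
    (v u : List ℕ) (hu : ∀ z ∈ u, 1 ≤ z ∧ z ≤ q) (hv : ∀ y ∈ v, y ≤ p) (h : i ∈ v ∨ u = []) :
    ins x' n' (comp i q (word k v) (word k u)) =
      comp i q (ins p (p + 1) (word k v)) (word k u) := by
  induction hN : v.length + u.length using Nat.strong_induction_on generalizing v u with
  | _ N ih =>
  subst hN
  have ih v u hu hv h hN := ih (v.length + u.length) hN v u hu hv h rfl
  have hpp : p + 1 ≠ p := by omega
  rcases v with _ | ⟨y, v⟩
  · rw [comp_word_of_notMem _ _ _ List.not_mem_nil, ins_nil, map_zero, List.map_nil, ins_nil,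
      LinearMap.zero_apply]
  have hv' : ∀ y ∈ v, y ≤ p := fun y hy => hv y (List.mem_cons_of_mem _ hy)
  have hpv : p + 1 ∉ v := fun h => by have := hv' _ h; omega
  have hyp := hv y List.mem_cons_self
  have hβp : Surj.beta i q (p + 1) = n' := by
    unfold Surj.beta
    split_ifs <;> omega
  by_cases hyi : y = i
  swap
  · have ih := ih v u hu hv' (h.imp_left fun h => (List.mem_cons.1 h).resolve_left (Ne.symm hyi))
      (by simp)
    rw [← cons_word, comp_cons_of_ne hyi]
    by_cases hy : y = p
    · subst hy
      have hβ : Surj.beta i q y = x' := by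
        unfold Surj.beta
        split_ifs <;> omega
      rw [hβ, ins_cons_self, ins_cons_self, ih, map_neg, LinearMap.neg_apply,
        comp_cons_of_ne hyi, hβ]
    · have hβ : Surj.beta i q y ≠ x' := by
        unfold Surj.beta
        split_ifs <;> omega
      rw [ins_cons (c := y ∈ v) hβ (mem_beta_comp hu hyi), ins_cons (c := y ∈ v) hy
        (word_mem Iff.rfl), map_add, map_smul, LinearMap.add_apply, LinearMap.smul_apply,
        comp_cons_of_ne hyi, comp_cons_of_ne (by omega), comp_cons_of_ne hyi, comp_cons_of_ne hyi,
        hβp, ih]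
  subst hyi
  have hmv := mem_ins_word (k := k) hpv hpp (y := y) (by omega)
  have hyw : cons (p + 1) (cons y (word k v)) ∈ spanOf k fun w => y ∈ w := by
    simp only [cons_word]; exact word_mem (by simp)
  rcases u with _ | ⟨z, u⟩
  · rw [← cons_word, ins_cons (c := y ∈ v) hip.ne (word_mem Iff.rfl), map_add, map_smul,
      LinearMap.add_apply, LinearMap.smul_apply, comp_cons_nil q hyw, zero_add]
    by_cases hyv : y ∈ v
    · rw [comp_cons_nil q (word_mem hyv), comp_cons_nil q (spanOf_mono (fun w hw => hw.2 hyv) hmv)]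
      simp
    · rw [comp_cons_last_nil q (word_mem hyv), comp_cons_last_nil q
        (spanOf_mono (fun w hw => mt hw.1 hyv) hmv), ih v [] hu hv' (.inr rfl) (by simp)]
      simp [hyv]
  have hyy : y ∈ y :: v := List.mem_cons_self
  have hz := hu z List.mem_cons_self
  have hu' : ∀ z ∈ u, 1 ≤ z ∧ z ≤ q := fun a h => hu a (List.mem_cons_of_mem _ h)
  have hα : Surj.alpha y z ≠ x' := by
    unfold Surj.alpha
    omega
  have hwu : word k u ∈ spanOf k fun w => z ∈ w ↔ z ∈ u := word_mem Iff.rfl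
  have hwv : word k v ∈ spanOf k fun w => (y ∈ w ↔ y ∈ v) ∧ deg (y :: w) = deg (y :: v) :=
    word_mem ⟨Iff.rfl, rfl⟩
  have d1 : cons (p + 1) (cons y (word k v)) ∈ spanOf k fun w =>
      (y ∈ w ↔ True) ∧ deg (y :: w) = deg (y :: v) + 1 := by
    simp only [cons_word]
    refine word_mem ⟨by simp, ?_⟩
    rw [deg_cons, rep_of_mem (by simp), deg_cons (p + 1), rep_of_notMem (u := y :: v)
      (by rw [List.mem_cons, not_or]; exact ⟨by omega, hpv⟩)]
    ring
  have d2 : ins p (p + 1) (word k v) ∈ spanOf k fun w =>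
      (y ∈ w ↔ y ∈ v) ∧ deg (y :: w) = deg (y :: v) + 1 :=
    spanOf_mono (fun w hw => ⟨hw.1, by rw [deg_cons, rep_congr hw.1, hw.2, deg_cons]; ring⟩)
      (spanOf_and hmv (deg_ins_word hpv hpp))
  have m2 := mem_alpha_comp (k := k) hu' hyy hz
  have ih2 := congrArg (cons (Surj.alpha y z)) (ih (y :: v) u hu' hv (.inl hyy) (by simp))
  have ih1 (hyv : y ∈ v) := ih v (z :: u) hu hv' (.inl hyv) (by simp)
  have m1 (hyv : y ∈ v) : comp y q (word k v) (word k (z :: u)) ∈ spanOf k fun w =>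
      Surj.alpha y z ∈ w ↔ True :=
    spanOf_mono (fun w hw => iff_true_intro (hw.2 List.mem_cons_self)) (mem_alpha_comp hu hyv hz)
  simp only [← cons_word] at ih1 ih2 m1 m2 ⊢
  -- Wrapping a letter `z` of the inner word around the new letter amounts to replacing `y` by `(y,
  -- p + 1, y)` in the outer word and cutting the inner word at `z`. So the first summand of
  -- `ins_cons` on the right matches the wrapped inner letters on the left.
  rw [ins_cons (c := y ∈ v) hip.ne (word_mem Iff.rfl), comp_cons_cons q hwv hwu, map_add (cons _), map_add (ins x' n'), map_add (comp y q),
    LinearMap.add_apply, comp_cons_cons q d1 hwu, comp_cons_of_ne (show p + 1 ≠ y by omega), hβp,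
    comp_cons_cons q hwv hwu, map_smul (comp y q), LinearMap.smul_apply, comp_cons_cons q d2 hwu,
    map_smul, map_smul, ins_cons hα m2]
  rw [ins_cons (c := y ∈ v) hip.ne (word_mem Iff.rfl), map_add, map_smul (comp y q),
    LinearMap.add_apply, LinearMap.smul_apply, map_add, map_smul] at ih2
  by_cases hyv : y ∈ v
  · rw [if_pos hyv] at ih2
    rw [if_pos hyv, if_pos hyv, if_pos hyv, if_pos trivial, ins_cons hα (m1 hyv), ih1 hyv]
    simp only [if_pos, map_add, map_smul]
    rw [ih2]
    split_ifs
    · simp only [one_mul, pow_succ, pow_zero]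
      module
    · simp only [zero_mul, pow_succ, pow_zero]
      module
  · rw [if_neg hyv] at ih2
    rw [if_neg hyv, if_neg hyv, if_neg hyv, if_pos trivial]
    simp only [map_add, map_smul, map_zero]
    rw [ih2]
    split_ifs
    · simp only [one_mul, pow_succ, pow_zero]
      module
    · simp only [zero_mul, pow_zero]
      module

/-- This treats the part of the outer word that follows its only `p`: there neither the
distinguished letter nor the inner word is seen any more. -/
theorem ins_comp_word_of_notMem (hx' : x' + 1 = p + q) (hn' : n' = p + q) (hq : 1 ≤ q)
    (u : List ℕ) : ∀ v : List ℕ, (∀ y ∈ v, y < p) →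
    ins x' n' (comp p q (word k v) (word k u)) = comp p q (ins p (p + 1) (word k v)) (word k u)
  | [], _ => by
    rw [comp_word_of_notMem _ _ _ List.not_mem_nil, ins_nil, map_zero, List.map_nil, ins_nil,
      LinearMap.zero_apply]
  | y :: v, hv => by
    have hyp := hv y List.mem_cons_self
    have hv' : ∀ y ∈ v, y < p := fun y hy => hv y (List.mem_cons_of_mem _ hy)
    have ih := ins_comp_word_of_notMem hx' hn' hq u v hv'
    have hβ : Surj.beta p q y = y := if_pos hyp
    have hβp : Surj.beta p q (p + 1) = n' := by
      unfold Surj.beta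
      split_ifs <;> omega
    have hm : comp p q (word k v) (word k u) ∈ spanOf k fun w => y ∈ w ↔ y ∈ v := by
      rw [comp_word_of_notMem _ _ _ fun h => (hv' p h).false, map_beta_of_lt hv']
      exact word_mem Iff.rfl
    rw [← cons_word, comp_cons_of_ne hyp.ne, hβ, ins_cons (by omega) hm,
      ins_cons (c := y ∈ v) hyp.ne (word_mem Iff.rfl), map_add, map_smul, LinearMap.add_apply,
      LinearMap.smul_apply, comp_cons_of_ne hyp.ne, comp_cons_of_ne (by omega),
      comp_cons_of_ne hyp.ne, comp_cons_of_ne hyp.ne, hβp, hβ, ih]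

/-- As `p` occurs only at the front, `u` enters as a single block, and the wrapped letter lies
either in `v` or in `u`. Reaching `v` means passing the distinguished letter, which is the image of
`q`, hence the sign `u.count q`; it is left as a count because the induction reads `u` from the left
and `q` may already have been passed. -/
theorem ins_comp_cons_last (hp : 1 ≤ p) (hx' : x' + 1 = p + q) (hn' : n' = p + q) (hq : 1 ≤ q)
    {v : List ℕ} (hv : ∀ y ∈ v, y < p) : ∀ u : List ℕ, (∀ z ∈ u, 1 ≤ z ∧ z ≤ q) → u.count q ≤ 1 →
    ins x' n' (comp p q (word k (p :: v)) (word k u)) =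
      (-1 : k) ^ u.count q • comp p q (cons p (ins p (p + 1) (word k v))) (word k u) +
      (-1 : k) ^ deg v • comp p q (word k (p :: v)) (ins q (q + 1) (word k u))
  | [], _, _ => by
    have hpv : p ∉ v := fun h => (hv p h).false
    have hpv' : p + 1 ∉ v := fun h => by have := hv _ h; omega
    have hpp : p + 1 ≠ p := by omega
    rw [← cons_word, comp_cons_last_nil q (word_mem hpv), ins_comp_word_of_notMem hx' hn' hq [] v hv,
      comp_cons_last_nil q (spanOf_mono (fun w hw => mt hw.1 hpv)
        (mem_ins_word hpv' hpp hpp.symm))]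
    simp
  | z :: u, hu, hc => by
    have hpv : p ∉ v := fun h => (hv p h).false
    have hpv' : p + 1 ∉ v := fun h => by have := hv _ h; omega
    have hpp : p + 1 ≠ p := by omega
    have hz := hu z List.mem_cons_self
    have hu' : ∀ z ∈ u, 1 ≤ z ∧ z ≤ q := fun a h => hu a (List.mem_cons_of_mem _ h)
    have hqu : q + 1 ∉ u := fun h => by have := hu' _ h; omega
    have hqq : q + 1 ≠ q := by omega
    have hpp' : p ∈ p :: v := List.mem_cons_self
    have hdeg : deg (p :: v) = deg v := by rw [deg_cons, rep_of_notMem hpv, zero_add]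
    have hwu : word k u ∈ spanOf k fun w => z ∈ w ↔ z ∈ u := word_mem Iff.rfl
    have hiu : ins q (q + 1) (word k u) ∈ spanOf k fun w => z ∈ w ↔ z ∈ u :=
      mem_ins_word hqu hqq (by omega)
    have hwv : word k v ∈ spanOf k fun w => (p ∈ w ↔ False) ∧ deg (p :: w) = deg v :=
      word_mem ⟨iff_false_intro hpv, hdeg⟩
    have hiv : ins p (p + 1) (word k v) ∈ spanOf k fun w =>
        (p ∈ w ↔ False) ∧ deg (p :: w) = deg v + 1 :=
      spanOf_mono (fun w hw => ⟨hw.1.trans (iff_false_intro hpv), by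
        rw [deg_cons, rep_of_notMem (mt hw.1.1 hpv), hw.2, zero_add]⟩)
        (spanOf_and (mem_ins_word hpv' hpp hpp.symm) (deg_ins_word hpv' hpp))
    have m2 := mem_alpha_comp (k := k) hu' hpp' hz
    have ih := ins_comp_cons_last hp hx' hn' hq hv u hu'
    by_cases hzq : z = q
    · subst hzq
      rw [List.count_cons_self] at hc ⊢
      have hzu : z ∉ u := List.count_eq_zero.1 (by omega)
      replace ih := ih (by omega)
      have hα : Surj.alpha p z = x' := by
        unfold Surj.alpha
        omega
      simp only [← cons_word] at ih ⊢
      rw [ins_cons_self, map_neg, comp_cons_cons z hwv hwu, comp_cons_cons z hwv hiu,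
        comp_cons_cons z hiv hwu, hα, ins_cons_self]
      simp only [if_false, if_neg hzu, zero_mul, pow_zero, one_smul, zero_add]
      rw [ih, pow_succ, map_add, map_smul, map_smul]
      module
    · rw [List.count_cons_of_ne hzq] at hc ⊢
      replace ih := ih hc
      have hα : Surj.alpha p z ≠ x' := by
        unfold Surj.alpha
        omega
      have hαq : Surj.alpha p (q + 1) = n' := by
        unfold Surj.alpha
        omega
      have h1 : cons z (word k u) ∈ spanOf k fun w => q + 1 ∈ w ↔ False := by
        rw [cons_word]
        refine word_mem (iff_false_intro ?_)
        rw [List.mem_cons, not_or]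
        exact ⟨by omega, hqu⟩
      have h2 : cons (q + 1) (cons z (word k u)) ∈ spanOf k fun w => z ∈ w ↔ True := by
        simp only [cons_word]
        exact word_mem (by simp)
      simp only [← cons_word] at ih m2 ⊢
      rw [ins_cons hzq hwu, map_add, map_smul (comp p q _), comp_cons_cons q hwv h2,
        comp_cons_cons q hwv h1, comp_cons_cons q hwv hwu, comp_cons_cons q hwv hiu,
        comp_cons_cons q hiv hwu, hαq]
      simp only [if_false, if_true, zero_mul, pow_zero, one_smul, zero_add, one_mul]
      rw [map_smul, map_smul, ins_cons hα m2, ih]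
      by_cases hzu : z ∈ u
      · simp only [if_pos hzu, map_add, map_smul, one_mul, pow_succ]
        rcases neg_one_pow_eq_or k (deg v) with e | e <;> rw [e] <;> module
      · simp only [if_neg hzu, map_add, map_smul, zero_mul, pow_zero]
        rcases neg_one_pow_eq_or k (deg v) with e | e <;> rw [e] <;> module

/-- The arity of the inner word enters only through the relabelling of letters greater than `t`. -/
theorem comp_congr_arity {t n m : ℕ} {v : List ℕ} (hv : ∀ y ∈ v, y ≤ t) (U : FreeWords k) :
    comp t n (word k v) U = comp t m (word k v) U := by
  refine eq_of_mem (mem_true U) _ _ fun u hu => ?_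
  clear hu
  induction hN : v.length + u.length using Nat.strong_induction_on generalizing v u with
  | _ N ih =>
  subst hN
  have ih v u hv hN := ih (v.length + u.length) hN (v := v) hv u rfl
  rcases v with _ | ⟨y, v⟩
  · simp [comp_word_of_notMem _ _ _ List.not_mem_nil]
  have hyp := hv y List.mem_cons_self
  have hv' : ∀ y ∈ v, y ≤ t := fun y hy => hv y (List.mem_cons_of_mem _ hy)
  by_cases hy : y = t
  · subst hy
    rcases u with _ | ⟨z, u⟩
    · by_cases hyv : y ∈ v
      · rw [comp_word_cons_nil _ _ hyv, comp_word_cons_nil _ _ hyv]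
      · rw [← cons_word, comp_cons_last_nil n (word_mem hyv), comp_cons_last_nil m (word_mem hyv),
          ih v [] hv' (by simp)]
    · rw [comp_word_cons_cons, comp_word_cons_cons, ih v (z :: u) hv' (by simp),
        ih (y :: v) u hv (by simp)]
  · have hlt : y < t := lt_of_le_of_ne hyp hy
    rw [← cons_word, comp_cons_of_ne hy, comp_cons_of_ne hy, ih v u hv' (by simp), Surj.beta,
      Surj.beta, if_pos hlt, if_pos hlt]

/-- Insertion into `v ∘_p u` when `p` is the distinguished letter of `v`. -/
theorem ins_comp_word_last (hp : 1 ≤ p) (hx' : x' + 1 = p + q) (hn' : n' = p + q) (hq : 1 ≤ q)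
    {u : List ℕ} (hu : ∀ z ∈ u, 1 ≤ z ∧ z ≤ q) (hc : u.count q = 1) : ∀ v : List ℕ,
    (∀ y ∈ v, y ≤ p) → v.count p = 1 →
    ins x' n' (comp p q (word k v) (word k u)) = comp p q (ins p (p + 1) (word k v)) (word k u) +
      (-1 : k) ^ deg v • comp p (q + 1) (word k v) (ins q (q + 1) (word k u))
  | [], _, h => by simp at h
  | y :: v, hv, h => by
    have hv' : ∀ y ∈ v, y ≤ p := fun y hy => hv y (List.mem_cons_of_mem _ hy)
    by_cases hy : y = p
    · subst hy
      rw [List.count_cons_self] at h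
      have hyv : y ∉ v := List.count_eq_zero.1 (by omega)
      rw [ins_comp_cons_last hp hx' hn' hq (fun z hz => lt_of_le_of_ne (hv' z hz)
        fun e => hyv (e ▸ hz)) u hu hc.le, hc, comp_congr_arity (n := q + 1) (m := q) hv,
        ← cons_word, ins_cons_self, deg_cons, rep_of_notMem hyv, map_neg, zero_add]
      simp
    · have hyp : y < p := lt_of_le_of_ne (hv y List.mem_cons_self) hy
      rw [List.count_cons_of_ne hy] at h
      have ih := ins_comp_word_last hp hx' hn' hq hu hc v hv' h
      have hβ : Surj.beta p q y = y := if_pos hyp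
      have hβ' : Surj.beta p (q + 1) y = y := if_pos hyp
      have hβp : Surj.beta p q (p + 1) = n' := by
        unfold Surj.beta
        split_ifs <;> omega
      have hm : comp p q (word k v) (word k u) ∈ spanOf k fun w => y ∈ w ↔ y ∈ v :=
        spanOf_mono (fun w hw => by rwa [hβ] at hw) (mem_beta_comp hu hy)
      rw [← cons_word, comp_cons_of_ne hy, hβ, ins_cons (by omega) hm, ins_cons (c := y ∈ v) hy
        (word_mem Iff.rfl), map_add, map_smul, LinearMap.add_apply, LinearMap.smul_apply,
        comp_cons_of_ne hy, comp_cons_of_ne (by omega), comp_cons_of_ne hy, comp_cons_of_ne hy, ih,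
        hβp, hβ, comp_cons_of_ne hy, hβ', deg_cons, rep, pow_add, map_add, map_smul]
      module

end InsComp

end FreeWords

namespace FreeWords

variable {k : Type u} [CommRing k]

/-! The images of the generators of `A_∞`. -/

theorem isWordOf_ins {N : ℕ} {a b : ℤ} (hb : a + 1 = b) {X : FreeWords k}
    (hX : X ∈ spanOf k (IsWordOf N a)) :
    ins N (N + 1) X ∈ spanOf k fun w => IsWordOf (N + 1) b w ∧ w.count (N + 1) = 1 := by
  refine map_mem hX _ _ fun w hw => ?_
  have hN : N + 1 ∉ w := fun h => by have := hw.mem _ h; omega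
  refine spanOf_mono (fun v hv => ⟨⟨by omega, fun z => ?_, ?_⟩, hv.2.2⟩)
    (ins_word_mem hN (by omega : N + 1 ≠ N))
  · rw [hv.1, hw.2.1]
    have := hw.1
    omega
  · have := hw.2.2
    rw [hv.2.1]
    push_cast
    omega

theorem comp_one_word_pair {N : ℕ} {u : List ℕ} :
    comp 1 N (word k [1, 2] + word k [2, 1]) (word k u) =
      word k (u ++ [N + 1]) + word k ((N + 1) :: u) := by
  have hα : u.map (Surj.alpha 1) = u := by
    conv_rhs => rw [← List.map_id u]
    exact List.map_congr_left fun z _ => by simp [Surj.alpha]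
  have hβ : Surj.beta 1 N 2 = N + 1 := by
    rw [Surj.beta, if_neg (by omega)]
    omega
  rw [map_add, LinearMap.add_apply, comp_word_cons_last 1 N (by simp), ← cons_word 2,
    comp_cons_of_ne (by omega), comp_word_cons_last 1 N (by simp), hα]
  simp [hβ, deg_cons, rep]

/-- This is `diff_ins_word` with its boundary terms read as compositions: insertion is a homotopy
between composing with `(1,2) + (2,1)` on the outside and composing with it at the last input. -/
theorem diff_ins {N : ℕ} {a : ℤ} {X : FreeWords k}
    (hX : X ∈ spanOf k fun w => IsWordOf N a w ∧ w.count N = 1) :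
    diff (ins N (N + 1) X) + ins N (N + 1) (diff X) =
      comp 1 N (word k [1, 2] + word k [2, 1]) X -
        comp N 2 X (word k [1, 2] + word k [2, 1]) :=
  eq_of_mem hX (diff ∘ₗ ins N (N + 1) + ins N (N + 1) ∘ₗ diff)
    (comp 1 N (word k [1, 2] + word k [2, 1]) -
      (comp N 2).flip (word k [1, 2] + word k [2, 1])) fun w hw => by
    have hN : N + 1 ∉ w := fun h => by have := hw.1.mem _ h; omega
    have h1 := diff_ins_word (k := k) (by omega : N + 1 ≠ N) hN hw.2.le
    rw [bdryWord_eq hw.2 hw.1.mem] at h1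
    simp only [LinearMap.add_apply, LinearMap.sub_apply, LinearMap.comp_apply,
      LinearMap.flip_apply]
    rw [h1, comp_one_word_pair]
    abel

theorem ins_comp_left {p q i x n : ℕ} {a b : ℤ} (hi : 1 ≤ i) (hip : i < p) (hx : x + 1 = p + q)
    (hn : n = p + q) {X Y : FreeWords k} (hX : X ∈ spanOf k (IsWordOf p a))
    (hY : Y ∈ spanOf k (IsWordOf q b)) :
    ins x n (comp i q X Y) = comp i q (ins p (p + 1) X) Y := by
  have h := eq_of_mem hX (ins (k := k) x n ∘ₗ (comp i q).flip Y)
    ((comp (k := k) i q).flip Y ∘ₗ ins p (p + 1)) fun v hv => ?_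
  · simpa only [LinearMap.comp_apply, LinearMap.flip_apply] using h
  rw [LinearMap.comp_apply, LinearMap.comp_apply, LinearMap.flip_apply, LinearMap.flip_apply]
  refine eq_of_mem hY (ins x n ∘ₗ comp i q (word k v)) (comp i q (ins p (p + 1) (word k v)))
    fun u hu => ?_
  exact ins_comp_word_left hi hip hx hn v u hu.mem (fun y hy => (hv.mem y hy).2)
    (.inl ((hv.2.1 i).2 ⟨hi, hip.le⟩))

theorem ins_comp_last {p q x n d : ℕ} {b : ℤ} (hx : x + 1 = p + q) (hn : n = p + q)
    {X Y : FreeWords k} (hX : X ∈ spanOf k fun w => IsWordOf p d w ∧ w.count p = 1)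
    (hY : Y ∈ spanOf k fun w => IsWordOf q b w ∧ w.count q = 1) :
    ins x n (comp p q X Y) = comp p q (ins p (p + 1) X) Y +
      (-1 : k) ^ d • comp p (q + 1) X (ins q (q + 1) Y) :=
  eq_of_mem hX (ins x n ∘ₗ (comp p q).flip Y) ((comp p q).flip Y ∘ₗ ins p (p + 1) +
      (-1 : k) ^ d • (comp p (q + 1)).flip (ins q (q + 1) Y)) fun v hv =>
    eq_of_mem hY (ins x n ∘ₗ comp p q (word k v)) (comp p q (ins p (p + 1) (word k v)) +
      (-1 : k) ^ d • (comp p (q + 1) (word k v) ∘ₗ ins q (q + 1)))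
      fun u hu => by
        have hd : d = deg v := by have := hv.1.deg_eq; omega
        rw [hd]
        exact ins_comp_word_last hv.1.1 hx hn hu.1.1 hu.1.mem hu.2 v
          (fun y hy => (hv.1.mem y hy).2) hv.2

variable (k) in
/-- The image of the generator of arity `m + 2`. -/
noncomputable def mu : ℕ → FreeWords k
  | 0 => word k [1, 2] + word k [2, 1]
  | m + 1 => (-1 : k) ^ m • ins (m + 2) (m + 3) (mu m)

theorem ins_mu (m : ℕ) : ins (m + 2) (m + 3) (mu k m) = (-1 : k) ^ m • mu k (m + 1) := by
  rw [mu, smul_smul, ← mul_pow]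
  simp

theorem mu_mem : ∀ m : ℕ, mu k m ∈ spanOf k fun w => IsWordOf (m + 2) m w ∧ w.count (m + 2) = 1
  | 0 => by
    refine Submodule.add_mem _ (word_mem ⟨⟨by simp, fun x => ?_, by simp⟩, by simp⟩)
      (word_mem ⟨⟨by simp, fun x => ?_, by simp⟩, by simp⟩) <;>
    · simp only [List.mem_cons, List.not_mem_nil, or_false]
      omega
  | m + 1 => Submodule.smul_mem _ _
      (isWordOf_ins (by push_cast; ring) (spanOf_mono (fun _ h => h.1) (mu_mem m)))

theorem mu_isWordOf (m : ℕ) : mu k m ∈ spanOf k (IsWordOf (m + 2) m) :=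
  spanOf_mono (fun _ h => h.1) (mu_mem m)

theorem diff_mu_zero : diff (mu k 0) = 0 := by
  rw [mu, map_add, ← cons_word, ← cons_word, ← cons_word, ← cons_word]
  rw [diff_cons_of_notMem (by rw [cons_word]; exact word_mem (by simp)),
    diff_cons_of_notMem (word_mem (by simp)),
    diff_cons_of_notMem (by rw [cons_word]; exact word_mem (by simp)),
    diff_cons_of_notMem (word_mem (by simp))]
  simp

variable (k) in
/-- The terms `± μ_p ∘_{i+1} μ_q` with `p = a + 2`, `q = b + 2`. -/
noncomputable def muTerm (a b i : ℕ) : FreeWords k :=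
  (-1 : k) ^ (i + b * (a + 1 - i)) • comp (i + 1) (b + 2) (mu k a) (mu k b)

/-- The largest letter of the composite comes from the outer factor, so insertion raises only the
outer arity. The new factor `(-1) ^ b` of the sign exponent absorbs the normalising signs. -/
theorem ins_muTerm_left {m a b i : ℕ} (h : a + b = m) (hi : i ≤ a) :
    (-1 : k) ^ m • ins (m + 3) (m + 4) (muTerm k a b i) = muTerm k (a + 1) b i := by
  rw [muTerm, map_smul, ins_comp_left (by omega) (by omega) (by omega) (by omega) (mu_isWordOf a)
    (mu_isWordOf b), ins_mu, map_smul, LinearMap.smul_apply, muTerm, smul_smul, smul_smul,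
    ← pow_add, ← pow_add]
  congr 1
  rw [show a + 1 + 1 - i = a + 1 - i + 1 by omega, mul_add, mul_one, ← h]
  rw [show a + b + (i + b * (a + 1 - i)) + a = 2 * a + (i + (b * (a + 1 - i) + b)) by ring,
    pow_add, pow_mul]
  simp

/-- At the last input the largest letter of the composite is the largest letter of the inner factor,
and the inserted letter can be attached to either factor. -/
theorem ins_muTerm_last {m a b : ℕ} (h : a + b = m) :
    (-1 : k) ^ m • ins (m + 3) (m + 4) (muTerm k a b (a + 1)) =
      muTerm k (a + 1) b (a + 1) + muTerm k a (b + 1) (a + 1) := by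
  rw [muTerm, map_smul, ins_comp_last (by omega) (by omega) (mu_mem a) (mu_mem b), ins_mu, ins_mu,
    map_smul, map_smul, LinearMap.smul_apply, muTerm, muTerm, ← h]
  simp only [Nat.sub_self, mul_zero, add_zero, show a + 1 + 1 - (a + 1) = 1 by omega, mul_one,
    pow_add, pow_one]
  rcases neg_one_pow_eq_or k a with e | e <;> rcases neg_one_pow_eq_or k b with e' | e' <;>
    rw [e, e'] <;> module

/-- The homotopy formula `diff_ins` expresses `d h μ` through `h d μ`. By induction and the two
preceding lemmas, the latter gives every term of the next relation except the first with outer arity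
two and the last with inner arity two, which are the right-hand side of `diff_ins`. -/
theorem diff_mu_succ : ∀ m : ℕ, diff (mu k (m + 1)) =
    ∑ c ∈ Finset.HasAntidiagonal.antidiagonal m, ∑ i ∈ Finset.range (c.1 + 2), muTerm k c.1 c.2 i
  | 0 => by
    have h := diff_ins (mu_mem (k := k) 0)
    rw [diff_mu_zero, map_zero, add_zero] at h
    rw [mu, pow_zero, one_smul, h]
    simp [Finset.sum_range_succ, muTerm, mu, sub_eq_add_neg]
    abel
  | m + 1 => by
    have h := diff_ins (mu_mem (k := k) (m + 1))
    rw [diff_mu_succ m, map_sum] at h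
    have h1 : ∀ c ∈ Finset.HasAntidiagonal.antidiagonal m, (-1 : k) ^ m • ins (m + 1 + 2) (m + 1 + 2 + 1)
        (∑ i ∈ Finset.range (c.1 + 2), muTerm k c.1 c.2 i) =
        ∑ i ∈ Finset.range (c.1 + 1 + 1), muTerm k (c.1 + 1) c.2 i +
          muTerm k c.1 (c.2 + 1) (c.1 + 1) := by
      intro c hc
      have hc := Finset.HasAntidiagonal.mem_antidiagonal.1 hc
      rw [Finset.sum_range_succ, map_add, smul_add, ins_muTerm_last hc, map_sum, Finset.smul_sum,
        Finset.sum_congr rfl fun i hi => ins_muTerm_left hc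
          (Nat.lt_succ_iff.1 (Finset.mem_range.1 hi)), Finset.sum_range_succ _ (c.1 + 1), add_assoc]
    have h2 := Finset.sum_congr rfl h1
    rw [← Finset.smul_sum, Finset.sum_add_distrib] at h2
    have h3 : ∀ c : ℕ × ℕ, ∑ i ∈ Finset.range (c.1 + 2), muTerm k c.1 c.2 i =
        ∑ i ∈ Finset.range (c.1 + 1), muTerm k c.1 c.2 i + muTerm k c.1 c.2 (c.1 + 1) :=
      fun c => Finset.sum_range_succ _ _
    -- Terms away from the last input are split off at outer arity two, terms at the last input at
    -- inner arity two. The pieces split off are `e1` and `e2`; the remainder is `h2`.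
    rw [Finset.sum_congr rfl fun c _ => h3 c, Finset.sum_add_distrib,
      Finset.Nat.sum_antidiagonal_succ, Finset.Nat.sum_antidiagonal_succ', mu, map_smul]
    have e1 : muTerm k 0 (m + 1) 0 = (-1 : k) ^ (m + 1) •
        comp 1 (m + 1 + 2) (word k [1, 2] + word k [2, 1]) (mu k (m + 1)) := by
      simp [muTerm, mu]
    have e2 : muTerm k (m + 1) 0 (m + 1 + 1) = (-1 : k) ^ m •
        comp (m + 1 + 2) 2 (mu k (m + 1)) (word k [1, 2] + word k [2, 1]) := by
      simp [muTerm, mu, pow_succ]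
    simp only [zero_add, Finset.sum_range_one]
    rw [e1, e2]
    linear_combination (norm := (simp only [pow_succ]; module)) (-1 : k) ^ (m + 1) • h + h2

end FreeWords

/-! The sets `C'_n`. -/

theorem IsCactus.sublist {u v : List ℕ} (hv : IsCactus v) (h : u.Sublist v) : IsCactus u :=
  fun i j hij hs => hv i j hij (hs.trans h)

/-- A cactus without degeneracies on `m` letters has at most `2 m - 1` entries, and at most
`2 m - 2` if its first and last entries differ. -/
theorem IsCactus.length_le {r : ℕ} {w : List ℕ} (hc : IsCactus (r :: w))
    (hw : (r :: w).IsChain (· ≠ ·)) :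
    w.length + 2 ≤ 2 * (r :: w).toFinset.card ∧
      ((r :: w).getLast (List.cons_ne_nil r w) ≠ r →
        w.length + 3 ≤ 2 * (r :: w).toFinset.card) := by
  induction hN : w.length using Nat.strong_induction_on generalizing r w with
  | _ N ih =>
  subst hN
  by_cases hr : r ∈ w
  · obtain ⟨A, B, rfl, hA⟩ := List.eq_append_cons_of_mem hr
    match A, hA, hc, hw with
    | [], _, _, hw => exact absurd rfl (List.isChain_cons_cons.1 hw).1
    | a :: A, hA, hc, hw =>
      -- A letter `z` on both sides of the second `r` would give the subsequence `(r, z, r, z)`.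
      -- Hence the two parts use disjoint letters, and their bounds add up.
      have hdisj : Disjoint (a :: A).toFinset (r :: B).toFinset := by
        refine Finset.disjoint_left.2 fun z hz hz' => ?_
        rw [List.mem_toFinset] at hz hz'
        have hzr : z ≠ r := fun e => hA (e ▸ hz)
        refine hc r z hzr.symm (List.Sublist.cons_cons r ?_)
        exact (List.singleton_sublist.2 hz).append (List.Sublist.cons_cons r
          (List.singleton_sublist.2 ((List.mem_cons.1 hz').resolve_left hzr)))
      have hcard : (r :: (a :: A ++ r :: B)).toFinset.card =
          (a :: A).toFinset.card + (r :: B).toFinset.card := by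
        rw [← Finset.card_union_of_disjoint hdisj]
        congr 1
        ext z
        simp only [List.toFinset_cons, List.toFinset_append, Finset.mem_insert, Finset.mem_union,
          List.mem_toFinset]
        tauto
      have h1 := (ih A.length (by simp) (hc.sublist
        ((List.sublist_append_left (a :: A) (r :: B)).cons r)) (hw.tail.left_of_append) rfl).1
      have h2 := ih B.length (by simp; omega) (hc.sublist
        ((List.sublist_append_right (a :: A) (r :: B)).cons r)) (hw.tail.right_of_append) rfl
      rw [hcard]
      refine ⟨by simp only [List.length_append, List.length_cons]; omega, fun hl => ?_⟩
      rw [List.getLast_cons (by simp), List.getLast_append_of_ne_nil _ (by simp)] at hl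
      have h3 := h2.2 hl
      simp only [List.length_append, List.length_cons]
      omega
  · have hcard : (r :: w).toFinset.card = w.toFinset.card + 1 := by
      rw [List.toFinset_cons, Finset.card_insert_of_notMem (by simpa using hr)]
    rcases w with _ | ⟨s, w⟩
    · simp
    · have h1 := (ih w.length (by simp) (hc.sublist (List.sublist_cons_self r _)) hw.tail rfl).1
      rw [hcard]
      simp only [List.length_cons]
      exact ⟨by omega, fun _ => by omega⟩

/-- A sequence without equal neighbours can use at most one of two adjacent copies of `y`. -/
theorem List.Sublist.of_append_cons_cons {s P Q : List ℕ} {y : ℕ} (hs : s.IsChain (· ≠ ·))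
    (h : s.Sublist (P ++ y :: y :: Q)) : s.Sublist (P ++ y :: Q) := by
  obtain ⟨s1, s2, rfl, h1, h2⟩ := List.sublist_append_iff.1 h
  refine h1.append ?_
  cases h2 with
  | cons _ h => exact h
  | cons_cons _ h =>
    cases h with
    | cons _ h => exact h.cons_cons _
    | cons_cons _ h => exact absurd rfl (List.isChain_cons_cons.1 hs.right_of_append).1

theorem mem_of_sublist_append_cons {a b : ℕ} {L R : List ℕ} (hL : b ∉ L) (hR : b ∉ R)
    (h : [a, b, a].Sublist (L ++ b :: R)) : a ∈ L ∧ a ∈ R := by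
  have hb {s : List ℕ} (hs : (b :: s).Sublist (b :: R)) : s.Sublist R := by
    cases hs with
    | cons _ h => exact absurd (h.subset List.mem_cons_self) hR
    | cons_cons _ h => exact h
  induction L with
  | nil =>
    cases h with
    | cons _ h => exact absurd (h.subset (by simp)) hR
    | cons_cons _ h => exact absurd (h.subset (by simp)) hR
  | cons z L ih =>
    rw [List.mem_cons, not_or] at hL
    cases h with
    | cons _ h => exact ⟨List.mem_cons_of_mem _ (ih hL.2 h).1, (ih hL.2 h).2⟩
    | cons_cons _ h =>
      refine ⟨List.mem_cons_self, ?_⟩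
      obtain ⟨s1, s2, e, h1, h2⟩ := List.sublist_append_iff.1 h
      rcases s1 with _ | ⟨c, s1⟩
      · rw [List.nil_append] at e
        exact List.singleton_sublist.1 (hb (e ▸ h2))
      · obtain ⟨rfl, -⟩ := List.cons_eq_cons.1 e
        exact absurd (h1.subset List.mem_cons_self) hL.2

namespace Cactus

/-- The words in `C'_n`. -/
structure IsAdmissibleWord (n : ℕ) (u : List ℕ) : Prop where
  mem : ∀ x, x ∈ u ↔ 1 ≤ x ∧ x ≤ n
  chain : u.IsChain (· ≠ ·)
  length : u.length + 2 = 2 * n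
  cactus : IsCactus u
  avoid : ∀ i j, (j = i + 1 ∨ j < i) → ¬ [i, j, i].Sublist u

theorem isAdmissible_iff {n : ℕ} (u : Surj.Seq n ((n : ℤ) - 2)) :
    IsAdmissible n u ↔ IsAdmissibleWord n u.1 := by
  refine ⟨fun h => ⟨u.2.1.2.1, u.2.1.2.2, ?_, h.1, h.2⟩, fun h => ⟨h.cactus, h.avoid⟩⟩
  have := u.2.2
  omega

/-- The words in `C'_n` as a finite set. -/
noncomputable def admissibleWords (n : ℕ) : Finset (List ℕ) :=
  (admissible n).map (Function.Embedding.subtype _)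

theorem mem_admissibleWords {n : ℕ} (hn : 1 ≤ n) {u : List ℕ} :
    u ∈ admissibleWords n ↔ IsAdmissibleWord n u := by
  simp only [admissibleWords, admissible, Finset.mem_map, Set.Finite.mem_toFinset,
    Set.mem_ofPred_eq, Function.Embedding.coe_subtype, isAdmissible_iff]
  constructor
  · rintro ⟨u, h, rfl⟩
    exact h
  · intro h
    refine ⟨⟨u, ⟨hn, h.mem, h.chain⟩, ?_⟩, h, rfl⟩
    have := h.length
    omega

variable {n : ℕ}

/-- Between two occurrences of `n` there would be a smaller letter `z`, and `(n, z, n)` is excluded.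
-/
theorem IsAdmissibleWord.exists_split {u : List ℕ} (hn : 1 ≤ n) (h : IsAdmissibleWord n u) :
    ∃ P R, u = P ++ n :: R ∧ n ∉ P ∧ n ∉ R := by
  obtain ⟨P, R, rfl, hP⟩ := List.eq_append_cons_of_mem ((h.mem n).2 ⟨hn, le_rfl⟩)
  refine ⟨P, R, rfl, hP, fun hR => ?_⟩
  rcases R with _ | ⟨z, R⟩
  · simp at hR
  have hz : n ≠ z := (List.isChain_cons_cons.1 h.chain.right_of_append).1
  have hz' := ((h.mem z).1 (by simp)).2
  refine h.avoid n z (.inr (by omega)) (List.Sublist.trans ?_ (List.sublist_append_right P _))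
  exact ((List.singleton_sublist.2 ((List.mem_cons.1 hR).resolve_left hz)).cons_cons z).cons_cons n

theorem IsAdmissibleWord.count {u : List ℕ} (hn : 1 ≤ n) (h : IsAdmissibleWord n u) :
    u.count n = 1 := by
  obtain ⟨P, R, rfl, hP, hR⟩ := h.exists_split hn
  simp [List.count_eq_zero_of_not_mem hP, List.count_eq_zero_of_not_mem hR]

/-- The letter `n + 1` occurs once. A forbidden pattern that avoids it already occurs in the old
word, by merging the two copies of `y`. A pattern that uses it must be `(n, n + 1, n)`, and since `y
≠ n` these two entries enclose `y` in the old word. -/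
theorem IsAdmissibleWord.insert {P Q : List ℕ} {y : ℕ} (h : IsAdmissibleWord n (P ++ y :: Q))
    (hy : y ≠ n) : IsAdmissibleWord (n + 1) (P ++ y :: (n + 1) :: y :: Q) := by
  have hyn := (h.mem y).1 (by simp)
  have hn1 : n + 1 ∉ P ++ y :: Q := fun hm => by have := (h.mem _).1 hm; omega
  have hP : n + 1 ∉ P := fun h => hn1 (List.mem_append_left _ h)
  have hQ : n + 1 ∉ Q := fun h => hn1 (List.mem_append_right _ (List.mem_cons_of_mem _ h))
  have hone (s : List ℕ) (hs : s.Sublist (P ++ y :: (n + 1) :: y :: Q)) : s.count (n + 1) ≤ 1 := by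
    refine (hs.count_le (n + 1)).trans ?_
    rw [List.count_append, List.count_eq_zero_of_not_mem hP, List.count_cons_of_ne (by omega),
      List.count_cons_self, List.count_cons_of_ne (by omega), List.count_eq_zero_of_not_mem hQ]
  have hsub (s : List ℕ) (hs : s.IsChain (· ≠ ·)) (hns : n + 1 ∉ s)
      (hs' : s.Sublist (P ++ y :: (n + 1) :: y :: Q)) : s.Sublist (P ++ y :: Q) := by
    refine List.Sublist.of_append_cons_cons hs ?_
    obtain ⟨s1, s2, rfl, h1, h2⟩ := List.sublist_append_iff.1 hs'
    refine h1.append ?_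
    have hns2 : n + 1 ∉ s2 := fun h => hns (List.mem_append_right _ h)
    cases h2 with
    | cons _ h2 =>
      cases h2 with
      | cons _ h2 => exact h2.cons _
      | cons_cons _ h2 => exact absurd List.mem_cons_self hns2
    | cons_cons _ h2 =>
      cases h2 with
      | cons _ h2 => exact h2.cons_cons _
      | cons_cons _ h2 => exact absurd (List.mem_cons_of_mem _ List.mem_cons_self) hns2
  refine ⟨fun x => ?_, ?_, ?_, fun i j hij hs => ?_, fun i j hij hs => ?_⟩
  · have := h.mem x
    simp only [List.mem_append, List.mem_cons] at this ⊢
    rw [show (x ∈ P ∨ x = y ∨ x = n + 1 ∨ x = y ∨ x ∈ Q) ↔ (x ∈ P ∨ x = y ∨ x ∈ Q) ∨ x = n + 1 by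
      tauto, this]
    omega
  · have h1 := List.isChain_split.1 h.chain
    rw [List.isChain_append_cons_cons, List.isChain_cons_cons]
    exact ⟨h1.1, by omega, by omega, h1.2⟩
  · have := h.length
    simp only [List.length_append, List.length_cons] at this ⊢
    omega
  · have h1 := hone _ hs
    by_cases hi : i = n + 1
    · subst hi
      simp [hij.symm] at h1
    by_cases hj : j = n + 1
    · subst hj
      simp [hij] at h1
    · exact h.cactus i j hij (hsub _ (by simp [hij, hij.symm]) (by simp; omega) hs)
  · have h1 := hone _ hs
    have hij' : i ≠ j := by omega
    by_cases hi : i = n + 1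
    · subst hi
      simp [List.count_cons] at h1
    by_cases hj : j = n + 1
    · subst hj
      have h2 : [i, n + 1, i].Sublist ((P ++ [y]) ++ (n + 1) :: (y :: Q)) := by simpa using hs
      have h3 := mem_of_sublist_append_cons
        (by rw [List.mem_append, List.mem_singleton, not_or]; exact ⟨hP, by omega⟩)
        (by rw [List.mem_cons, not_or]; exact ⟨by omega, hQ⟩) h2
      have hin : i ≤ n := by
        have h4 := (h.mem i).1
        simp only [List.mem_append, List.mem_cons, List.not_mem_nil] at h3 h4
        exact (h4 (by tauto)).2
      -- The pattern `(i, n + 1, i)` with `i ≤ n` is forbidden only for `i = n`.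
      obtain rfl : i = n := by omega
      have h4 : i ∈ P := by simpa [hy.symm] using h3.1
      have h5 : i ∈ Q := by simpa [hy.symm] using h3.2
      refine h.avoid i y (by omega) ?_
      exact (List.singleton_sublist.2 h4).append ((List.singleton_sublist.2 h5).cons_cons y)
    · exact h.avoid i j hij (hsub _ (by simp [hij', hij'.symm]) (by simp; omega) hs)

/-- A word with the letters of a word in `C'_n` but one more entry is degenerate. -/
theorem not_isChain_of_length {w : List ℕ} (hn : 2 ≤ n) (hw : ∀ x, x ∈ w ↔ 1 ≤ x ∧ x ≤ n)
    (hl : w.length + 1 = 2 * n) (hc : IsCactus w)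
    (ha : ∀ i j, (j = i + 1 ∨ j < i) → ¬ [i, j, i].Sublist w) : ¬ w.IsChain (· ≠ ·) := by
  intro hch
  match w, hw, hl, hc, ha, hch with
  | [], _, hl, _, _, _ => simp at hl; omega
  | r :: w, hw, hl, hc, ha, hch =>
    have hcard : (r :: w).toFinset.card = n := by
      have : (r :: w).toFinset = Finset.Icc 1 n := by
        ext x
        rw [List.mem_toFinset, hw, Finset.mem_Icc]
      rw [this]
      simp
    rw [List.length_cons] at hl
    -- Otherwise the sharper bound of `IsCactus.length_le` contradicts the length.
    have hlast : (r :: w).getLast (List.cons_ne_nil r w) = r := by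
      by_contra hne
      have := (hc.length_le hch).2 hne
      omega
    have hw0 : w ≠ [] := by
      rintro rfl
      simp at hl
      omega
    -- As the word begins and ends with `r`, every other letter is enclosed by two entries `r`. The
    -- letter `2` for `r = 1`, and the letter `1` otherwise, then gives a forbidden pattern.
    have hsub {j : ℕ} (hj : 1 ≤ j ∧ j ≤ n) (hjr : j ≠ r) : [r, j, r].Sublist (r :: w) := by
      rw [List.getLast_cons hw0] at hlast
      have e := List.dropLast_append_getLast hw0
      rw [hlast] at e
      have hjw := (List.mem_cons.1 ((hw j).2 hj)).resolve_left hjr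
      rw [← e, List.mem_append, List.mem_singleton] at hjw
      rw [← e]
      exact ((List.singleton_sublist.2 (hjw.resolve_right hjr)).append
        (List.Sublist.refl [r])).cons_cons r
    have hr := (hw r).1 List.mem_cons_self
    by_cases hr1 : r = 1
    · exact ha r 2 (.inl (by omega)) (hsub (by omega) (by omega))
    · exact ha r 1 (.inr (by omega)) (hsub (by omega) (by omega))

/-- Without `n + 1` the word still avoids all forbidden patterns but is one entry too long to be
non-degenerate. The only new adjacency is that of the neighbours of `n + 1`, so these are equal;
merging them gives the smaller word. They differ from `n` because `(n, n + 1, n)` is excluded. -/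
theorem IsAdmissibleWord.exists_insert {u : List ℕ} (hn : 2 ≤ n)
    (h : IsAdmissibleWord (n + 1) u) : ∃ P Q y, u = P ++ y :: (n + 1) :: y :: Q ∧
      y ≠ n ∧ IsAdmissibleWord n (P ++ y :: Q) := by
  obtain ⟨P, R, rfl, hP, hR⟩ := h.exists_split (by omega)
  have hsub : (P ++ R).Sublist (P ++ (n + 1) :: R) :=
    (List.Sublist.refl P).append (List.sublist_cons_self _ R)
  have hmem : ∀ x, x ∈ P ++ R ↔ 1 ≤ x ∧ x ≤ n := by
    intro x
    have h1 := h.mem x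
    have h2 : x ∈ P ++ R → x ≠ n + 1 := by
      rintro hx rfl
      exact (List.mem_append.1 hx).elim hP hR
    simp only [List.mem_append, List.mem_cons] at h1 h2 ⊢
    constructor
    · intro hx
      have := h2 hx
      have := h1.1 (by tauto)
      omega
    · intro hx
      have := h1.2 (by omega)
      have : x ≠ n + 1 := by omega
      tauto
  have hlen := h.length
  have hnot : ¬ (P ++ R).IsChain (· ≠ ·) := by
    refine not_isChain_of_length hn hmem ?_ (h.cactus.sublist hsub)
      fun i j hij hs => h.avoid i j hij (hs.trans hsub)
    simp only [List.length_append, List.length_cons] at hlen ⊢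
    omega
  rcases R with _ | ⟨z, Q⟩
  · rw [List.append_nil] at hnot
    exact absurd h.chain.left_of_append hnot
  rcases List.eq_nil_or_concat P with rfl | ⟨P, y, rfl⟩
  · exact absurd h.chain.tail hnot
  rw [List.concat_eq_append] at *
  simp only [List.append_assoc, List.singleton_append] at *
  have hch := h.chain
  rw [List.isChain_append_cons_cons, List.isChain_cons_cons] at hch
  obtain rfl : y = z := by
    by_contra hyz
    exact hnot (List.isChain_append_cons_cons.2 ⟨hch.1, hyz, hch.2.2.2⟩)
  have hsub' : (P ++ y :: Q).Sublist (P ++ y :: (n + 1) :: y :: Q) :=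
    (List.Sublist.refl P).append
      ((List.sublist_cons_of_sublist _ (List.sublist_cons_self y Q)).cons_cons y)
  refine ⟨P, Q, y, rfl, ?_, fun x => ?_, ?_, ?_, h.cactus.sublist hsub',
    fun i j hij hs => h.avoid i j hij (hs.trans hsub')⟩
  · rintro rfl
    refine h.avoid y (y + 1) (.inl rfl) (List.Sublist.trans ?_ (List.sublist_append_right P _))
    exact ((List.nil_sublist Q).cons_cons y).cons_cons _ |>.cons_cons y
  · rw [← hmem]
    simp
  · exact List.isChain_split.2 ⟨hch.1, hch.2.2.2⟩
  · simp only [List.length_append, List.length_cons] at hlen ⊢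
    omega

theorem IsAdmissibleWord.two_iff {u : List ℕ} :
    IsAdmissibleWord 2 u ↔ u = [1, 2] ∨ u = [2, 1] := by
  constructor
  · intro h
    obtain ⟨a, b, rfl⟩ := List.length_eq_two.1 (by have := h.length; omega : u.length = 2)
    have ha := (h.mem a).1 (by simp)
    have hb := (h.mem b).1 (by simp)
    have hab := (List.isChain_cons_cons.1 h.chain).1
    simp only [List.cons.injEq, and_true]
    omega
  · intro h
    have hl : u.length = 2 := by rcases h with rfl | rfl <;> rfl
    refine ⟨fun x => ?_, ?_, by omega, fun i j _ hs => ?_, fun i j _ hs => ?_⟩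
    · rcases h with rfl | rfl <;>
      · simp only [List.mem_cons, List.not_mem_nil, or_false]
        omega
    · rcases h with rfl | rfl <;> simp
    · have := hs.length_le
      simp [hl] at this
    · have := hs.length_le
      simp [hl] at this

end Cactus

namespace FreeWords

open Cactus

variable {k : Type u} [CommRing k]

/-- The word obtained by replacing the entry `y` at position `j` by `y, n, y`. -/
def insertAt (n j : ℕ) (v : List ℕ) : List ℕ := v.take (j + 1) ++ n :: v.drop j

theorem insertAt_length (n : ℕ) (P : List ℕ) (y : ℕ) (Q : List ℕ) :
    insertAt n P.length (P ++ y :: Q) = P ++ y :: n :: y :: Q := by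
  simp [insertAt, List.take_append]

/-- Letters passed before position `j` contribute their degrees, which add up to `relDeg v j`, and
passing `x` contributes one more sign. As `x` occurs at most once, the latter is decided by
comparing `j` with its position. -/
theorem ins_word {x n : ℕ} : ∀ {v : List ℕ}, v.count x ≤ 1 → ins x n (word k v) =
    ∑ j ∈ Finset.range v.length, if v.getD j 0 = x then 0 else
      (-1 : k) ^ (Surj.relDeg v j + if v.idxOf x < j then 1 else 0) • word k (insertAt n j v)
  | [], _ => by simp
  | y :: v, h => by
    rw [List.length_cons, Finset.sum_range_succ', ← cons_word]
    by_cases hy : y = x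
    · subst hy
      rw [List.count_cons_self] at h
      have hyv : y ∉ v := List.count_eq_zero.1 (by omega)
      rw [ins_cons_self, ins_word (by omega), map_sum, ← Finset.sum_neg_distrib]
      simp only [List.getD_cons_zero, if_pos, add_zero, List.getD_cons_succ]
      refine Finset.sum_congr rfl fun j hj => ?_
      have hj' := List.idxOf_eq_length hyv
      have hj := Finset.mem_range.1 hj
      rw [relDeg_cons_succ, rep_of_notMem hyv, if_neg (show ¬ v.idxOf y < j by omega),
        List.idxOf_cons_self, if_pos (Nat.succ_pos j)]
      split_ifs
      · simp
      · simp [insertAt, pow_succ]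
    · rw [List.count_cons_of_ne hy] at h
      rw [ins_cons (c := y ∈ v) hy (word_mem Iff.rfl), ins_word h, map_sum, Finset.smul_sum,
        add_comm]
      simp only [List.getD_cons_zero, if_neg hy, List.getD_cons_succ]
      congr 1
      · refine Finset.sum_congr rfl fun j _ => ?_
        rw [relDeg_cons_succ, List.idxOf_cons_ne _ hy]
        by_cases hj : v.getD j 0 = x
        · rw [if_pos hj, if_pos hj, map_zero, smul_zero]
        · rw [if_neg hj, if_neg hj, map_smul, smul_smul, ← pow_add, ← add_assoc]
          simp only [insertAt, rep, Nat.succ_eq_add_one, add_lt_add_iff_right, cons_word,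
            List.take_succ_cons, List.drop_succ_cons, List.cons_append]
      · simp [insertAt, relDeg_zero]

theorem idxOf_insertAt {n y : ℕ} {P : List ℕ} (hP : n ∉ P) (hy : y ≠ n) (Q : List ℕ) :
    (P ++ y :: n :: y :: Q).idxOf n = P.length + 1 := by
  rw [List.idxOf_append_of_notMem hP, List.idxOf_cons_ne _ hy, List.idxOf_cons_self]

theorem remove_insertAt (n y : ℕ) (P Q : List ℕ) :
    (P ++ y :: n :: y :: Q).take (P.length + 1) ++ (P ++ y :: n :: y :: Q).drop (P.length + 3) =
      P ++ y :: Q := by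
  simp [List.take_append, List.drop_append, List.take_of_length_le, List.drop_of_length_le]

/-- Expanding the insertion gives a sum over a word of the smaller set and a position not carrying
its largest letter. By `IsAdmissibleWord.insert` and `IsAdmissibleWord.exists_insert` such pairs
correspond to the words of the next set, and the exponents are those in the recursion of `signExp`.
-/
theorem mu_eq_sum : ∀ m : ℕ, mu k m =
    ∑ u ∈ admissibleWords (m + 2), (-1 : k) ^ signExp (m + 2) u • word k u
  | 0 => by
    have : admissibleWords (0 + 2) = {[1, 2], [2, 1]} := by
      ext u
      rw [mem_admissibleWords (by omega), IsAdmissibleWord.two_iff]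
      simp
    rw [this, Finset.sum_pair (by decide)]
    simp [mu, signExp]
  | m + 1 => by
    have hcount {v : List ℕ} (hv : v ∈ admissibleWords (m + 2)) : v.count (m + 2) ≤ 1 :=
      (((mem_admissibleWords (by omega)).1 hv).count (by omega)).le
    rw [mu, mu_eq_sum m, map_sum, Finset.smul_sum]
    have h1 : ∀ v ∈ admissibleWords (m + 2), (-1 : k) ^ m •
        ins (m + 2) (m + 3) ((-1 : k) ^ signExp (m + 2) v • word k v) =
        ∑ j ∈ (Finset.range (2 * m + 2)).filter fun j => v.getD j 0 ≠ m + 2,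
          (-1 : k) ^ (signExp (m + 2) v + m + Surj.relDeg v j +
            if v.idxOf (m + 2) < j then 1 else 0) • word k (insertAt (m + 3) j v) := by
      intro v hv
      have hl := ((mem_admissibleWords (by omega)).1 hv).length
      rw [map_smul, ins_word (hcount hv), show v.length = 2 * m + 2 by omega, Finset.sum_filter,
        Finset.smul_sum, Finset.smul_sum]
      refine Finset.sum_congr rfl fun j _ => ?_
      by_cases h : v.getD j 0 = m + 2
      · rw [if_pos h, if_neg (not_not.2 h), smul_zero, smul_zero]
      · rw [if_neg h, if_pos h, smul_smul, smul_smul, ← pow_add, ← pow_add]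
        congr 2
        omega
    rw [Finset.sum_congr rfl h1, Finset.sum_sigma']
    have hsplit (c : Σ _ : List ℕ, ℕ) (hc : c ∈ (admissibleWords (m + 2)).sigma fun v =>
        (Finset.range (2 * m + 2)).filter fun j => v.getD j 0 ≠ m + 2) :
        ∃ P Q y, c = ⟨P ++ y :: Q, P.length⟩ ∧ y ≠ m + 2 ∧ y ≠ m + 3 ∧ m + 3 ∉ P ∧
          IsAdmissibleWord (m + 2) (P ++ y :: Q) := by
      obtain ⟨v, j⟩ := c
      simp only [Finset.mem_sigma, Finset.mem_filter, Finset.mem_range,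
        mem_admissibleWords (show 1 ≤ m + 2 by omega)] at hc
      obtain ⟨hv, hj, hy⟩ := hc
      have hj' : j < v.length := by have := hv.length; omega
      rw [List.getD_eq_getElem _ _ hj'] at hy
      have hle (z : ℕ) (hz : z ∈ v) : z ≠ m + 3 := by have := (hv.mem z).1 hz; omega
      have e : v.take j ++ v[j] :: v.drop (j + 1) = v := by
        rw [← List.drop_eq_getElem_cons hj', List.take_append_drop]
      refine ⟨v.take j, v.drop (j + 1), v[j], ?_, hy, hle _ (List.getElem_mem hj'),
        fun h => hle _ (List.mem_of_mem_take h) rfl, by rwa [e]⟩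
      rw [e, List.length_take, min_eq_left hj'.le]
    have hremove {P : List ℕ} {y : ℕ} (hP : m + 3 ∉ P) (hy : y ≠ m + 3) (Q : List ℕ) :
        (⟨(P ++ y :: (m + 3) :: y :: Q).take ((P ++ y :: (m + 3) :: y :: Q).idxOf (m + 3) - 1 + 1) ++
          (P ++ y :: (m + 3) :: y :: Q).drop ((P ++ y :: (m + 3) :: y :: Q).idxOf (m + 3) - 1 + 3),
          (P ++ y :: (m + 3) :: y :: Q).idxOf (m + 3) - 1⟩ : Σ _ : List ℕ, ℕ) =
          ⟨P ++ y :: Q, P.length⟩ := by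
      rw [idxOf_insertAt hP hy, Nat.add_sub_cancel, remove_insertAt]
    have hinsert (u : List ℕ) (hu : u ∈ admissibleWords (m + 3)) : ∃ P Q y,
        u = P ++ y :: (m + 3) :: y :: Q ∧ y ≠ m + 2 ∧ y ≠ m + 3 ∧ m + 3 ∉ P ∧
          IsAdmissibleWord (m + 2) (P ++ y :: Q) := by
      obtain ⟨P, Q, y, rfl, hy, h⟩ := ((mem_admissibleWords (by omega)).1 hu).exists_insert
        (by omega)
      have hle (z : ℕ) (hz : z ∈ P ++ y :: Q) : z ≠ m + 3 := by have := (h.mem z).1 hz; omega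
      exact ⟨P, Q, y, rfl, hy, hle y (by simp), fun h => hle _ (List.mem_append_left _ h) rfl, h⟩
    -- The inverse reads the pair off the word: the new letter stands directly after position `j`,
    -- so `j` is its index minus one, and removing it together with the following entry restores the
    -- old word.
    refine Finset.sum_bij' (fun c _ => insertAt (m + 3) c.2 c.1)
      (fun u _ => ⟨u.take (u.idxOf (m + 3) - 1 + 1) ++ u.drop (u.idxOf (m + 3) - 1 + 3),
        u.idxOf (m + 3) - 1⟩) ?_ ?_ ?_ ?_ ?_
    · intro c hc
      obtain ⟨P, Q, y, rfl, hy, hy', hP, h⟩ := hsplit c hc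
      rw [insertAt_length]
      exact (mem_admissibleWords (by omega)).2 (h.insert hy)
    · intro u hu
      obtain ⟨P, Q, y, rfl, hy, hy', hP, h⟩ := hinsert u hu
      rw [hremove hP hy']
      have hl := h.length
      simp only [List.length_append, List.length_cons] at hl
      simp only [Finset.mem_sigma, Finset.mem_filter, Finset.mem_range,
        mem_admissibleWords (show 1 ≤ m + 2 by omega)]
      exact ⟨h, by omega, by simpa using hy⟩
    · intro c hc
      obtain ⟨P, Q, y, rfl, hy, hy', hP, h⟩ := hsplit c hc
      simp only [insertAt_length]
      exact hremove hP hy' Q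
    · intro u hu
      obtain ⟨P, Q, y, rfl, hy, hy', hP, h⟩ := hinsert u hu
      rw [hremove hP hy', insertAt_length]
    · intro c hc
      obtain ⟨P, Q, y, rfl, hy, hy', hP, h⟩ := hsplit c hc
      rw [insertAt_length]
      dsimp only
      rw [show m + 1 + 2 = m + 3 from rfl, signExp]
      simp only [idxOf_insertAt hP hy', Nat.add_sub_cancel, remove_insertAt]

end FreeWords

/-! ### The differential of `A_∞` squares to zero. -/

namespace AInf

variable {k : Type u} [CommRing k]

open Finset (range)

theorem d_mon {n : ℕ} {a b : ℤ} (h : b + 1 = a) (x : AExpr n a) :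
    d k h (mon k x) = dExpr k x b h :=
  lift_mon _ _ x

theorem leibniz {m n p : ℕ} {a a' b b' c c' : ℤ} (i : ℕ) (hi : 1 ≤ i) (him : i ≤ m)
    (hp : m + n = p + 1) (hc : a + b = c) (ha' : a' + 1 = a) (hb' : b' + 1 = b)
    (hc' : c' + 1 = c) (x : Obj k m a) (y : Obj k n b) :
    d k hc' (circ k i hi him hp hc x y) = circ k i hi him hp (by omega) (d k ha' x) y +
      a.negOnePow • circ k i hi him hp (by omega) x (d k hb' y) := by
  obtain rfl : a' = a - 1 := by omega
  obtain rfl : b' = b - 1 := by omega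
  refine induction_mon x (by simp) (fun x x' hx hx' => ?_) (fun r x hx => ?_) (fun x => ?_)
  · simp only [map_add, LinearMap.add_apply, hx, hx', smul_add]
    abel
  · simp only [map_smul, LinearMap.smul_apply, hx, smul_comm _ r, smul_add]
  refine induction_mon y (by simp) (fun x x' hx hx' => ?_) (fun r x hx => ?_) (fun y => ?_)
  · simp only [map_add, hx, hx', smul_add]
    abel
  · simp only [map_smul, hx, smul_comm _ r, smul_add]
  rw [circ_mon, d_mon, d_mon, d_mon, dExpr]

/-- Partial composition, extended by zero. -/
noncomputable def circOrZero {m n : ℕ} {a b : ℤ} (N : ℕ) (e : ℤ) (i : ℕ) :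
    Obj k m a →ₗ[k] Obj k n b →ₗ[k] Obj k N e :=
  if h : 1 ≤ i ∧ i ≤ m ∧ m + n = N + 1 ∧ a + b = e then
    circ k i h.1 h.2.1 h.2.2.1 h.2.2.2 else 0

theorem circOrZero_eq {m n N i : ℕ} {a b e : ℤ} (hi : 1 ≤ i) (him : i ≤ m) (hN : m + n = N + 1)
    (he : a + b = e) (x : Obj k m a) (y : Obj k n b) :
    circOrZero N e i x y = circ k i hi him hN he x y := by
  rw [circOrZero, dif_pos ⟨hi, him, hN, he⟩]

theorem d_circOrZero {m n N : ℕ} {a a' b b' e e' : ℤ} (i : ℕ) (ha : a' + 1 = a) (hb : b' + 1 = b)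
    (he : e' + 1 = e) (x : Obj k m a) (y : Obj k n b) :
    d k he (circOrZero N e i x y) = circOrZero N e' i (d k ha x) y +
      a.negOnePow • circOrZero N e' i x (d k hb y) := by
  by_cases h : 1 ≤ i ∧ i ≤ m ∧ m + n = N + 1 ∧ a + b = e
  · obtain ⟨h1, h2, h3, h4⟩ := h
    rw [circOrZero_eq h1 h2 h3 h4, circOrZero_eq h1 h2 h3 (by omega),
      circOrZero_eq h1 h2 h3 (by omega)]
    exact leibniz i h1 h2 h3 h4 ha hb he x y
  · rw [circOrZero, dif_neg h, circOrZero, dif_neg (by omega), circOrZero, dif_neg (by omega)]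
    simp

variable (k) in
/-- The generator `m_p`, or zero if `p < 2`. -/
noncomputable def genOrZero (p : ℕ) : Obj k p ((p : ℤ) - 2) :=
  if h : 2 ≤ p then mon k (.gen p (p - 2) h (by omega)) else 0

theorem genOrZero_of_lt {p : ℕ} (hp : ¬ 2 ≤ p) : genOrZero k p = 0 := dif_neg hp

/-- The sign exponent of `m_p ∘_i m_q` in the differential. -/
def genSign (x : ℕ × ℕ × ℕ) : ℕ := (x.2.2 - 1) + x.2.1 * (x.1 - x.2.2)

variable (k) in
/-- The composition `m_p ∘_i m_q` of generators, or zero if not defined. -/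
noncomputable def genCirc (N : ℕ) (e : ℤ) (x : ℕ × ℕ × ℕ) : Obj k N e :=
  circOrZero N e x.2.2 (genOrZero k x.1) (genOrZero k x.2.1)

/-- The conditions for `m_p ∘_i m_q` to be defined, of arity `N`. -/
def IsGenCirc (N : ℕ) (x : ℕ × ℕ × ℕ) : Prop :=
  2 ≤ x.1 ∧ 2 ≤ x.2.1 ∧ x.1 + x.2.1 = N + 1 ∧ 1 ≤ x.2.2 ∧ x.2.2 ≤ x.1

theorem genCirc_eq_zero {N : ℕ} {e : ℤ} {x : ℕ × ℕ × ℕ} (h : ¬ IsGenCirc N x) :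
    genCirc k N e x = 0 := by
  unfold IsGenCirc at h
  rw [genCirc]
  by_cases h1 : 2 ≤ x.1
  · by_cases h2 : 2 ≤ x.2.1
    · rw [circOrZero, dif_neg (by omega)]
      simp
    · rw [genOrZero_of_lt h2, map_zero]
  · rw [genOrZero_of_lt h1, map_zero, LinearMap.zero_apply]

/-- The triples with entries at most `M`. -/
def triples (M : ℕ) : Finset (ℕ × ℕ × ℕ) := range (M + 1) ×ˢ range (M + 1) ×ˢ range (M + 1)

theorem mem_triples {M : ℕ} {x : ℕ × ℕ × ℕ} :
    x ∈ triples M ↔ x.1 ≤ M ∧ x.2.1 ≤ M ∧ x.2.2 ≤ M := by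
  simp [triples]

/-- Undefined compositions are zero, so the index set may be enlarged. Hence all differentials
occurring in `d (d m_N)` can be summed over the same set of triples. -/
theorem dGen_eq {n M : ℕ} {b : ℤ} (hb : b + 3 = n) (hM : n ≤ M) :
    dGen k n b hb = ∑ x ∈ triples M, (-1 : k) ^ genSign x • genCirc k n b x := by
  have h1 : ∑ x ∈ triples n, (-1 : k) ^ genSign x • genCirc k n b x =
      ∑ x ∈ triples M, (-1 : k) ^ genSign x • genCirc k n b x := by
    refine Finset.sum_subset (fun x hx => ?_) fun x _ hx => ?_
    · rw [mem_triples] at hx ⊢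
      omega
    · rw [genCirc_eq_zero, smul_zero]
      unfold IsGenCirc
      rw [mem_triples] at hx
      omega
  rw [← h1, triples, Finset.sum_product]
  simp only [Finset.sum_product]
  refine Finset.sum_congr rfl fun p _ => Finset.sum_congr rfl fun q _ =>
    Finset.sum_congr rfl fun i _ => ?_
  split_ifs with h
  · rw [genCirc, genOrZero, dif_pos h.1, genOrZero, dif_pos h.2.1,
      circOrZero_eq h.2.2.2.1 h.2.2.2.2 h.2.2.1]
    rfl
  · rw [genCirc_eq_zero (x := (p, q, i)) h, smul_zero]

theorem d_genOrZero {p M : ℕ} {b : ℤ} (hb : b + 1 = (p : ℤ) - 2) (hM : p ≤ M) :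
    d k hb (genOrZero k p) = ∑ x ∈ triples M, (-1 : k) ^ genSign x • genCirc k p b x := by
  by_cases hp : 2 ≤ p
  · rw [genOrZero, dif_pos hp, d_mon, dExpr, dGen_eq _ hM]
  · rw [genOrZero, dif_neg hp, map_zero]
    refine (Finset.sum_eq_zero fun x _ => ?_).symm
    rw [genCirc_eq_zero, smul_zero]
    unfold IsGenCirc
    omega

variable (k) in
/-- The term of `d (d m_N)` given by `(m_a ∘_j m_b) ∘_i m_q`, where `p + 1 = a + b`. -/
noncomputable def leftTerm (N : ℕ) (e : ℤ) (x : (ℕ × ℕ × ℕ) × (ℕ × ℕ × ℕ)) : Obj k N e :=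
  (-1 : k) ^ (genSign x.1 + genSign x.2) •
    circOrZero N e x.1.2.2 (genCirc k x.1.1 ((x.1.1 : ℤ) - 3) x.2) (genOrZero k x.1.2.1)

variable (k) in
/-- The term of `d (d m_N)` given by `m_p ∘_i (m_b ∘_l m_c)`, where `q + 1 = b + c`. -/
noncomputable def rightTerm (N : ℕ) (e : ℤ) (x : (ℕ × ℕ × ℕ) × (ℕ × ℕ × ℕ)) : Obj k N e :=
  (-1 : k) ^ (genSign x.1 + x.1.1 + genSign x.2) •
    circOrZero N e x.1.2.2 (genOrZero k x.1.1) (genCirc k x.1.2.1 ((x.1.2.1 : ℤ) - 3) x.2)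

theorem neg_one_pow_add_eq_zero {e f : ℕ} (h : (e : ZMod 2) + f = 1) :
    (-1 : k) ^ e + (-1) ^ f = 0 := by
  have h1 : Odd (e + f) := by
    rw [← ZMod.natCast_eq_one_iff_odd]
    exact_mod_cast h
  have h2 : (-1 : k) ^ e * (-1) ^ f = -1 := by rw [← pow_add, h1.neg_one_pow]
  rcases neg_one_pow_eq_or k e with h3 | h3 <;> rw [h3] at h2 ⊢
  · linear_combination h2
  · linear_combination -h2

theorem circOrZero_sequential {l m n P Q N : ℕ} {a b c f g e : ℤ} {i j r : ℕ} (hj : 1 ≤ j)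
    (hjl : j ≤ l) (hr : 1 ≤ r) (hrm : r ≤ m) (hi : i + 1 = j + r) (hP : l + m = P + 1)
    (hQ : m + n = Q + 1) (hN : P + n = N + 1) (hf : a + b = f) (hg : b + c = g) (he : f + c = e)
    (x : Obj k l a) (y : Obj k m b) (z : Obj k n c) :
    circOrZero N e i (circOrZero P f j x y) z = circOrZero N e j x (circOrZero Q g r y z) := by
  obtain rfl : r = i - j + 1 := by omega
  rw [circOrZero_eq hj hjl hP hf, circOrZero_eq (by omega) (by omega) hN he,
    circOrZero_eq (by omega) (by omega) hQ hg, circOrZero_eq hj hjl (by omega) (by omega)]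
  exact sequential j i hj hjl (by omega) (by omega) hP hQ hN hf hg he x y z

theorem circOrZero_parallel {l m n P Q N : ℕ} {a b c f g e : ℤ} {i i' j : ℕ} (hj : 1 ≤ j)
    (hji : j < i) (hil : i ≤ l) (hi' : i' + 1 = i + n) (hP : l + m = P + 1) (hQ : l + n = Q + 1)
    (hN : P + n = N + 1) (hf : a + b = f) (hg : a + c = g) (he : f + c = e)
    (x : Obj k l a) (y : Obj k m b) (z : Obj k n c) :
    circOrZero N e j (circOrZero P f i x y) z =
      (b * c).negOnePow • circOrZero N e i' (circOrZero Q g j x z) y := by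
  by_cases hn : i' = i + n - 1
  · subst hn
    rw [circOrZero_eq (by omega) hil hP hf, circOrZero_eq (by omega) (by omega) hN he,
      circOrZero_eq hj (by omega) hQ hg, circOrZero_eq (by omega) (by omega) (by omega) (by omega)]
    exact parallel i j hj hji hil hP hQ hN hf hg he x y z
  · omega

/-- The two compositions agree by the sequential law, and their sign exponents have opposite parity.
-/
theorem leftTerm_add_rightTerm {N a b c i j r : ℕ} {e : ℤ} (he : e + 4 = N) (hj : 1 ≤ j)
    (hja : j ≤ a) (hr : 1 ≤ r) (hrb : r ≤ b) (hi : i + 1 = j + r) (hN : a + b + c = N + 2)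
    (hc : 1 ≤ c) :
    leftTerm k N e ((a + b - 1, c, i), (a, b, j)) +
      rightTerm k N e ((a, b + c - 1, j), (b, c, r)) = 0 := by
  rw [leftTerm, rightTerm, genCirc, genCirc]
  dsimp only
  rw [circOrZero_sequential (Q := b + c - 1) (g := ((b + c - 1 : ℕ) : ℤ) - 3) hj hja hr hrb hi
    (by omega) (by omega) (by omega) (by omega) (by omega) (by omega), ← add_smul,
    neg_one_pow_add_eq_zero, zero_smul]
  -- Writing the variables as sums removes truncated subtraction, so the parity claim becomes a
  -- polynomial identity modulo `2`.
  obtain ⟨j, rfl⟩ := Nat.exists_eq_add_of_le' hj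
  obtain ⟨r, rfl⟩ := Nat.exists_eq_add_of_le' hr
  obtain ⟨a, rfl⟩ := Nat.exists_eq_add_of_le hja
  obtain ⟨b, rfl⟩ := Nat.exists_eq_add_of_le hrb
  obtain ⟨c, rfl⟩ := Nat.exists_eq_add_of_le' hc
  obtain rfl : i = j + r + 1 := by omega
  simp only [genSign, show j + 1 + a + (r + 1 + b) - 1 - (j + r + 1) = a + b by omega,
    show r + 1 + b + (c + 1) - 1 = r + b + c + 1 by omega, Nat.add_sub_cancel,
    Nat.add_sub_cancel_left]
  push_cast
  have h2 : (2 : ZMod 2) = 0 := rfl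
  linear_combination (2 * j + r + a + (c + 1) * (a + b) + (r + b) * a) * h2

/-- Here `m_b` and `m_c` are inserted at different inputs of `m_a`. The parallel law exchanges them
with the sign `(-1) ^ (b * c)`, and the remaining exponents then have opposite parity. -/
theorem leftTerm_add_leftTerm {N a b c i j i' : ℕ} {e : ℤ} (he : e + 4 = N) (hj : 1 ≤ j)
    (hji : j < i) (hia : i ≤ a) (hi' : i' + 1 = i + c) (hN : a + b + c = N + 2)
    (hb : 1 ≤ b) (hc : 1 ≤ c) :
    leftTerm k N e ((a + b - 1, c, j), (a, b, i)) +
      leftTerm k N e ((a + c - 1, b, i'), (a, c, j)) = 0 := by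
  rw [leftTerm, leftTerm, genCirc, genCirc]
  dsimp only
  have hs : (((b : ℤ) - 2) * ((c : ℤ) - 2)).negOnePow = ((b * c : ℕ) : ℤ).negOnePow :=
    (Int.negOnePow_eq_iff _ _).2 ⟨2 - b - c, by push_cast; ring⟩
  rw [circOrZero_parallel (Q := a + c - 1) (g := ((a + c - 1 : ℕ) : ℤ) - 3) hj hji hia hi'
    (by omega) (by omega) (by omega) (by omega) (by omega) (by omega), hs,
    ← FreeWords.negOnePow_smul (k := k), smul_smul, ← pow_add, ← add_smul,
    neg_one_pow_add_eq_zero, zero_smul]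
  obtain ⟨j, rfl⟩ := Nat.exists_eq_add_of_le' hj
  obtain ⟨i, rfl⟩ := Nat.exists_eq_add_of_lt hji
  obtain ⟨a, rfl⟩ := Nat.exists_eq_add_of_le hia
  obtain ⟨b, rfl⟩ := Nat.exists_eq_add_of_le' hb
  obtain ⟨c, rfl⟩ := Nat.exists_eq_add_of_le' hc
  obtain rfl : i' = j + i + c + 2 := by omega
  simp only [genSign, show j + 1 + i + 1 + a + (b + 1) - 1 - (j + 1) = i + a + b + 1 by omega,
    show j + 1 + i + 1 + a + (c + 1) - 1 - (j + i + c + 2) = a by omega,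
    show j + 1 + i + 1 + a - (j + 1) = i + a + 1 by omega,
    show j + i + c + 2 - 1 = j + i + c + 1 by omega, Nat.add_sub_cancel,
    Nat.add_sub_cancel_left]
  push_cast
  have h2 : (2 : ZMod 2) = 0 := rfl
  linear_combination
    (2 + 2 * j + 2 * c + c * i + c * a + c * b + 2 * i + 2 * a + a * b + b) * h2


/-- The matching of the terms of `d (d m_N)` that cancel. -/
def cancel : ((ℕ × ℕ × ℕ) × (ℕ × ℕ × ℕ)) ⊕ ((ℕ × ℕ × ℕ) × (ℕ × ℕ × ℕ)) →
    ((ℕ × ℕ × ℕ) × (ℕ × ℕ × ℕ)) ⊕ ((ℕ × ℕ × ℕ) × (ℕ × ℕ × ℕ))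
  | .inl ((_, c, i), (a, b, j)) =>
      if i < j then .inl ((a + c - 1, b, j + c - 1), (a, c, i))
      else if i < j + b then .inr ((a, b + c - 1, j), (b, c, i + 1 - j))
      else .inl ((a + c - 1, b, j), (a, c, i + 1 - b))
  | .inr ((p, _, j), (b, c, r)) => .inl ((p + b - 1, c, j + r - 1), (p, b, j))

-- Once the undefined compositions are discarded, `cancel` is an involution without fixed points
-- that pairs opposite terms. In `(m_a ∘_j m_b) ∘_i m_c` the input `i` belongs to `m_b`, which gives
-- a nested term by the sequential law, or lies to the left or right of it, which gives the term
-- with `m_b` and `m_c` inserted in the other order.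
open Classical in
theorem sum_leftTerm_add_sum_rightTerm {N : ℕ} {e : ℤ} (he : e + 4 = N) :
    ∑ x ∈ triples N ×ˢ triples N, leftTerm k N e x +
      ∑ x ∈ triples N ×ˢ triples N, rightTerm k N e x = 0 := by
  have hl : ∑ x ∈ triples N ×ˢ triples N, leftTerm k N e x =
      ∑ x ∈ (triples N ×ˢ triples N).filter fun x => IsGenCirc N x.1 ∧ IsGenCirc x.1.1 x.2,
        leftTerm k N e x := by
    refine (Finset.sum_filter_of_ne fun x _ hx => ?_).symm
    contrapose! hx
    rw [leftTerm]
    by_cases h : IsGenCirc x.1.1 x.2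
    · have h1 : ¬ IsGenCirc N x.1 := fun h' => hx h' h
      by_cases h2 : 2 ≤ x.1.2.1
      · unfold IsGenCirc at h h1
        rw [circOrZero, dif_neg (by omega)]
        simp
      · rw [genOrZero_of_lt h2, map_zero, smul_zero]
    · rw [genCirc_eq_zero h, map_zero, LinearMap.zero_apply, smul_zero]
  have hr : ∑ x ∈ triples N ×ˢ triples N, rightTerm k N e x =
      ∑ x ∈ (triples N ×ˢ triples N).filter fun x => IsGenCirc N x.1 ∧ IsGenCirc x.1.2.1 x.2,
        rightTerm k N e x := by
    refine (Finset.sum_filter_of_ne fun x _ hx => ?_).symm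
    contrapose! hx
    rw [rightTerm]
    by_cases h : IsGenCirc x.1.2.1 x.2
    · have h1 : ¬ IsGenCirc N x.1 := fun h' => hx h' h
      by_cases h2 : 2 ≤ x.1.1
      · unfold IsGenCirc at h h1
        rw [circOrZero, dif_neg (by omega)]
        simp
      · rw [genOrZero_of_lt h2, map_zero, LinearMap.zero_apply, smul_zero]
    · rw [genCirc_eq_zero h, map_zero, smul_zero]
  rw [hl, hr]
  have h := Finset.sum_disjSum
    ((triples N ×ˢ triples N).filter fun x => IsGenCirc N x.1 ∧ IsGenCirc x.1.1 x.2)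
    ((triples N ×ˢ triples N).filter fun x => IsGenCirc N x.1 ∧ IsGenCirc x.1.2.1 x.2)
    (Sum.elim (leftTerm k N e) (rightTerm k N e))
  simp only [Sum.elim_inl, Sum.elim_inr] at h
  rw [← h]
  refine Finset.sum_involution (fun x _ => cancel x) ?_ ?_ ?_ ?_
  · rintro (⟨⟨p, c, i⟩, ⟨a, b, j⟩⟩ | ⟨⟨p, q, j⟩, ⟨b, c, r⟩⟩) hx
    · simp only [Finset.inl_mem_disjSum, Finset.mem_filter] at hx
      simp only [IsGenCirc] at hx
      obtain rfl : p = a + b - 1 := by omega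
      simp only [cancel]
      split_ifs with h1 h2
      · exact leftTerm_add_leftTerm he (by omega) h1 (by omega) (by omega) (by omega) (by omega)
          (by omega)
      · exact leftTerm_add_rightTerm he (by omega) (by omega) (by omega) (by omega) (by omega)
          (by omega) (by omega)
      · have h3 := leftTerm_add_leftTerm (k := k) he (a := a) (b := c) (c := b) (i := i + 1 - b)
          (j := j) (i' := i) (by omega) (by omega) (by omega) (by omega) (by omega) (by omega)
          (by omega)
        rw [add_comm]
        exact h3
    · simp only [Finset.inr_mem_disjSum, Finset.mem_filter] at hx
      simp only [IsGenCirc] at hx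
      obtain rfl : q = b + c - 1 := by omega
      have h3 := leftTerm_add_rightTerm (k := k) he (a := p) (b := b) (c := c) (i := j + r - 1)
          (j := j) (r := r) (by omega) (by omega) (by omega) (by omega) (by omega) (by omega)
          (by omega)
      rw [add_comm]
      exact h3
  · rintro (⟨⟨p, c, i⟩, ⟨a, b, j⟩⟩ | ⟨⟨p, q, j⟩, ⟨b, c, r⟩⟩) hx - he
    · simp only [Finset.inl_mem_disjSum, Finset.mem_filter] at hx
      simp only [IsGenCirc] at hx
      simp only [cancel] at he
      split_ifs at he with h1 h2
      · simp only [Sum.inl.injEq, Prod.mk.injEq] at he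
        omega
      · simp only [Sum.inl.injEq, Prod.mk.injEq] at he
        omega
    · simp [cancel] at he
  · rintro (⟨⟨p, c, i⟩, ⟨a, b, j⟩⟩ | ⟨⟨p, q, j⟩, ⟨b, c, r⟩⟩) hx
    · simp only [Finset.inl_mem_disjSum, Finset.mem_filter, Finset.mem_product,
        mem_triples] at hx
      simp only [IsGenCirc] at hx
      simp only [cancel]
      split_ifs with h1 h2 <;> simp only [Finset.inl_mem_disjSum, Finset.inr_mem_disjSum,
        Finset.mem_filter, Finset.mem_product, mem_triples] <;> simp only [IsGenCirc] <;> omega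
    · simp only [Finset.inr_mem_disjSum, Finset.mem_filter, Finset.mem_product,
        mem_triples] at hx
      simp only [IsGenCirc] at hx
      simp only [cancel, Finset.inl_mem_disjSum, Finset.mem_filter, Finset.mem_product,
        mem_triples]
      simp only [IsGenCirc]
      omega
  · rintro (⟨⟨p, c, i⟩, ⟨a, b, j⟩⟩ | ⟨⟨p, q, j⟩, ⟨b, c, r⟩⟩) hx
    · simp only [Finset.inl_mem_disjSum, Finset.mem_filter] at hx
      simp only [IsGenCirc] at hx
      simp only [cancel]
      split_ifs with h1 h2
      · dsimp only
        rw [if_neg (by omega), if_neg (by omega)]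
        simp only [Sum.inl.injEq, Prod.mk.injEq, and_true, true_and]
        omega
      · dsimp only
        simp only [Sum.inl.injEq, Prod.mk.injEq, and_true, true_and]
        omega
      · dsimp only
        rw [if_pos (by omega)]
        simp only [Sum.inl.injEq, Prod.mk.injEq, and_true, true_and]
        omega
    · simp only [Finset.inr_mem_disjSum, Finset.mem_filter] at hx
      simp only [IsGenCirc] at hx
      simp only [cancel]
      rw [if_neg (by omega), if_pos (by omega)]
      simp only [Sum.inr.injEq, Prod.mk.injEq, and_true, true_and]
      omega

/-- By the Leibniz rule, differentiating the outer factor of each `m_p ∘_i m_q` gives the terms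
`leftTerm`, and differentiating the inner factor gives the terms `rightTerm`, with the sign `(-1) ^
p` because `m_p` has degree `p - 2`. -/
theorem d_dGen {n : ℕ} {b c : ℤ} (hb : b + 3 = n) (hc : c + 1 = b) :
    d k hc (dGen k n b hb) = 0 := by
  rw [← sum_leftTerm_add_sum_rightTerm (k := k) (N := n) (e := c) (by omega), dGen_eq hb le_rfl,
    map_sum, Finset.sum_product, Finset.sum_product, ← Finset.sum_add_distrib]
  refine Finset.sum_congr rfl fun x hx => ?_
  rw [mem_triples] at hx
  have hs : ((x.1 : ℤ) - 2).negOnePow = (x.1 : ℤ).negOnePow :=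
    (Int.negOnePow_eq_iff _ _).2 ⟨-1, by ring⟩
  rw [map_smul, genCirc, d_circOrZero _ (a' := (x.1 : ℤ) - 3) (b' := (x.2.1 : ℤ) - 3) (by omega)
    (by omega), d_genOrZero _ hx.1, d_genOrZero _ hx.2.1, map_sum, map_sum, LinearMap.sum_apply,
    hs, ← FreeWords.negOnePow_smul (k := k), smul_add, Finset.smul_sum, Finset.smul_sum,
    Finset.smul_sum]
  congr 1
  · refine Finset.sum_congr rfl fun y _ => ?_
    rw [map_smul, LinearMap.smul_apply, smul_smul, ← pow_add, leftTerm]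
  · refine Finset.sum_congr rfl fun y _ => ?_
    rw [map_smul, smul_smul, smul_smul, ← pow_add, ← pow_add, rightTerm]

theorem d_dExpr {n : ℕ} {a : ℤ} (x : AExpr n a) : ∀ (b c : ℤ) (hb : b + 1 = a) (hc : c + 1 = b),
    d k hc (dExpr k x b hb) = 0 := by
  induction x with
  | one => intro b c hb hc; rw [dExpr, map_zero]
  | gen n a hn ha => intro b c hb hc; rw [dExpr, d_dGen]
  | @circ m n p a b c i hi him hp hc x y ihx ihy =>
    intro e f he hf
    -- The two mixed terms, with both factors differentiated, carry the signs of degrees `a - 1` and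
    -- `a` and cancel.
    rw [dExpr, map_add, map_units_smul, leibniz i hi him hp _ (a' := a - 2) (b' := b - 1)
      (by omega) (by omega), leibniz i hi him hp _ (a' := a - 1) (b' := b - 2) (by omega)
      (by omega), ihx, ihy, d_mon, d_mon, Int.negOnePow_sub]
    simp

theorem isDGOperad (k : Type u) [CommRing k] : (AInf k).IsDGOperad where
  d_d hab hbc x := by
    refine induction_mon x (by simp) (fun x y hx hy => ?_) (fun r x hx => ?_) (fun x => ?_)
    · rw [map_add, map_add, hx, hy, add_zero]
    · rw [map_smul, map_smul, hx, smul_zero]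
    · change d k hbc (d k hab (mon k x)) = 0
      rw [d_mon, d_dExpr]
  leibniz := leibniz
  one_circ := one_circ
  circ_one := circ_one
  parallel := parallel
  sequential := sequential

end AInf

/-! The universal property of `A_∞`. -/

/-- The Leibniz rule for `1 = 1 ∘_1 1` gives `d 1 = d 1 + d 1`. -/
theorem DGOperadData.IsDGOperad.d_one {k : Type u} [CommRing k] {O : DGOperadData k}
    (hO : O.IsDGOperad) {b : ℤ} (hb : b + 1 = 0) : O.d hb O.one = 0 := by
  have h := hO.leibniz (p := 1) (c := 0) 1 le_rfl le_rfl rfl (by omega) hb hb hb O.one O.one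
  rw [hO.one_circ, Int.negOnePow_zero, one_smul] at h
  have h1 := hO.circ_one 1 le_rfl le_rfl (O.d hb O.one)
  have h2 := hO.one_circ (O.d hb O.one)
  rw [h1, h2] at h
  simpa using h

namespace AInf

variable {k : Type u} [CommRing k] {O : DGOperadData k}

/-- The value of a monomial in an operad, given the values of the generators. -/
noncomputable def eval (g : ∀ (n : ℕ) (a : ℤ), 2 ≤ n → a + 2 = n → O.obj n a) :
    ∀ {n : ℕ} {a : ℤ}, AExpr n a → O.obj n a
  | _, _, .one => O.one
  | _, _, .gen n a hn ha => g n a hn ha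
  | _, _, .circ i hi him hp hc x y => O.circ i hi him hp hc (eval g x) (eval g y)

variable {g : ∀ (n : ℕ) (a : ℤ), 2 ≤ n → a + 2 = n → O.obj n a}

theorem eval_rel (hO : O.IsDGOperad) {n : ℕ} {a : ℤ} {x y : AExpr n a} {s : ℤˣ}
    (h : AExpr.Rel x y s) : eval g x = s • eval g y := by
  induction h with
  | one_circ x => rw [one_smul]; exact hO.one_circ _
  | circ_one i hi hin x => rw [one_smul]; exact hO.circ_one i hi hin _
  | parallel i j hj hji hil hp hq hr he hf hg x y z =>
    exact hO.parallel i j hj hji hil hp hq hr he hf hg _ _ _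
  | sequential i j hi hil hij hjm hp hq hr he hf hg x y z =>
    rw [one_smul]
    exact hO.sequential i j hi hil hij hjm hp hq hr he hf hg _ _ _
  | congr_left i hi him hp hc x x' s y h ih =>
    rw [eval, ih, map_units_smul, units_smul_apply, eval]
  | congr_right i hi him hp hc x y y' s h ih =>
    rw [eval, ih, map_units_smul, eval]

/-- The linear extension of `eval`. -/
noncomputable def evalMap (hO : O.IsDGOperad)
    (g : ∀ (n : ℕ) (a : ℤ), 2 ≤ n → a + 2 = n → O.obj n a) {n : ℕ} {a : ℤ} :
    Obj k n a →ₗ[k] O.obj n a :=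
  lift (eval g) fun _ _ _ h => eval_rel hO h

theorem evalMap_mon (hO : O.IsDGOperad) {n : ℕ} {a : ℤ} (x : AExpr n a) :
    evalMap hO g (mon k x) = eval g x :=
  lift_mon _ _ x

theorem evalMap_circ (hO : O.IsDGOperad) {m n p : ℕ} {a b c : ℤ} (i : ℕ) (hi : 1 ≤ i)
    (him : i ≤ m) (hp : m + n = p + 1) (hc : a + b = c) (x : Obj k m a) (y : Obj k n b) :
    evalMap hO g (circ k i hi him hp hc x y) =
      O.circ i hi him hp hc (evalMap hO g x) (evalMap hO g y) := by
  refine induction_mon x (by simp) (fun x x' hx hx' => ?_) (fun r x hx => ?_) (fun x => ?_)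
  · simp only [map_add, LinearMap.add_apply, hx, hx']
  · simp only [map_smul, LinearMap.smul_apply, hx]
  refine induction_mon y (by simp) (fun x x' hx hx' => ?_) (fun r x hx => ?_) (fun y => ?_)
  · simp only [map_add, hx, hx']
  · simp only [map_smul, hx]
  rw [circ_mon, evalMap_mon, evalMap_mon, evalMap_mon, eval]

/-- The differentials of the values of the generators are those required by `A_∞`. -/
def IsAInfFamily (g : ∀ (n : ℕ) (a : ℤ), 2 ≤ n → a + 2 = n → O.obj n a) : Prop :=
  ∀ (n : ℕ) (a b : ℤ) (hn : 2 ≤ n) (ha : a + 2 = n) (hb : b + 1 = a), O.d hb (g n a hn ha) =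
    ∑ p ∈ Finset.range (n + 1), ∑ q ∈ Finset.range (n + 1), ∑ i ∈ Finset.range (n + 1),
      if h : 2 ≤ p ∧ 2 ≤ q ∧ p + q = n + 1 ∧ 1 ≤ i ∧ i ≤ p then
        ((-1 : k) ^ ((i - 1) + q * (p - i))) •
          O.circ i h.2.2.2.1 h.2.2.2.2 h.2.2.1 (by omega)
            (g p (p - 2) h.1 (by omega)) (g q (q - 2) h.2.1 (by omega))
      else 0

/-- Both sides obey the Leibniz rule and vanish on the unit, so it is enough that they agree on
generators. -/
theorem evalMap_dExpr (hO : O.IsDGOperad) (hg : IsAInfFamily g) {n : ℕ} {a : ℤ} (x : AExpr n a) :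
    ∀ (b : ℤ) (hb : b + 1 = a), evalMap hO g (dExpr k x b hb) = O.d hb (eval g x) := by
  induction x with
  | one => intro b hb; rw [dExpr, map_zero, eval, hO.d_one]
  | gen n a hn ha =>
    intro b hb
    rw [dExpr, eval, hg, dGen]
    simp only [map_sum]
    refine Finset.sum_congr rfl fun p _ => Finset.sum_congr rfl fun q _ =>
      Finset.sum_congr rfl fun i _ => ?_
    split_ifs
    · rw [map_smul, evalMap_circ, evalMap_mon, evalMap_mon, eval, eval]
    · rw [map_zero]
  | @circ m n p a b c i hi him hp hc x y ihx ihy =>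
    intro e he
    rw [dExpr, map_add, map_units_smul, evalMap_circ, evalMap_circ, ihx, ihy, evalMap_mon,
      evalMap_mon, eval, hO.leibniz (a' := a - 1) (b' := b - 1) i hi him hp hc (by omega) (by omega) he]

/-- The morphism from `A_∞` with given values of the generators. -/
noncomputable def evalHom (hO : O.IsDGOperad) (hg : IsAInfFamily g) :
    DGOperadData.Hom (AInf k) O where
  map := evalMap hO g
  map_one := by rw [evalMap_mon, eval]
  map_circ i hi him hp hc x y := evalMap_circ hO i hi him hp hc x y
  map_d h x := by
    refine induction_mon x (by simp) (fun x y hx hy => ?_) (fun r x hx => ?_) (fun x => ?_)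
    · simp only [map_add, hx, hy]
    · simp only [map_smul, hx]
    · rw [evalMap_mon, ← evalMap_dExpr hO hg]
      exact congrArg _ (d_mon h x)

end AInf

/-! ### The morphism from `A_∞` to the operad of cacti. -/

namespace FreeWords

variable {k : Type u} [CommRing k]

theorem diff_mu {n : ℕ} (hn : 2 ≤ n) : diff (mu k (n - 2)) =
    ∑ p ∈ Finset.range (n + 1), ∑ q ∈ Finset.range (n + 1), ∑ i ∈ Finset.range (n + 1),
      if 2 ≤ p ∧ 2 ≤ q ∧ p + q = n + 1 ∧ 1 ≤ i ∧ i ≤ p then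
        ((-1 : k) ^ ((i - 1) + q * (p - i))) • comp i q (mu k (p - 2)) (mu k (q - 2)) else 0 := by
  obtain ⟨m, rfl⟩ := Nat.exists_eq_add_of_le' hn
  rw [Nat.add_sub_cancel]
  rcases m with _ | m
  · rw [diff_mu_zero]
    refine (Finset.sum_eq_zero fun p _ => Finset.sum_eq_zero fun q _ =>
      Finset.sum_eq_zero fun i _ => if_neg (by omega)).symm
  have h : ∑ x ∈ Finset.range (m + 1 + 2 + 1) ×ˢ Finset.range (m + 1 + 2 + 1) ×ˢ
      Finset.range (m + 1 + 2 + 1),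
      (if 2 ≤ x.1 ∧ 2 ≤ x.2.1 ∧ x.1 + x.2.1 = m + 1 + 2 + 1 ∧ 1 ≤ x.2.2 ∧ x.2.2 ≤ x.1 then
        ((-1 : k) ^ ((x.2.2 - 1) + x.2.1 * (x.1 - x.2.2))) •
          comp x.2.2 x.2.1 (mu k (x.1 - 2)) (mu k (x.2.1 - 2)) else 0) =
      ∑ c ∈ Finset.HasAntidiagonal.antidiagonal m, ∑ i ∈ Finset.range (c.1 + 2),
        muTerm k c.1 c.2 i := by
    rw [← Finset.sum_filter, Finset.sum_sigma']
    refine Finset.sum_nbij' (fun x => ⟨(x.1 - 2, x.2.1 - 2), x.2.2 - 1⟩)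
      (fun y => (y.1.1 + 2, y.1.2 + 2, y.2 + 1)) ?_ ?_ ?_ ?_ ?_
    · rintro ⟨p, q, i⟩ hx
      simp only [Finset.mem_filter, Finset.mem_product, Finset.mem_range, Finset.mem_sigma,
        Finset.HasAntidiagonal.mem_antidiagonal] at hx ⊢
      omega
    · rintro ⟨⟨a, b⟩, i⟩ hx
      simp only [Finset.mem_filter, Finset.mem_product, Finset.mem_range, Finset.mem_sigma,
        Finset.HasAntidiagonal.mem_antidiagonal] at hx ⊢
      omega
    · rintro ⟨p, q, i⟩ hx
      simp only [Finset.mem_filter] at hx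
      simp only [Prod.mk.injEq]
      omega
    · rintro ⟨⟨a, b⟩, i⟩ -
      simp
    · rintro ⟨p, q, i⟩ hx
      simp only [Finset.mem_filter] at hx
      obtain ⟨p, rfl⟩ := Nat.exists_eq_add_of_le' hx.2.1
      obtain ⟨q, rfl⟩ := Nat.exists_eq_add_of_le' hx.2.2.1
      obtain ⟨i, rfl⟩ := Nat.exists_eq_add_of_le' hx.2.2.2.2.1
      simp only [Nat.add_sub_cancel, muTerm, show p + 2 - (i + 1) = p + 1 - i by omega]
      -- The exponent in `muTerm` uses `b` in place of the arity `q = b + 2`; the difference is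
      -- even.
      rw [add_mul, ← add_assoc, pow_add _ _ (2 * _), pow_mul _ 2]
      simp
  rw [diff_mu_succ, ← h, Finset.sum_product]
  simp only [Finset.sum_product]

theorem toSeq_mu {n : ℕ} (hn : 2 ≤ n) : toSeq n ((n : ℤ) - 2) (mu k (n - 2)) =
    ∑ u ∈ Cactus.admissible n, ((-1 : k) ^ Cactus.signExp n u.1) • Finsupp.single u 1 := by
  rw [mu_eq_sum, Nat.sub_add_cancel hn, Cactus.admissibleWords, Finset.sum_map, map_sum]
  refine Finset.sum_congr rfl fun u _ => ?_
  rw [map_smul, Function.Embedding.coe_subtype, toSeq_word]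

theorem toSeq_mu_mem {n : ℕ} {a : ℤ} (hn : 2 ≤ n) (ha : a + 2 = n) :
    toSeq n a (mu k (n - 2)) ∈ Cactus.span k n a := by
  obtain rfl : a = (n : ℤ) - 2 := by omega
  rw [toSeq_mu hn]
  refine Submodule.sum_mem _ fun u hu => Submodule.smul_mem _ _ ?_
  refine Finsupp.single_mem_supported k _ ?_
  rw [Cactus.admissible, Set.Finite.mem_toFinset] at hu
  exact hu.1

/-- The images of the generators of `A_∞` in the operad of cacti. -/
noncomputable def cactusMu (k : Type u) [CommRing k] (n : ℕ) (a : ℤ) (hn : 2 ≤ n)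
    (ha : a + 2 = n) : (cactusOperad k).obj n a :=
  ⟨toSeq n a (mu k (n - 2)), toSeq_mu_mem hn ha⟩

theorem mu_sub_mem {n : ℕ} {a : ℤ} (hn : 2 ≤ n) (ha : a + 2 = n) :
    mu k (n - 2) ∈ spanOf k (IsWordOf n a) := by
  obtain ⟨m, rfl⟩ := Nat.exists_eq_add_of_le' hn
  obtain rfl : a = m := by push_cast at ha; omega
  exact mu_isWordOf m

/-- The relation holds already for words, by `diff_mu`; replacing words by their classes changes
differentials and compositions only by degenerate words. -/
theorem cactusMu_isAInfFamily (k : Type u) [CommRing k] : AInf.IsAInfFamily (cactusMu k) := by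
  intro n a b hn ha hb
  refine Subtype.ext ?_
  change (Surj.d k (toSeq n a (mu k (n - 2))) : Surj.Seq n b →₀ k) = _
  rw [surj_d, toSeq_diff_ofSeq (mu_sub_mem hn ha), diff_mu hn]
  simp only [map_sum, Submodule.coe_sum]
  refine Finset.sum_congr rfl fun p _ => Finset.sum_congr rfl fun q _ =>
    Finset.sum_congr rfl fun i _ => ?_
  split_ifs with h
  · obtain ⟨hp, hq, hpq, hi, hip⟩ := h
    rw [map_smul, Submodule.coe_smul]
    congr 1
    change _ = (Surj.circ k i (toSeq p _ (mu k (p - 2))) (toSeq q _ (mu k (q - 2))) :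
      Surj.Seq n b →₀ k)
    rw [surj_circ, toSeq_comp_left (mu_sub_mem hp (by omega)),
      toSeq_comp_right hi hip (mu_sub_mem hp (a := (p : ℤ) - 2) (by omega))
        (mu_sub_mem hq (by omega))]
  · rw [map_zero]
    rfl

end FreeWords

/-- The generator `m_2` is sent to the symmetrised cup product `(2,1) + (1,2)`, and `m_n` to the
signed sum of the cacti in `C'_n`. -/
theorem theorem1 (k : Type u) [CommRing k] :
    (AInf k).IsDGOperad ∧ (cactusOperad k).IsDGOperad ∧
      ∃ ψ : DGOperadData.Hom (AInf k) (cactusOperad k),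
        (ψ.map (AInf.m k 2 le_rfl)).1 = Surj.basis k 2 _ [2, 1] + Surj.basis k 2 _ [1, 2] ∧
        ∀ (n : ℕ) (hn : 2 ≤ n), (ψ.map (AInf.m k n hn)).1 =
          ∑ u ∈ Cactus.admissible n, ((-1 : k) ^ Cactus.signExp n u.1) • Finsupp.single u 1 := by
  have h : ∀ (n : ℕ) (hn : 2 ≤ n), ((AInf.evalHom (cactusOperad_isDGOperad k)
      (FreeWords.cactusMu_isAInfFamily k)).map (AInf.m k n hn)).1 =
        FreeWords.toSeq n ((n : ℤ) - 2) (FreeWords.mu k (n - 2)) := by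
    intro n hn
    have h := AInf.evalMap_mon (g := FreeWords.cactusMu k) (cactusOperad_isDGOperad k)
      (.gen n (n - 2) hn (by omega))
    rw [AInf.eval] at h
    exact congrArg Subtype.val h
  refine ⟨AInf.isDGOperad k, cactusOperad_isDGOperad k, AInf.evalHom (cactusOperad_isDGOperad k)
    (FreeWords.cactusMu_isAInfFamily k), ?_, fun n hn => ?_⟩
  · rw [h, FreeWords.mu, map_add, add_comm]
    simp [FreeWords.toSeq, FreeWords.lin_word]
  · rw [h, FreeWords.toSeq_mu hn]
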